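/- **Model.** A transmitter has a buffer of capacity $K\in\{1,2,\dots\}\cup\{\infty\}$. In slot $n$, $a[n]$ packets arrive and the channel is in state $h[n]\in\{1,\dots,W\}$ ($W\ge 1$). The variables $a[n]$ are i.i.d. with $\Pr\{a[n]=m\}=\theta_m$, $0\le m\le M$ ($M\ge 1$) and mean $\bar a=\sum_m m\theta_m>0$; the variables $h[n]$ are i.i.d. with $\Pr\{h[n]=w\}=\eta_w$, and are independent of the arrivals. Sending one packet in channel state $w$ costs power $P_w$, where $P_1>P_2>\dots>P_W>0$. A probabilistic scheduling policy is a family $f=\{f_{t,w}\}$ in $[0,1]$ with $f_{0,w}=0$ and $f_{t,w}=0$ for $t>K$: if $q[n-1]+a[n]=t$ and $h[n]=w$, then $s[n]=1$ packet is sent with probability $f_{t,w}$, and otherwise $s[n]=0$. The queue length evolves by $q[n]=\max\{\min\{q[n-1]+a[n],K\}-s[n],0\}$. For a stationary distribution $\pi=(\pi_k)_{0\le k\le K}$ of this Markov chain, the average delay and the average power are $$D=\frac1{\bar a}\sum_k k\,\pi_k\in[0,\infty],\qquad P=\sum_k\pi_k\sum_{w=1}^W\eta_wP_w\sum_{m=0}^M\theta_m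 f_{k+m,w}.$$ Given a power budget $P_{aver}$, a pair $(f,\pi)$ is feasible if $f$ is a policy, $\pi$ is stationary under $f$, $P\le P_{aver}$, and no packet overflow occurs, i.e. $k+m\le K$ whenever $\pi_k>0$ and $\theta_m>0$ (no restriction if $K=\infty$). A feasible pair is optimal if $D$ is minimal among all feasible pairs. Suppose that a feasible pair exists. **Theorem 5.** (I) There is an optimal pair $(f^*,\pi^*)$ whose policy is a dual-threshold policy with at most one randomized threshold state. Precisely: (1) a) for every queue length $0\le k\le K$ ($k<\infty$) there is a channel threshold $T_k^*\in\{0,1,\dots,W\}$ such that, for $1\le w\le W$, $f^*_{k,w}=0$ if $w<T^*_k$ and $f^*_{k,w}=1$ if $w>T_k^*$; likewise, for every channel state $w$ there is a queue threshold $I_w^*\in\{0,1,\dots\}\cup\{\infty\}$, $I_w^*\le K$, such that, for $0\le k\le K$, $f^*_{k,w}=0$ if $k<I_w^*$ and $f^*_{k,w}=1$ if $k>I_w^*$; b) $T_k^*\ge T_l^*$ whenever $1\le k\le l\le K$. (2) There is at most one threshold state $(k^\star,w^\star)$, $w^\star=T^*_{k^\star}\ge1$, at which $f^*_{k^\star,w^\star}\ne0$;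 and there is at most one state $(k,w)$ with $0<f^*_{k,w}<1$. (II) Every optimal pair $(f,\pi)$ has the channel-threshold structure on the states that occur: there are $T_k\in\{0,\dots,W\}$ such that, for each $k\ge1$ with $\sum_{m\le k}\theta_m\pi_{k-m}>0$ and each $w$ with $\eta_w>0$, $f_{k,w}=0$ if $w<T_k$ and $f_{k,w}=1$ if $w>T_k$; and $T_k\ge T_l$ whenever $1\le k\le l$ both satisfy that condition. -/

import Mathlib

/-- Data of the scheduling model: a buffer of capacity `K` (a positive integer or `∞`), i.i.d.
arrivals with probability mass function `θ` on `{0, …, M}`, an i.i.d. block-fading channel with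
states `1, …, W` (worst to best) and probabilities `η`, and the power `P w` that is needed to
transmit one packet in channel state `w`. The values of `η` and `P` outside `{1, …, W}` are never
used. -/
structure SchedModel where
  /-- buffer capacity -/
  K : ℕ∞
  /-- largest number of packets arriving in one slot -/
  M : ℕ
  /-- number of channel states -/
  W : ℕ
  /-- arrival probabilities -/
  θ : ℕ → ℝ
  /-- channel state probabilities -/
  η : ℕ → ℝ
  /-- transmission powers -/
  P : ℕ → ℝ
  K_pos : 1 ≤ K
  M_pos : 1 ≤ M
  W_pos : 1 ≤ W
  θ_nonneg : ∀ m, 0 ≤ θ m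
  θ_zero : ∀ m, M < m → θ m = 0
  θ_sum : ∑ m ∈ Finset.range (M + 1), θ m = 1
  η_nonneg : ∀ w, 1 ≤ w → w ≤ W → 0 ≤ η w
  η_sum : ∑ w ∈ Finset.Icc 1 W, η w = 1
  P_pos : ∀ w, 1 ≤ w → w ≤ W → 0 < P w
  P_anti : ∀ v w, 1 ≤ v → v < w → w ≤ W → P w < P v

namespace SchedModel

noncomputable section

/-- Average arrival rate `ā = ∑ m θ_m`. -/
def arrivalRate (S : SchedModel) : ℝ :=
  ∑ m ∈ Finset.range (S.M + 1), (m : ℝ) * S.θ m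

/-- Queue update `q[n] = max {min {q[n-1] + a[n], K} - s[n], 0}` with `q[n-1] = k`, `a[n] = m`,
`s[n] = s`; the subtraction is the truncated one of `ℕ`, which is the maximum with `0`. -/
def nextQueue (S : SchedModel) (k m s : ℕ) : ℕ :=
  (min ((k + m : ℕ) : ℕ∞) S.K).toNat - s

/-- `f t w` is the probability of transmitting one packet when the updated queue state
`q[n-1] + a[n]` is `t` and the channel state is `w`. Nothing is transmitted from an empty queue,
and `f t w = 0` for `t > K` by convention. -/
structure IsPolicy (S : SchedModel) (f : ℕ → ℕ → ℝ) : Prop where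
  nonneg : ∀ t w, 0 ≤ f t w
  le_one : ∀ t w, f t w ≤ 1
  empty : ∀ w, f 0 w = 0
  above : ∀ t w : ℕ, S.K < (t : ℕ∞) → f t w = 0

/-- One-step transition probability `Pr {q[n] = l | q[n-1] = k}` of the queue length under the
policy `f`; arrival, channel state and transmission decision are drawn in the slot. -/
def trans (S : SchedModel) (f : ℕ → ℕ → ℝ) (k l : ℕ) : ℝ :=
  ∑ m ∈ Finset.range (S.M + 1), S.θ m * ∑ w ∈ Finset.Icc 1 S.W, S.η w *
    (f (k + m) w * (if S.nextQueue k m 1 = l then 1 else 0) +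
      (1 - f (k + m) w) * (if S.nextQueue k m 0 = l then 1 else 0))

/-- `π` is a probability distribution on the queue lengths `0, …, K` that is stationary for the
queue length chain under the policy `f`. -/
structure IsStationary (S : SchedModel) (f : ℕ → ℕ → ℝ) (π : ℕ → ℝ) : Prop where
  nonneg : ∀ k, 0 ≤ π k
  supp : ∀ k : ℕ, S.K < (k : ℕ∞) → π k = 0
  hasSum_one : HasSum π 1
  balance : ∀ l, HasSum (fun k => π k * S.trans f k l) (π l)

/-- No packet overflow occurs in the steady state `π`: every `q[n-1] + a[n]` of positive
probability is at most `K`. This always holds if `K = ∞`. -/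
def NoOverflow (S : SchedModel) (π : ℕ → ℝ) : Prop :=
  ∀ k m, 0 < π k → 0 < S.θ m → ((k + m : ℕ) : ℕ∞) ≤ S.K

/-- Average power `∑_k π_k ∑_w η_w P_w ∑_m θ_m f_{k+m,w}`. -/
def avgPower (S : SchedModel) (f : ℕ → ℕ → ℝ) (π : ℕ → ℝ) : ℝ :=
  ∑' k, π k * ∑ w ∈ Finset.Icc 1 S.W, S.η w * S.P w *
    ∑ m ∈ Finset.range (S.M + 1), S.θ m * f (k + m) w

/-- Average queueing delay `(1 / ā) ∑_k k π_k`, with values in `[0, ∞]`. -/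
def avgDelay (S : SchedModel) (π : ℕ → ℝ) : ENNReal :=
  (∑' k : ℕ, (k : ENNReal) * ENNReal.ofReal (π k)) / ENNReal.ofReal S.arrivalRate

/-- The constraints of the delay minimization problem with power budget `Paver`. -/
structure IsFeasible (S : SchedModel) (Paver : ℝ) (f : ℕ → ℕ → ℝ) (π : ℕ → ℝ) : Prop where
  policy : S.IsPolicy f
  stationary : S.IsStationary f π
  noOverflow : S.NoOverflow π
  power : S.avgPower f π ≤ Paver

/-- `f`, run in the steady state `π`, has the least average delay under the power budget. -/
def IsOptimal (S : SchedModel) (Paver : ℝ) (f : ℕ → ℕ → ℝ) (π : ℕ → ℝ) : Prop :=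
  S.IsFeasible Paver f π ∧
    ∀ f' π', S.IsFeasible Paver f' π' → S.avgDelay π ≤ S.avgDelay π'

/-- Steady-state probability that the updated queue state `q[n-1] + a[n]` equals `k`. -/
def updatedProb (S : SchedModel) (π : ℕ → ℝ) (k : ℕ) : ℝ :=
  ∑ m ∈ Finset.range (S.M + 1), if m ≤ k then S.θ m * π (k - m) else 0

/-- Dual-threshold structure of a policy with channel thresholds `T k ∈ {0, …, W}` and queue
thresholds `I w ∈ {0, …, K}`. -/
structure IsDualThreshold (S : SchedModel) (f : ℕ → ℕ → ℝ) (T : ℕ → ℕ) (I : ℕ → ℕ∞) : Prop where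
  T_le : ∀ k, T k ≤ S.W
  channel_below : ∀ k w : ℕ, (k : ℕ∞) ≤ S.K → 1 ≤ w → w ≤ S.W → w < T k → f k w = 0
  channel_above : ∀ k w : ℕ, (k : ℕ∞) ≤ S.K → 1 ≤ w → w ≤ S.W → T k < w → f k w = 1
  T_anti : ∀ k l : ℕ, 1 ≤ k → k ≤ l → (l : ℕ∞) ≤ S.K → T l ≤ T k
  I_le : ∀ w, I w ≤ S.K
  queue_below : ∀ k w : ℕ, (k : ℕ∞) ≤ S.K → 1 ≤ w → w ≤ S.W → (k : ℕ∞) < I w → f k w = 0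
  queue_above : ∀ k w : ℕ, (k : ℕ∞) ≤ S.K → 1 ≤ w → w ≤ S.W → I w < (k : ℕ∞) → f k w = 1

end

end SchedModel

namespace SchedModel

noncomputable section

/-- The sequence `π` delayed by `i` places. -/
def delayed (π : ℕ → ℝ) (i j : ℕ) : ℝ := if i ≤ j then π (j - i) else 0

theorem delayed_zero (π : ℕ → ℝ) (j : ℕ) : delayed π 0 j = π j := by simp [delayed]

theorem delayed_succ_succ (π : ℕ → ℝ) (i j : ℕ) :
    delayed π (i + 1) (j + 1) = delayed π i j := by
  simp [delayed]

theorem delayed_succ_zero (π : ℕ → ℝ) (i : ℕ) : delayed π (i + 1) 0 = 0 := by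
  simp [delayed]

theorem delayed_add (π : ℕ → ℝ) (i k : ℕ) : delayed π i (k + i) = π k := by
  simp [delayed]

theorem delayed_nonneg {π : ℕ → ℝ} (h : ∀ k, 0 ≤ π k) (i j : ℕ) : 0 ≤ delayed π i j := by
  unfold delayed; split_ifs
  · exact h _
  · exact le_rfl

theorem hasSum_delayed {π u : ℕ → ℝ} {i : ℕ} {a : ℝ}
    (h : HasSum (fun k => π k * u (k + i)) a) : HasSum (fun t => delayed π i t * u t) a := by
  have hinj : Function.Injective (fun k : ℕ => k + i) := fun a b h => by simpa using h
  rw [← hinj.hasSum_iff]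
  · simpa [Function.comp_def, delayed] using h
  · intro t ht
    have : ¬ i ≤ t := fun hi => ht ⟨t - i, by simp [hi]⟩
    simp [delayed, this]

/-- The probability that at least `i` packets arrive in a slot. -/
def arrivalTail (S : SchedModel) (i : ℕ) : ℝ :=
  ∑ m ∈ Finset.range (S.M + 1), if i ≤ m then S.θ m else 0

/-- The rate at which arrivals lift the queue length from below `t` to at least `t`. -/
def upRate (S : SchedModel) (π : ℕ → ℝ) (t : ℕ) : ℝ :=
  ∑ i ∈ Finset.Icc 1 S.M, S.arrivalTail i * delayed π i t

/-- The probability of a transmission from the updated queue state `t`. -/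
def txProb (S : SchedModel) (f : ℕ → ℕ → ℝ) (t : ℕ) : ℝ :=
  ∑ w ∈ Finset.Icc 1 S.W, S.η w * f t w

variable (S : SchedModel)

theorem updatedProb_eq (π : ℕ → ℝ) (t : ℕ) :
    S.updatedProb π t = ∑ m ∈ Finset.range (S.M + 1), S.θ m * delayed π m t := by
  unfold updatedProb delayed
  refine Finset.sum_congr rfl fun m _ => ?_
  split_ifs <;> simp

theorem updatedProb_nonneg {π : ℕ → ℝ} (h : ∀ k, 0 ≤ π k) (t : ℕ) : 0 ≤ S.updatedProb π t := by
  rw [updatedProb_eq]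
  exact Finset.sum_nonneg fun m _ => mul_nonneg (S.θ_nonneg m) (delayed_nonneg h m t)

theorem le_updatedProb {π : ℕ → ℝ} (h : ∀ k, 0 ≤ π k) (k m : ℕ) :
    S.θ m * π k ≤ S.updatedProb π (k + m) := by
  by_cases hm : m ≤ S.M
  · rw [updatedProb_eq]
    have := Finset.single_le_sum (f := fun m' => S.θ m' * delayed π m' (k + m))
      (fun m' _ => mul_nonneg (S.θ_nonneg m') (delayed_nonneg h m' _))
      (Finset.mem_range.2 (Nat.lt_succ_of_le hm))
    simpa [delayed_add] using this
  · rw [S.θ_zero m (by omega), zero_mul]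
    exact S.updatedProb_nonneg h _

theorem arrivalTail_zero : S.arrivalTail 0 = 1 := by
  simp [arrivalTail, S.θ_sum]

theorem arrivalTail_nonneg (i : ℕ) : 0 ≤ S.arrivalTail i :=
  Finset.sum_nonneg fun m _ => by split_ifs; exacts [S.θ_nonneg m, le_rfl]

theorem arrivalTail_of_lt {i : ℕ} (h : S.M < i) : S.arrivalTail i = 0 :=
  Finset.sum_eq_zero fun m hm => by
    rw [Finset.mem_range] at hm
    rw [if_neg (by omega)]

theorem arrivalTail_eq_add (i : ℕ) : S.arrivalTail i = S.θ i + S.arrivalTail (i + 1) := by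
  by_cases hi : i ≤ S.M
  · have h1 : S.θ i = ∑ m ∈ Finset.range (S.M + 1), if m = i then S.θ m else 0 := by
      rw [Finset.sum_ite_eq' _ i, if_pos (Finset.mem_range.2 (by omega))]
    rw [h1, arrivalTail, arrivalTail, ← Finset.sum_add_distrib]
    refine Finset.sum_congr rfl fun m _ => ?_
    rcases lt_trichotomy m i with h | h | h
    · rw [if_neg (by omega), if_neg (by omega), if_neg (by omega)]; simp
    · rw [if_pos (by omega), if_pos (by omega), if_neg (by omega)]; simp
    · rw [if_pos (by omega), if_neg (by omega), if_pos (by omega)]; simp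
  · rw [S.arrivalTail_of_lt (by omega), S.arrivalTail_of_lt (by omega), S.θ_zero i (by omega)]
    simp

theorem θ_le_arrivalTail (i : ℕ) : S.θ i ≤ S.arrivalTail i := by
  rw [arrivalTail_eq_add]; linarith [S.arrivalTail_nonneg (i + 1)]

theorem sum_arrivalTail : ∑ i ∈ Finset.Icc 1 S.M, S.arrivalTail i = S.arrivalRate := by
  unfold arrivalTail arrivalRate
  rw [Finset.sum_comm]
  refine Finset.sum_congr rfl fun m hm => ?_
  rw [Finset.mem_range] at hm
  rw [← Finset.sum_filter, Finset.sum_const, nsmul_eq_mul]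
  congr 2
  rw [show (Finset.Icc 1 S.M).filter (fun i => i ≤ m) = Finset.Icc 1 m by
    ext i; simp; omega]
  simp

theorem sum_Icc_one_eq (u : ℕ → ℝ) (n : ℕ) :
    ∑ i ∈ Finset.Icc 1 n, u i = ∑ i ∈ Finset.range n, u (i + 1) := by
  rw [Finset.range_eq_Ico, Finset.sum_Ico_add' u 0 n 1]
  rfl

theorem upRate_zero (π : ℕ → ℝ) : S.upRate π 0 = 0 := by
  rw [upRate, sum_Icc_one_eq]
  simp [delayed_succ_zero]

/-- Conservation of probability across the level `k`. -/
theorem upRate_succ (π : ℕ → ℝ) (k : ℕ) :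
    S.upRate π (k + 1) + S.updatedProb π k = S.upRate π k + π k := by
  have h1 : S.upRate π (k + 1)
      = ∑ i ∈ Finset.range (S.M + 1), S.arrivalTail (i + 1) * delayed π i k := by
    rw [upRate, sum_Icc_one_eq, Finset.sum_range_succ, S.arrivalTail_of_lt (Nat.lt_succ_self _)]
    simp [delayed_succ_succ]
  have h2 : S.upRate π k + π k
      = ∑ i ∈ Finset.range (S.M + 1), S.arrivalTail i * delayed π i k := by
    rw [upRate, sum_Icc_one_eq, Finset.sum_range_succ', arrivalTail_zero, delayed_zero, one_mul]
  rw [h1, h2, updatedProb_eq, ← Finset.sum_add_distrib]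
  refine Finset.sum_congr rfl fun i _ => ?_
  rw [S.arrivalTail_eq_add i]; ring

theorem upRate_nonneg {π : ℕ → ℝ} (h : ∀ k, 0 ≤ π k) (t : ℕ) : 0 ≤ S.upRate π t :=
  Finset.sum_nonneg fun i _ => mul_nonneg (S.arrivalTail_nonneg i) (delayed_nonneg h i t)

theorem hasSum_updatedProb {π u a : ℕ → ℝ} (h : ∀ m, HasSum (fun k => π k * u (k + m)) (a m)) :
    HasSum (fun t => S.updatedProb π t * u t) (∑ m ∈ Finset.range (S.M + 1), S.θ m * a m) := by
  have := hasSum_sum (s := Finset.range (S.M + 1)) fun m _ =>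
    (hasSum_delayed (h m)).mul_left (S.θ m)
  refine this.congr_fun fun t => ?_
  rw [updatedProb_eq, Finset.sum_mul]
  exact Finset.sum_congr rfl fun m _ => by ring

theorem hasSum_mul_arrival {π u a : ℕ → ℝ} (h : ∀ m, HasSum (fun k => π k * u (k + m)) (a m)) :
    HasSum (fun k => π k * ∑ m ∈ Finset.range (S.M + 1), S.θ m * u (k + m))
      (∑ m ∈ Finset.range (S.M + 1), S.θ m * a m) := by
  have := hasSum_sum (s := Finset.range (S.M + 1)) fun m _ => (h m).mul_left (S.θ m)
  refine this.congr_fun fun k => ?_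
  rw [Finset.mul_sum]
  exact Finset.sum_congr rfl fun m _ => by ring

theorem hasSum_upRate {π u a : ℕ → ℝ} (h : ∀ m, HasSum (fun k => π k * u (k + m)) (a m)) :
    HasSum (fun t => S.upRate π t * u t) (∑ i ∈ Finset.Icc 1 S.M, S.arrivalTail i * a i) := by
  have := hasSum_sum (s := Finset.Icc 1 S.M) fun m _ =>
    (hasSum_delayed (h m)).mul_left (S.arrivalTail m)
  refine this.congr_fun fun t => ?_
  rw [upRate, Finset.sum_mul]
  exact Finset.sum_congr rfl fun m _ => by ring

theorem hasSum_mul_tail {π u a : ℕ → ℝ} (h : ∀ m, HasSum (fun k => π k * u (k + m)) (a m)) :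
    HasSum (fun k => π k * ∑ i ∈ Finset.Icc 1 S.M, S.arrivalTail i * u (k + i))
      (∑ i ∈ Finset.Icc 1 S.M, S.arrivalTail i * a i) := by
  have := hasSum_sum (s := Finset.Icc 1 S.M) fun m _ => (h m).mul_left (S.arrivalTail m)
  refine this.congr_fun fun k => ?_
  rw [Finset.mul_sum]
  exact Finset.sum_congr rfl fun m _ => by ring

theorem hasSum_updatedProb_one {π : ℕ → ℝ} {s : ℝ} (h : HasSum π s) :
    HasSum (S.updatedProb π) s := by
  have := S.hasSum_updatedProb (u := fun _ => 1) (a := fun _ => s) fun m => by simpa using h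
  simpa [← Finset.sum_mul, S.θ_sum] using this

theorem hasSum_upRate_one {π : ℕ → ℝ} {s : ℝ} (h : HasSum π s) :
    HasSum (S.upRate π) (S.arrivalRate * s) := by
  have := S.hasSum_upRate (u := fun _ => 1) (a := fun _ => s) fun m => by simpa using h
  simpa [← Finset.sum_mul, S.sum_arrivalTail] using this

theorem summable_mul_of_bounded {π u : ℕ → ℝ} (h0 : ∀ k, 0 ≤ π k) (h : Summable π) {C : ℝ}
    (hu : ∀ k, |u k| ≤ C) : Summable fun k => π k * u k := by
  refine Summable.of_norm_bounded (h.mul_right C) fun k => ?_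
  rw [Real.norm_eq_abs, abs_mul, abs_of_nonneg (h0 k)]
  exact mul_le_mul_of_nonneg_left (hu k) (h0 k)

theorem tsum_mul_arrival {π u : ℕ → ℝ} (h : ∀ m, Summable fun k => π k * u (k + m)) :
    ∑' k, π k * ∑ m ∈ Finset.range (S.M + 1), S.θ m * u (k + m)
      = ∑' t, S.updatedProb π t * u t :=
  (S.hasSum_mul_arrival fun m => (h m).hasSum).tsum_eq.trans
    (S.hasSum_updatedProb fun m => (h m).hasSum).tsum_eq.symm

theorem txProb_nonneg {f : ℕ → ℕ → ℝ} (h : ∀ t w, 0 ≤ f t w) (t : ℕ) : 0 ≤ S.txProb f t :=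
  Finset.sum_nonneg fun w hw => by
    rw [Finset.mem_Icc] at hw
    exact mul_nonneg (S.η_nonneg w hw.1 hw.2) (h t w)

theorem txProb_le_one {f : ℕ → ℕ → ℝ} (h : ∀ t w, f t w ≤ 1) (t : ℕ) : S.txProb f t ≤ 1 := by
  rw [← S.η_sum, txProb]
  refine Finset.sum_le_sum fun w hw => ?_
  rw [Finset.mem_Icc] at hw
  exact mul_le_of_le_one_right (S.η_nonneg w hw.1 hw.2) (h t w)

end

noncomputable section

/-- The mean power spent on a slot with updated queue state `t`. -/
def txCost (S : SchedModel) (f : ℕ → ℕ → ℝ) (t : ℕ) : ℝ :=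
  ∑ w ∈ Finset.Icc 1 S.W, S.η w * S.P w * f t w

/-- The average power as a sum over the updated queue states. -/
def meanPower (S : SchedModel) (f : ℕ → ℕ → ℝ) (π : ℕ → ℝ) : ℝ :=
  ∑' t, S.updatedProb π t * S.txCost f t

/-- The mean queue length. -/
def meanQueue (π : ℕ → ℝ) : ℝ := ∑' k, π k * (k : ℝ)

/-- A policy (not truncated above the buffer capacity) together with a queue length distribution
below the capacity for which up- and downcrossing rates agree at every level. -/
structure Admissible (S : SchedModel) (f : ℕ → ℕ → ℝ) (π : ℕ → ℝ) : Prop where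
  f_nonneg : ∀ t w, 0 ≤ f t w
  f_le_one : ∀ t w, f t w ≤ 1
  f_empty : ∀ w, f 0 w = 0
  nonneg : ∀ k, 0 ≤ π k
  supp : ∀ k : ℕ, S.K ≤ (k : ℕ∞) → π k = 0
  hasSum_one : HasSum π 1
  balance : ∀ t, S.updatedProb π t * S.txProb f t = S.upRate π t

/-- With a finite buffer, at most one packet arrives per slot. -/
def FiniteBufferSingleArrival (S : SchedModel) : Prop :=
  S.K = ⊤ ∨ ∀ m, 2 ≤ m → S.θ m = 0

variable {S : SchedModel} {f : ℕ → ℕ → ℝ} {π : ℕ → ℝ}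

theorem sum_channel_eq (S : SchedModel) (f : ℕ → ℕ → ℝ) (t : ℕ) (a b : ℝ) :
    ∑ w ∈ Finset.Icc 1 S.W, S.η w * (f t w * a + (1 - f t w) * b)
      = S.txProb f t * a + (1 - S.txProb f t) * b := by
  have h : ∀ w, S.η w * (f t w * a + (1 - f t w) * b)
      = (S.η w * f t w) * (a - b) + S.η w * b := fun w => by ring
  simp_rw [h]
  rw [Finset.sum_add_distrib, ← Finset.sum_mul, ← Finset.sum_mul, S.η_sum, txProb]
  ring

theorem txProb_empty (S : SchedModel) (h : ∀ w, f 0 w = 0) : S.txProb f 0 = 0 := by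
  simp [txProb, h]

theorem hasSum_trans (S : SchedModel) (h0 : ∀ t w, 0 ≤ f t w) (h1 : ∀ t w, f t w ≤ 1)
    (he : ∀ w, f 0 w = 0) (hπ : ∀ k, 0 ≤ π k) (hs : Summable π) (hno : S.NoOverflow π) (l : ℕ) :
    HasSum (fun k => π k * S.trans f k l)
      (S.updatedProb π l * (1 - S.txProb f l)
        + S.updatedProb π (l + 1) * S.txProb f (l + 1)) := by
  set g := S.txProb f with hg
  set v : ℕ → ℝ := fun t => g t * (if t - 1 = l then 1 else 0)
    + (1 - g t) * (if t = l then 1 else 0) with hv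
  have g0 : ∀ t, 0 ≤ g t := S.txProb_nonneg h0
  have g1 : ∀ t, g t ≤ 1 := S.txProb_le_one h1
  have hvb : ∀ t, |v t| ≤ 1 := by
    intro t
    have := g0 t; have := g1 t
    rw [abs_le]; simp only [hv]; split_ifs <;> constructor <;> linarith
  have hsum : ∀ m, Summable fun k => π k * v (k + m) := fun m =>
    summable_mul_of_bounded hπ hs fun k => hvb (k + m)
  have hA := S.hasSum_mul_arrival fun m => (hsum m).hasSum
  have hB := S.hasSum_updatedProb fun m => (hsum m).hasSum
  have hC : HasSum (fun t => S.updatedProb π t * v t)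
      (S.updatedProb π l * (1 - g l) + S.updatedProb π (l + 1) * g (l + 1)) := by
    have hfin : HasSum (fun t => S.updatedProb π t * v t)
        (∑ t ∈ ({l, l + 1} : Finset ℕ), S.updatedProb π t * v t) :=
      hasSum_sum_of_ne_finset_zero (by
        intro t ht
        simp only [Finset.mem_insert, Finset.mem_singleton, not_or] at ht
        have h2 : g t * (if t - 1 = l then 1 else 0) = 0 := by
          by_cases h : t - 1 = l
          · have : t = 0 := by omega
            subst this
            simp [hg, S.txProb_empty he]
          · simp [h]
        simp only [hv, h2, if_neg ht.1, mul_zero, add_zero])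
    rw [Finset.sum_pair (by omega)] at hfin
    convert hfin using 2
    · congr 1
      simp only [hv, if_true]
      by_cases h : l - 1 = l
      · have : l = 0 := by omega
        subst this
        simp [hg, S.txProb_empty he]
      · simp [h]
    · simp [hv]
  rw [hB.unique hC] at hA
  refine hA.congr_fun fun k => ?_
  rcases (hπ k).eq_or_lt with hk | hk
  · simp [← hk]
  congr 1
  refine Finset.sum_congr rfl fun m _ => ?_
  rcases (S.θ_nonneg m).eq_or_lt with hm | hm
  · simp [← hm]
  congr 1
  have hle := hno k m hk hm
  have hn : ∀ s, S.nextQueue k m s = k + m - s := fun s => by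
    rw [nextQueue, min_eq_left hle, ENat.toNat_natCast]
  rw [hn, hn, sum_channel_eq]
  simp [hv, hg]

theorem IsFeasible.balance {Paver : ℝ} (h : S.IsFeasible Paver f π) (t : ℕ) :
    S.updatedProb π t * S.txProb f t = S.upRate π t := by
  induction t with
  | zero => rw [upRate_zero, S.txProb_empty h.policy.empty, mul_zero]
  | succ l ih =>
    have h1 := (S.hasSum_trans h.policy.nonneg h.policy.le_one h.policy.empty h.stationary.nonneg
      h.stationary.hasSum_one.summable h.noOverflow l).unique (h.stationary.balance l)
    have h2 := S.upRate_succ π l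
    linarith

theorem exists_pos_of_hasSum_one (h0 : ∀ k, 0 ≤ π k) (h : HasSum π 1) : ∃ k, 0 < π k := by
  by_contra! hc
  have : π = 0 := funext fun k => le_antisymm (hc k) (h0 k)
  rw [this] at h
  exact one_ne_zero (h.unique hasSum_zero)

theorem updatedProb_mul_txProb_le (h0 : ∀ k, 0 ≤ π k) (h1 : ∀ t w, f t w ≤ 1) (t : ℕ) :
    S.updatedProb π t * S.txProb f t ≤ S.updatedProb π t :=
  mul_le_of_le_one_right (S.updatedProb_nonneg h0 t) (S.txProb_le_one h1 t)

theorem exists_arrival_pos (hrate : 0 < S.arrivalRate) : ∃ m, 1 ≤ m ∧ 0 < S.θ m := by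
  by_contra! hc
  refine hrate.ne' (Finset.sum_eq_zero fun m _ => ?_)
  rcases Nat.eq_zero_or_pos m with rfl | hm
  · simp
  · rw [le_antisymm (hc m hm) (S.θ_nonneg m), mul_zero]

theorem IsFeasible.finite_buffer {Paver : ℝ} (hrate : 0 < S.arrivalRate)
    (h : S.IsFeasible Paver f π) {n : ℕ} (hK : S.K = n) :
    (∀ m, 2 ≤ m → S.θ m = 0) ∧ ∀ k, n ≤ k → π k = 0 := by
  have h0 := h.stationary.nonneg
  have hz : ∀ k, n < k → π k = 0 := fun k hk => h.stationary.supp k (by rw [hK]; exact_mod_cast hk)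
  have hm2 : ∀ m, 2 ≤ m → S.θ m = 0 := by
    obtain ⟨k, hk⟩ := exists_pos_of_hasSum_one h0 h.stationary.hasSum_one
    have hkn : k ≤ n := by by_contra! hc; exact hk.ne' (hz k hc)
    set L := Nat.findGreatest (fun k => 0 < π k) n
    have hL : 0 < π L := Nat.findGreatest_spec (P := fun k => 0 < π k) hkn hk
    have hLz : ∀ j, L < j → π j = 0 := fun j hj => by
      by_cases hjn : j ≤ n
      · exact le_antisymm (not_lt.1 (Nat.findGreatest_is_greatest hj hjn)) (h0 j)
      · exact hz j (by omega)
    intro m hm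
    by_contra hc
    have hpos : 0 < S.updatedProb π (L + m) :=
      lt_of_lt_of_le (mul_pos ((S.θ_nonneg m).lt_of_ne' hc) hL) (S.le_updatedProb h0 L m)
    obtain ⟨j, hj⟩ : ∃ j, L + m = j + 1 := ⟨L + m - 1, by omega⟩
    rw [hj] at hpos
    have e1 := S.upRate_succ π (j + 1)
    have e2 := S.upRate_succ π j
    rw [hLz (j + 1) (by omega)] at e1
    rw [hLz j (by omega)] at e2
    have e3 := S.upRate_nonneg h0 (j + 1 + 1)
    have e4 := updatedProb_mul_txProb_le (S := S) h0 h.policy.le_one j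
    rw [h.balance] at e4
    linarith
  refine ⟨hm2, fun k hk => ?_⟩
  obtain ⟨m, hm, hpos⟩ := exists_arrival_pos hrate
  by_contra hc
  have := h.noOverflow k m ((h0 k).lt_of_ne' hc) hpos
  rw [hK] at this
  have : k + m ≤ n := by exact_mod_cast this
  omega

theorem IsFeasible.finiteBufferSingleArrival {Paver : ℝ} (hrate : 0 < S.arrivalRate)
    (h : S.IsFeasible Paver f π) : S.FiniteBufferSingleArrival := by
  by_cases hK : S.K = ⊤
  · exact Or.inl hK
  · lift S.K to ℕ using hK with n hn
    exact Or.inr (h.finite_buffer hrate hn.symm).1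

theorem IsFeasible.admissible {Paver : ℝ} (hrate : 0 < S.arrivalRate)
    (h : S.IsFeasible Paver f π) : S.Admissible f π where
  f_nonneg := h.policy.nonneg
  f_le_one := h.policy.le_one
  f_empty := h.policy.empty
  nonneg := h.stationary.nonneg
  supp k hk := by
    have hK : S.K ≠ ⊤ := fun hK => by rw [hK] at hk; exact absurd hk (by simp)
    obtain ⟨n, hn⟩ := ENat.ne_top_iff_exists.1 hK
    exact (h.finite_buffer hrate hn.symm).2 k (by rw [← hn] at hk; exact_mod_cast hk)
  hasSum_one := h.stationary.hasSum_one
  balance := h.balance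

theorem abs_txCost_le (S : SchedModel) (h0 : ∀ t w, 0 ≤ f t w) (h1 : ∀ t w, f t w ≤ 1) (t : ℕ) :
    |S.txCost f t| ≤ ∑ w ∈ Finset.Icc 1 S.W, S.η w * S.P w := by
  have hp : ∀ w ∈ Finset.Icc 1 S.W, 0 ≤ S.η w * S.P w := fun w hw => by
    rw [Finset.mem_Icc] at hw
    exact mul_nonneg (S.η_nonneg w hw.1 hw.2) (S.P_pos w hw.1 hw.2).le
  rw [txCost, abs_of_nonneg (Finset.sum_nonneg fun w hw => mul_nonneg (hp w hw) (h0 t w))]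
  exact Finset.sum_le_sum fun w hw => mul_le_of_le_one_right (hp w hw) (h1 t w)

theorem avgPower_eq_meanPower (S : SchedModel) (h0 : ∀ t w, 0 ≤ f t w) (h1 : ∀ t w, f t w ≤ 1)
    (hπ : ∀ k, 0 ≤ π k) (hs : Summable π) : S.avgPower f π = S.meanPower f π := by
  rw [meanPower, ← S.tsum_mul_arrival (u := S.txCost f) fun m =>
    summable_mul_of_bounded hπ hs fun k => S.abs_txCost_le h0 h1 (k + m), avgPower]
  congr 1
  ext k
  congr 1
  simp_rw [txCost, Finset.mul_sum]
  rw [Finset.sum_comm]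
  exact Finset.sum_congr rfl fun m _ => Finset.sum_congr rfl fun w _ => by ring

theorem Admissible.avgPower_eq (h : S.Admissible f π) : S.avgPower f π = S.meanPower f π :=
  S.avgPower_eq_meanPower h.f_nonneg h.f_le_one h.nonneg h.hasSum_one.summable

theorem Admissible.noOverflow (hS : S.FiniteBufferSingleArrival) (h : S.Admissible f π) :
    S.NoOverflow π := by
  intro k m hk hm
  rcases hS with hS | hS
  · rw [hS]; exact le_top
  · have hm1 : m ≤ 1 := by by_contra! hc; exact hm.ne' (hS m hc)
    have hkK : (k : ℕ∞) < S.K := by by_contra! hc; exact hk.ne' (h.supp k hc)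
    calc ((k + m : ℕ) : ℕ∞) ≤ ((k + 1 : ℕ) : ℕ∞) := by exact_mod_cast Nat.add_le_add_left hm1 k
      _ ≤ S.K := by push_cast; exact Order.add_one_le_of_lt hkK

theorem NoOverflow.updatedProb_eq_zero (hno : S.NoOverflow π) (h0 : ∀ k, 0 ≤ π k) {t : ℕ}
    (ht : S.K < (t : ℕ∞)) : S.updatedProb π t = 0 := by
  refine Finset.sum_eq_zero fun m _ => ?_
  split_ifs with hm
  · by_contra hc
    have h1 := (S.θ_nonneg m).lt_of_ne' (left_ne_zero_of_mul hc)
    have h2 := (h0 (t - m)).lt_of_ne' (right_ne_zero_of_mul hc)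
    have := hno _ _ h2 h1
    rw [Nat.sub_add_cancel hm] at this
    exact absurd this (not_le.2 ht)
  · rfl

/-- The policy `f` cut off above the buffer capacity. -/
def cutoff (S : SchedModel) (f : ℕ → ℕ → ℝ) (t w : ℕ) : ℝ :=
  if (t : ℕ∞) ≤ S.K then f t w else 0

theorem cutoff_of_le {t : ℕ} (h : (t : ℕ∞) ≤ S.K) (w : ℕ) : S.cutoff f t w = f t w := if_pos h

theorem Admissible.congr_policy {f' : ℕ → ℕ → ℝ} (h : S.Admissible f π)
    (h0 : ∀ t w, 0 ≤ f' t w) (h1 : ∀ t w, f' t w ≤ 1) (he : ∀ w, f' 0 w = 0)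
    (hf : ∀ t w, 0 < S.updatedProb π t → 1 ≤ w → w ≤ S.W → 0 < S.η w → f' t w = f t w) :
    S.Admissible f' π ∧ S.meanPower f' π = S.meanPower f π := by
  have key : ∀ c : ℕ → ℝ, ∀ t, S.updatedProb π t * ∑ w ∈ Finset.Icc 1 S.W, S.η w * c w * f' t w
      = S.updatedProb π t * ∑ w ∈ Finset.Icc 1 S.W, S.η w * c w * f t w := by
    intro c t
    rcases (S.updatedProb_nonneg h.nonneg t).eq_or_lt with hμ | hμ
    · simp [← hμ]
    congr 1
    refine Finset.sum_congr rfl fun w hw => ?_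
    rw [Finset.mem_Icc] at hw
    rcases (S.η_nonneg w hw.1 hw.2).eq_or_lt with hη | hη
    · simp [← hη]
    · rw [hf t w hμ hw.1 hw.2 hη]
  refine ⟨⟨h0, h1, he, h.nonneg, h.supp, h.hasSum_one, fun t => ?_⟩, ?_⟩
  · rw [← h.balance t]
    simpa [txProb] using key (fun _ => 1) t
  · exact tsum_congr fun t => key S.P t

theorem Admissible.cutoff (hS : S.FiniteBufferSingleArrival) (h : S.Admissible f π) :
    S.Admissible (S.cutoff f) π ∧ S.meanPower (S.cutoff f) π = S.meanPower f π := by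
  refine h.congr_policy (fun t w => ?_) (fun t w => ?_) (fun w => ?_) fun t w hμ _ _ _ => ?_
  · unfold SchedModel.cutoff; split_ifs; exacts [h.f_nonneg t w, le_rfl]
  · unfold SchedModel.cutoff; split_ifs; exacts [h.f_le_one t w, zero_le_one]
  · unfold SchedModel.cutoff; split_ifs; exacts [h.f_empty w, rfl]
  · refine cutoff_of_le ?_ w
    by_contra! hc
    exact hμ.ne' ((h.noOverflow hS).updatedProb_eq_zero h.nonneg hc)

theorem Admissible.isFeasible (hS : S.FiniteBufferSingleArrival) (h : S.Admissible f π)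
    {Paver : ℝ} (hP : S.meanPower f π ≤ Paver) : S.IsFeasible Paver (S.cutoff f) π := by
  obtain ⟨hc, hcP⟩ := h.cutoff hS
  refine ⟨⟨hc.f_nonneg, hc.f_le_one, hc.f_empty, fun t w ht => if_neg (not_le.2 ht)⟩,
    ⟨h.nonneg, fun k hk => h.supp k hk.le, h.hasSum_one, fun l => ?_⟩, h.noOverflow hS, ?_⟩
  · have := S.hasSum_trans hc.f_nonneg hc.f_le_one hc.f_empty h.nonneg h.hasSum_one.summable
      (h.noOverflow hS) l
    convert this using 1
    have e1 := S.upRate_succ π l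
    rw [hc.balance (l + 1), mul_sub, hc.balance l]
    linarith
  · rw [hc.avgPower_eq, hcP]; exact hP

/-- At the lowest occupied queue length nothing moves upwards. -/
theorem Admissible.exists_lowest (h : S.Admissible f π) :
    ∃ k, 0 < π k ∧ S.upRate π k = 0 := by
  classical
  have hex := exists_pos_of_hasSum_one h.nonneg h.hasSum_one
  refine ⟨Nat.find hex, Nat.find_spec hex, Finset.sum_eq_zero fun i hi => ?_⟩
  rw [Finset.mem_Icc] at hi
  unfold delayed
  split_ifs with hle
  · have := Nat.find_min hex (m := Nat.find hex - i) (by omega)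
    rw [le_antisymm (not_lt.1 this) (h.nonneg _), mul_zero]
  · simp

theorem Admissible.pos_zero (hθ : 0 < S.θ 0) (h : S.Admissible f π)
    (hg : ∀ t, 1 ≤ t → 0 < S.updatedProb π t → 0 < S.txProb f t) : 0 < π 0 := by
  obtain ⟨k, hk, hup⟩ := h.exists_lowest
  rcases Nat.eq_zero_or_pos k with rfl | hk1
  · exact hk
  · have hμ : 0 < S.updatedProb π k :=
      lt_of_lt_of_le (mul_pos hθ hk) (by simpa using S.le_updatedProb h.nonneg k 0)
    have := h.balance k
    rw [hup] at this
    exact absurd this (mul_pos hμ (hg k hk1 hμ)).ne'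

theorem Admissible.rate_lt (hθ : 0 < S.θ 0) (h : S.Admissible f π) {γ : ℝ} (hγ : 0 < γ)
    (hg : ∀ t, S.updatedProb π t * S.txProb f t ≤ S.updatedProb π t * γ) : S.arrivalRate < γ := by
  obtain ⟨k, hk, hup⟩ := h.exists_lowest
  have hμ : 0 < S.updatedProb π k :=
    lt_of_lt_of_le (mul_pos hθ hk) (by simpa using S.le_updatedProb h.nonneg k 0)
  have h1 := S.hasSum_upRate_one h.hasSum_one
  have h2 := (S.hasSum_updatedProb_one h.hasSum_one).mul_right γ
  have := hasSum_lt (fun t => (h.balance t).symm.le.trans (hg t)) (i := k)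
    (by rw [hup]; positivity) h1 h2
  simpa using this

theorem Admissible.rate_lt_one (hθ : 0 < S.θ 0) (h : S.Admissible f π) : S.arrivalRate < 1 :=
  h.rate_lt hθ one_pos fun t => by
    rw [mul_one]; exact updatedProb_mul_txProb_le h.nonneg h.f_le_one t

end

noncomputable section

/-- The solution of a triangular linear recursion started at `1`. -/
def forwardSolution (c : ℕ → ℕ → ℝ) : ℕ → ℝ
  | 0 => 1
  | k + 1 => ∑ j : Fin (k + 1), c (k + 1) j * forwardSolution c j

theorem forwardSolution_succ (c : ℕ → ℕ → ℝ) (k : ℕ) :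
    forwardSolution c (k + 1)
      = ∑ j ∈ Finset.range (k + 1), c (k + 1) j * forwardSolution c j := by
  rw [forwardSolution, Finset.sum_range]

theorem sum_mul_delayed {a : ℕ → ℝ} {M : ℕ} (ha : ∀ m, M < m → a m = 0) (π : ℕ → ℝ) (k : ℕ) :
    ∑ m ∈ Finset.range (M + 1), a m * delayed π m k
      = ∑ j ∈ Finset.range (k + 1), a (k - j) * π j := by
  have h1 : ∑ m ∈ Finset.range (M + 1), a m * delayed π m k
      = ∑ m ∈ Finset.range (M + k + 1), a m * delayed π m k := by
    refine Finset.sum_subset (Finset.range_mono (by omega)) fun m _ hm => ?_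
    rw [Finset.mem_range, not_lt] at hm
    rw [ha m (by omega), zero_mul]
  have h2 : ∑ m ∈ Finset.range (k + 1), a m * delayed π m k
      = ∑ m ∈ Finset.range (M + k + 1), a m * delayed π m k := by
    refine Finset.sum_subset (Finset.range_mono (by omega)) fun m _ hm => ?_
    rw [Finset.mem_range, not_lt] at hm
    rw [delayed, if_neg (by omega), mul_zero]
  rw [h1, ← h2, ← Finset.sum_range_reflect]
  refine Finset.sum_congr rfl fun j hj => ?_
  rw [Finset.mem_range] at hj
  rw [delayed, if_pos (by omega), show k + 1 - 1 - j = k - j by omega,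
    show k - (k - j) = j by omega]

variable (S : SchedModel)

theorem updatedProb_eq_range (π : ℕ → ℝ) (k : ℕ) :
    S.updatedProb π k = ∑ j ∈ Finset.range k, S.θ (k - j) * π j + S.θ 0 * π k := by
  rw [updatedProb_eq, sum_mul_delayed S.θ_zero, Finset.sum_range_succ, Nat.sub_self]

theorem upRate_eq_range (π : ℕ → ℝ) (k : ℕ) :
    S.upRate π k = ∑ j ∈ Finset.range k, S.arrivalTail (k - j) * π j := by
  have h := sum_mul_delayed (fun m hm => S.arrivalTail_of_lt hm) π k
  rw [Finset.sum_range_succ', Finset.sum_range_succ, Nat.sub_self, delayed_zero] at h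
  rw [upRate, sum_Icc_one_eq]
  linarith

/-- The queue length weights, normalized to `1` at `0`, of a policy with transmission
probabilities `g`. -/
def weights (g : ℕ → ℝ) : ℕ → ℝ :=
  forwardSolution fun k j => (S.arrivalTail (k - j) / g k - S.θ (k - j)) / S.θ 0

theorem weights_zero (g : ℕ → ℝ) : S.weights g 0 = 1 := by simp [weights, forwardSolution]

variable {S}

theorem balance_iff (hθ : 0 < S.θ 0) {g : ℕ → ℝ} {k : ℕ} (hg : 0 < g k) (π : ℕ → ℝ) :
    S.updatedProb π k * g k = S.upRate π k ↔
      π k = ∑ j ∈ Finset.range k,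
        (S.arrivalTail (k - j) / g k - S.θ (k - j)) / S.θ 0 * π j := by
  have h : ∑ j ∈ Finset.range k, (S.arrivalTail (k - j) / g k - S.θ (k - j)) / S.θ 0 * π j
      = ((∑ j ∈ Finset.range k, S.arrivalTail (k - j) * π j) / g k
          - ∑ j ∈ Finset.range k, S.θ (k - j) * π j) / S.θ 0 := by
    rw [Finset.sum_div, ← Finset.sum_sub_distrib, Finset.sum_div]
    exact Finset.sum_congr rfl fun j _ => by ring
  rw [h, updatedProb_eq_range, upRate_eq_range, eq_div_iff hθ.ne', eq_sub_iff_add_eq,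
    eq_div_iff hg.ne']
  constructor <;> intro h <;> linarith

theorem weights_nonneg {g : ℕ → ℝ} (hg : ∀ t, 1 ≤ t → 0 < g t) (hg1 : ∀ t, g t ≤ 1) (k : ℕ) :
    0 ≤ S.weights g k := by
  induction k using Nat.strong_induction_on with
  | _ k ih =>
    cases k with
    | zero => rw [weights_zero]; exact zero_le_one
    | succ k =>
      rw [weights, forwardSolution_succ]
      refine Finset.sum_nonneg fun j hj => ?_
      rw [Finset.mem_range] at hj
      refine mul_nonneg (div_nonneg (sub_nonneg.2 ?_) (S.θ_nonneg 0)) (ih j hj)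
      refine (S.θ_le_arrivalTail _).trans ?_
      rw [le_div_iff₀ (hg _ (by omega))]
      exact mul_le_of_le_one_right (S.arrivalTail_nonneg _) (hg1 _)

theorem weights_balance (hθ : 0 < S.θ 0) {g : ℕ → ℝ} (hg0 : g 0 = 0)
    (hg : ∀ t, 1 ≤ t → 0 < g t) (t : ℕ) :
    S.updatedProb (S.weights g) t * g t = S.upRate (S.weights g) t := by
  cases t with
  | zero => rw [hg0, mul_zero, upRate_zero]
  | succ t =>
    rw [balance_iff hθ (hg _ (by omega))]
    exact forwardSolution_succ _ t

theorem eq_of_balance (hθ : 0 < S.θ 0) {g g' : ℕ → ℝ} {n : ℕ} (hgg : ∀ t, t ≤ n → g t = g' t)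
    (hg : ∀ t, 1 ≤ t → 0 < g t) {π π' : ℕ → ℝ} (h0 : π 0 = π' 0)
    (h : ∀ t, S.updatedProb π t * g t = S.upRate π t)
    (h' : ∀ t, S.updatedProb π' t * g' t = S.upRate π' t) (k : ℕ) (hk : k ≤ n) : π k = π' k := by
  induction k using Nat.strong_induction_on with
  | _ k ih =>
    rcases Nat.eq_zero_or_pos k with rfl | hpos
    · exact h0
    · rw [(balance_iff hθ (hg k hpos) π).1 (h k),
        (balance_iff hθ (g := g') (by rw [← hgg k hk]; exact hg k hpos) π').1 (h' k), hgg k hk]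
      refine Finset.sum_congr rfl fun j hj => ?_
      rw [Finset.mem_range] at hj
      rw [ih j hj (by omega)]

theorem Admissible.unique (hθ : 0 < S.θ 0) {f : ℕ → ℕ → ℝ} {π π' : ℕ → ℝ}
    (hg : ∀ t, 1 ≤ t → 0 < S.txProb f t) (h : S.Admissible f π) (h' : S.Admissible f π') :
    π = π' := by
  have h0 := h.pos_zero hθ fun t ht _ => hg t ht
  set r := π' 0 / π 0 with hr
  have hb : ∀ t, S.updatedProb (fun k => r * π k) t * S.txProb f t
      = S.upRate (fun k => r * π k) t := by
    intro t
    have := h.balance t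
    rw [updatedProb_eq_range, upRate_eq_range] at this ⊢
    have e1 : ∀ a : ℕ → ℝ, ∑ j ∈ Finset.range t, a (t - j) * (r * π j)
        = r * ∑ j ∈ Finset.range t, a (t - j) * π j := fun a => by
      rw [Finset.mul_sum]; exact Finset.sum_congr rfl fun j _ => by ring
    rw [e1, e1, ← this]; ring
  have heq : ∀ k, r * π k = π' k := fun k =>
    eq_of_balance hθ (n := k) (fun _ _ => rfl) hg (π := fun k => r * π k)
      (by simp only [hr]; field_simp) hb h'.balance k le_rfl
  have h1 := h.hasSum_one.mul_left r
  have h2 := h'.hasSum_one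
  rw [← funext heq] at h2
  have hr1 : r = 1 := by simpa using h1.unique h2
  ext k
  rw [← heq k, hr1, one_mul]

theorem sum_upRate_le {π v : ℕ → ℝ} (h0 : ∀ k, 0 ≤ π k) (hv : ∀ k, 0 ≤ v k) (n : ℕ) :
    ∑ k ∈ Finset.range (n + 2), v k * S.upRate π k
      ≤ ∑ j ∈ Finset.range (n + 1), π j * ∑ i ∈ Finset.Icc 1 S.M, S.arrivalTail i * v (j + i) := by
  have h1 : ∑ k ∈ Finset.range (n + 2), v k * S.upRate π k
      = ∑ i ∈ Finset.Icc 1 S.M, S.arrivalTail i *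
          ∑ k ∈ Finset.range (n + 2), v k * delayed π i k := by
    simp_rw [upRate, Finset.mul_sum]
    rw [Finset.sum_comm]
    exact Finset.sum_congr rfl fun i _ => Finset.sum_congr rfl fun k _ => by ring
  have h2 : ∑ j ∈ Finset.range (n + 1), π j * ∑ i ∈ Finset.Icc 1 S.M, S.arrivalTail i * v (j + i)
      = ∑ i ∈ Finset.Icc 1 S.M, S.arrivalTail i *
          ∑ j ∈ Finset.range (n + 1), v (j + i) * π j := by
    simp_rw [Finset.mul_sum]
    rw [Finset.sum_comm]
    exact Finset.sum_congr rfl fun i _ => Finset.sum_congr rfl fun k _ => by ring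
  rw [h1, h2]
  refine Finset.sum_le_sum fun i hi => mul_le_mul_of_nonneg_left ?_ (S.arrivalTail_nonneg i)
  rw [Finset.mem_Icc] at hi
  calc ∑ k ∈ Finset.range (n + 2), v k * delayed π i k
      ≤ ∑ k ∈ Finset.range (i + (n + 1)), v k * delayed π i k :=
        Finset.sum_le_sum_of_subset_of_nonneg (Finset.range_mono (by omega))
          fun k _ _ => mul_nonneg (hv k) (delayed_nonneg h0 i k)
    _ = ∑ j ∈ Finset.range (n + 1), v (j + i) * π j := by
        rw [Finset.sum_range_add, Finset.sum_eq_zero, zero_add]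
        · exact Finset.sum_congr rfl fun j _ => by rw [add_comm i j, delayed_add]
        · intro k hk
          rw [Finset.mem_range] at hk
          rw [delayed, if_neg (by omega), mul_zero]

theorem sum_mul_le_sum_updatedProb {π v : ℕ → ℝ} (h0 : ∀ k, 0 ≤ π k) (hv : ∀ k, 0 ≤ v k)
    (hm : Monotone v) (hle : ∀ t, S.upRate π t ≤ S.updatedProb π t) (n : ℕ) :
    ∑ k ∈ Finset.range (n + 1), v k * π k ≤ ∑ k ∈ Finset.range (n + 2), v k * S.updatedProb π k := by
  have key : ∀ n, ∑ k ∈ Finset.range (n + 1), v k * π k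
      ≤ ∑ k ∈ Finset.range (n + 1), v k * S.updatedProb π k + v n * S.upRate π (n + 1) := by
    intro n
    induction n with
    | zero =>
      have := S.upRate_succ π 0
      rw [upRate_zero] at this
      simp only [Finset.sum_range_one, zero_add]
      rw [zero_add] at this
      rw [← mul_add]
      exact mul_le_mul_of_nonneg_left (by linarith) (hv 0)
    | succ n ih =>
      rw [Finset.sum_range_succ, Finset.sum_range_succ _ (n + 1)]
      have h1 := S.upRate_succ π (n + 1)
      have h2 := mul_le_mul_of_nonneg_right (hm (Nat.le_succ n)) (S.upRate_nonneg h0 (n + 1))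
      have h3 : v (n + 1) * π (n + 1) = v (n + 1) * S.updatedProb π (n + 1)
          + v (n + 1) * S.upRate π (n + 1 + 1) - v (n + 1) * S.upRate π (n + 1) := by
        rw [← mul_add, ← mul_sub]; congr 1; linarith
      linarith
  rw [Finset.sum_range_succ _ (n + 1)]
  have h2 := mul_le_mul (hm (Nat.le_succ n)) (hle (n + 1)) (S.upRate_nonneg h0 _) (hv (n + 1))
  linarith [key n]

/-- The Foster-Lyapunov bound. -/
theorem lyapunov_bound {π v g : ℕ → ℝ} (h0 : ∀ k, 0 ≤ π k) (hv : ∀ k, 0 ≤ v k)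
    (hm : Monotone v) (hg1 : ∀ t, g t ≤ 1)
    (hb : ∀ t, S.updatedProb π t * g t = S.upRate π t) {γ : ℝ}
    (hγ : 0 ≤ γ) {N : ℕ} (hN : ∀ t, N ≤ t → γ ≤ g t) (n : ℕ) :
    γ * ∑ k ∈ Finset.range (n + 1), v k * π k
      ≤ ∑ j ∈ Finset.range (n + 1), π j * ∑ i ∈ Finset.Icc 1 S.M, S.arrivalTail i * v (j + i)
        + ∑ k ∈ Finset.range N, γ * (v k * S.updatedProb π k) := by
  have hμ := S.updatedProb_nonneg h0
  have hle : ∀ t, S.upRate π t ≤ S.updatedProb π t := fun t => by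
    rw [← hb]; exact mul_le_of_le_one_right (hμ t) (hg1 t)
  have h1 := mul_le_mul_of_nonneg_left (sum_mul_le_sum_updatedProb h0 hv hm hle n) hγ
  have hpos : ∀ k, 0 ≤ γ * (v k * S.updatedProb π k) := fun k =>
    mul_nonneg hγ (mul_nonneg (hv k) (hμ k))
  have h2 : γ * ∑ k ∈ Finset.range (n + 2), v k * S.updatedProb π k
      ≤ ∑ k ∈ Finset.range (n + 2), v k * S.upRate π k
        + ∑ k ∈ Finset.range (n + 2), if k < N then γ * (v k * S.updatedProb π k) else 0 := by
    rw [Finset.mul_sum, ← Finset.sum_add_distrib]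
    refine Finset.sum_le_sum fun k _ => ?_
    split_ifs with hk
    · have := mul_nonneg (hv k) (S.upRate_nonneg h0 k)
      linarith
    · rw [← hb k, add_zero]
      have := mul_le_mul_of_nonneg_left (hN k (not_lt.1 hk)) (mul_nonneg (hv k) (hμ k))
      linarith
  have h3 : ∑ k ∈ Finset.range (n + 2), (if k < N then γ * (v k * S.updatedProb π k) else 0)
      ≤ ∑ k ∈ Finset.range N, γ * (v k * S.updatedProb π k) := by
    rw [← Finset.sum_filter]
    refine Finset.sum_le_sum_of_subset_of_nonneg (fun k hk => ?_) fun k _ _ => hpos k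
    exact Finset.mem_range.2 (Finset.mem_filter.1 hk).2
  linarith [sum_upRate_le (S := S) h0 hv n]

theorem summable_of_drift {π g : ℕ → ℝ} (h0 : ∀ k, 0 ≤ π k) (hg1 : ∀ t, g t ≤ 1) (hb : ∀ t, S.updatedProb π t * g t = S.upRate π t) {γ : ℝ}
    (hγ : 0 ≤ γ) (hrate : S.arrivalRate < γ) {N : ℕ} (hN : ∀ t, N ≤ t → γ ≤ g t) :
    Summable π ∧ Summable fun k => π k * (k : ℝ) := by
  have hpos : 0 < γ - S.arrivalRate := by linarith
  have hs : Summable π := by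
    set C := ∑ k ∈ Finset.range N, γ * (1 * S.updatedProb π k) with hC
    have hC0 : 0 ≤ C := Finset.sum_nonneg fun k _ => by
      have := S.updatedProb_nonneg h0 k; positivity
    refine summable_of_sum_range_le (c := C / (γ - S.arrivalRate)) h0 fun n => ?_
    refine (Finset.sum_le_sum_of_subset_of_nonneg (Finset.range_mono (Nat.le_succ n))
      fun k _ _ => h0 k).trans ?_
    have := lyapunov_bound (v := fun _ => 1) h0 (fun _ => zero_le_one) monotone_const hg1 hb hγ
      hN n
    simp only [mul_one, one_mul, S.sum_arrivalTail, ← Finset.sum_mul] at this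
    simp only [one_mul] at hC
    rw [← hC] at this
    rw [le_div_iff₀ hpos]
    linarith
  refine ⟨hs, ?_⟩
  set B := ∑ i ∈ Finset.Icc 1 S.M, S.arrivalTail i * (i : ℝ) with hB
  have hB0 : 0 ≤ B := Finset.sum_nonneg fun i _ =>
    mul_nonneg (S.arrivalTail_nonneg i) (Nat.cast_nonneg i)
  set C := ∑ k ∈ Finset.range N, γ * ((k : ℝ) * S.updatedProb π k) with hC
  have hk0 : ∀ k, 0 ≤ π k * (k : ℝ) := fun k => mul_nonneg (h0 k) (Nat.cast_nonneg k)
  refine summable_of_sum_range_le (c := (B * (∑' k, π k) + C) / (γ - S.arrivalRate)) hk0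
    fun n => ?_
  refine (Finset.sum_le_sum_of_subset_of_nonneg (Finset.range_mono (Nat.le_succ n))
      fun k _ _ => hk0 k).trans ?_
  have := lyapunov_bound (v := fun k => (k : ℝ)) h0 (fun _ => Nat.cast_nonneg _) Nat.mono_cast
    hg1 hb hγ hN n
  have e1 : ∀ j : ℕ, ∑ i ∈ Finset.Icc 1 S.M, S.arrivalTail i * ((j + i : ℕ) : ℝ)
      = S.arrivalRate * j + B := fun j => by
    rw [hB, ← S.sum_arrivalTail, Finset.sum_mul, ← Finset.sum_add_distrib]
    exact Finset.sum_congr rfl fun i _ => by push_cast; ring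
  simp_rw [e1, mul_add, Finset.sum_add_distrib, ← Finset.sum_mul] at this
  have e2 : ∑ j ∈ Finset.range (n + 1), π j * (S.arrivalRate * (j : ℝ))
      = S.arrivalRate * ∑ j ∈ Finset.range (n + 1), π j * (j : ℝ) := by
    rw [Finset.mul_sum]; exact Finset.sum_congr rfl fun j _ => by ring
  have e3 : ∑ j ∈ Finset.range (n + 1), (j : ℝ) * π j
      = ∑ j ∈ Finset.range (n + 1), π j * (j : ℝ) :=
    Finset.sum_congr rfl fun j _ => by ring
  have e4 : (∑ j ∈ Finset.range (n + 1), π j) * B ≤ (∑' k, π k) * B :=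
    mul_le_mul_of_nonneg_right (hs.sum_le_tsum _ fun k _ => h0 k) hB0
  rw [e2, e3] at this
  rw [le_div_iff₀ hpos]
  linarith

theorem weights_summable (hθ : 0 < S.θ 0) {g : ℕ → ℝ} (hg0 : g 0 = 0)
    (hg : ∀ t, 1 ≤ t → 0 < g t) (hg1 : ∀ t, g t ≤ 1) {γ : ℝ} (hγ : 0 ≤ γ)
    (hrate : S.arrivalRate < γ) {N : ℕ} (hN : ∀ t, N ≤ t → γ ≤ g t) :
    Summable (S.weights g) ∧ Summable fun k => S.weights g k * (k : ℝ) :=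
  summable_of_drift (weights_nonneg hg hg1) hg1 (weights_balance hθ hg0 hg) hγ hrate hN

theorem updatedProb_smul (S : SchedModel) (r : ℝ) (π : ℕ → ℝ) (t : ℕ) :
    S.updatedProb (fun k => r * π k) t = r * S.updatedProb π t := by
  rw [updatedProb_eq, updatedProb_eq, Finset.mul_sum]
  refine Finset.sum_congr rfl fun m _ => ?_
  unfold delayed; split_ifs <;> ring

theorem upRate_smul (S : SchedModel) (r : ℝ) (π : ℕ → ℝ) (t : ℕ) :
    S.upRate (fun k => r * π k) t = r * S.upRate π t := by
  rw [upRate, upRate, Finset.mul_sum]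
  refine Finset.sum_congr rfl fun m _ => ?_
  unfold delayed; split_ifs <;> ring

theorem updatedProb_add (S : SchedModel) (π π' : ℕ → ℝ) (t : ℕ) :
    S.updatedProb (fun k => π k + π' k) t = S.updatedProb π t + S.updatedProb π' t := by
  rw [updatedProb_eq, updatedProb_eq, updatedProb_eq, ← Finset.sum_add_distrib]
  refine Finset.sum_congr rfl fun m _ => ?_
  unfold delayed; split_ifs <;> ring

theorem upRate_add (S : SchedModel) (π π' : ℕ → ℝ) (t : ℕ) :
    S.upRate (fun k => π k + π' k) t = S.upRate π t + S.upRate π' t := by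
  rw [upRate, upRate, upRate, ← Finset.sum_add_distrib]
  refine Finset.sum_congr rfl fun m _ => ?_
  unfold delayed; split_ifs <;> ring

theorem weights_eq_zero (hθ : 0 < S.θ 0) (hm : ∀ m, 2 ≤ m → S.θ m = 0) {g : ℕ → ℝ}
    (hg0 : g 0 = 0) (hg : ∀ t, 1 ≤ t → 0 < g t) {k : ℕ} (hgk : g k = 1) :
    S.weights g k = 0 := by
  have h2 : ∀ i, 2 ≤ i → S.arrivalTail i = 0 := fun i hi =>
    Finset.sum_eq_zero fun m _ => by
      split_ifs with h
      · exact hm m (by omega)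
      · rfl
  have h1 : ∀ i, 1 ≤ i → S.arrivalTail i = S.θ i := fun i hi => by
    rw [arrivalTail_eq_add, h2 (i + 1) (by omega), add_zero]
  have hb := weights_balance hθ hg0 hg k
  rw [hgk, mul_one, updatedProb_eq_range, upRate_eq_range] at hb
  have : ∑ j ∈ Finset.range k, S.arrivalTail (k - j) * S.weights g j
      = ∑ j ∈ Finset.range k, S.θ (k - j) * S.weights g j :=
    Finset.sum_congr rfl fun j hj => by
      rw [Finset.mem_range] at hj
      rw [h1 _ (by omega)]
  rw [this] at hb
  have h3 : S.θ 0 * S.weights g k = 0 := by linarith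
  exact (mul_eq_zero.1 h3).resolve_left hθ.ne'

/-- A policy that drains long queues has a stationary distribution of finite mean. -/
theorem exists_admissible (hθ : 0 < S.θ 0) (hS : S.FiniteBufferSingleArrival)
    {f : ℕ → ℕ → ℝ} (hf0 : ∀ t w, 0 ≤ f t w) (hf1 : ∀ t w, f t w ≤ 1) (he : ∀ w, f 0 w = 0)
    (hg : ∀ t, 1 ≤ t → 0 < S.txProb f t) {γ : ℝ} (hγ : 0 ≤ γ) (hrate : S.arrivalRate < γ)
    {N : ℕ} (hN : ∀ t, N ≤ t → γ ≤ S.txProb f t)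
    (hK : ∀ t : ℕ, S.K ≤ (t : ℕ∞) → S.txProb f t = 1) :
    S.Admissible f (fun k => (∑' j, S.weights (S.txProb f) j)⁻¹ * S.weights (S.txProb f) k) ∧
      Summable (fun k => (∑' j, S.weights (S.txProb f) j)⁻¹ * S.weights (S.txProb f) k
        * (k : ℝ)) := by
  have hg1 := S.txProb_le_one hf1
  have hg0 := S.txProb_empty he
  have hw0 := weights_nonneg (S := S) hg hg1
  obtain ⟨hs, hs1⟩ := weights_summable hθ hg0 hg hg1 hγ hrate hN
  set Z := ∑' j, S.weights (S.txProb f) j with hZ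
  have hZpos : 0 < Z := lt_of_lt_of_le one_pos (by
    rw [← S.weights_zero (S.txProb f)]; exact hs.le_tsum 0 fun j _ => hw0 j)
  refine ⟨⟨hf0, hf1, he, fun k => mul_nonneg (inv_nonneg.2 hZpos.le) (hw0 k), fun k hk => ?_, ?_,
    fun t => ?_⟩, ?_⟩
  · have h2 : ∀ m, 2 ≤ m → S.θ m = 0 := hS.resolve_left fun h => by
      rw [h] at hk; exact absurd hk (by simp)
    rw [weights_eq_zero hθ h2 hg0 hg (hK k hk), mul_zero]
  · have := hs.hasSum.mul_left Z⁻¹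
    rwa [← hZ, inv_mul_cancel₀ hZpos.ne'] at this
  · rw [updatedProb_smul, upRate_smul, mul_assoc, weights_balance hθ hg0 hg]
  · simpa only [mul_assoc] using hs1.mul_left Z⁻¹

end

noncomputable section

/-- The expected gain `E min {0, lam P_h - x}` of the option to transmit when removing one packet
is worth `x`. -/
def txGain (S : SchedModel) (lam x : ℝ) : ℝ :=
  ∑ w ∈ Finset.Icc 1 S.W, S.η w * min 0 (lam * S.P w - x)

/-- The expected one-step change of the relative value with marginal values `e` (counted from the
present queue length), when transmissions gain `ψ`. -/
def valueDrift (S : SchedModel) (ψ : ℝ → ℝ) (e : ℕ → ℝ) : ℝ :=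
  ∑ m ∈ Finset.range (S.M + 1), S.θ m * ψ (e m) + ∑ i ∈ Finset.Icc 1 S.M, S.arrivalTail i * e i

/-- The loss, against the best decision, of the policy `f` in the updated queue state `t`. -/
def decisionLoss (S : SchedModel) (lam : ℝ) (D : ℕ → ℝ) (f : ℕ → ℕ → ℝ) (t : ℕ) : ℝ :=
  ∑ w ∈ Finset.Icc 1 S.W,
    S.η w * ((lam * S.P w - D t) * f t w - min 0 (lam * S.P w - D t))

/-- `w₀` is the best channel state of positive probability. -/
structure IsBestChannel (S : SchedModel) (w₀ : ℕ) : Prop where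
  one_le : 1 ≤ w₀
  le : w₀ ≤ S.W
  pos : 0 < S.η w₀
  max : ∀ w, 1 ≤ w → w ≤ S.W → 0 < S.η w → w ≤ w₀

/-- Marginal values `D` and optimal Lagrangian cost `c` of the problem of minimizing mean queue
length plus `lam` times average power. -/
structure ValueCert (S : SchedModel) (lam : ℝ) (w₀ : ℕ) (c : ℝ) (D : ℕ → ℝ) : Prop where
  zero : D 0 = lam * S.P w₀
  step : ∀ j, D j + 1 ≤ D (j + 1)
  eq : ∀ j : ℕ, (j : ℕ∞) < S.K → j + S.valueDrift (S.txGain lam) (fun i => D (j + i)) = c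
  top : ∀ n : ℕ, S.K ≤ (n : ℕ∞) → ∀ w, 1 ≤ w → w ≤ S.W → lam * S.P w < D n
  growth : ∃ C, ∀ j, D j ≤ C * (1 + j)

variable {S : SchedModel} {f : ℕ → ℕ → ℝ} {π : ℕ → ℝ} {lam : ℝ}

theorem exists_bestChannel (S : SchedModel) : ∃ w, S.IsBestChannel w := by
  classical
  have hne : ((Finset.Icc 1 S.W).filter fun w => 0 < S.η w).Nonempty := by
    by_contra hc
    rw [Finset.not_nonempty_iff_eq_empty, Finset.filter_eq_empty_iff] at hc
    have : ∑ w ∈ Finset.Icc 1 S.W, S.η w = 0 := Finset.sum_eq_zero fun w hw => by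
      rw [Finset.mem_Icc] at hw
      exact le_antisymm (not_lt.1 (hc (Finset.mem_Icc.2 hw))) (S.η_nonneg w hw.1 hw.2)
    rw [S.η_sum] at this
    exact one_ne_zero this
  have hmem := Finset.max'_mem _ hne
  set w := Finset.max' _ hne
  rw [Finset.mem_filter, Finset.mem_Icc] at hmem
  exact ⟨w, hmem.1.1, hmem.1.2, hmem.2, fun v h1 h2 h3 => Finset.le_max' _ _
    (Finset.mem_filter.2 ⟨Finset.mem_Icc.2 ⟨h1, h2⟩, h3⟩)⟩

theorem P_le_of_le {v w : ℕ} (h1 : 1 ≤ v) (hvw : v ≤ w) (hw : w ≤ S.W) : S.P w ≤ S.P v := by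
  rcases hvw.eq_or_lt with rfl | h
  · exact le_rfl
  · exact (S.P_anti v w h1 h hw).le

theorem IsBestChannel.P_pos {w₀ : ℕ} (h : S.IsBestChannel w₀) : 0 < S.P w₀ :=
  S.P_pos _ h.one_le h.le

theorem IsBestChannel.P_le {w₀ w : ℕ} (h : S.IsBestChannel w₀) (h1 : 1 ≤ w) (h2 : w ≤ S.W)
    (hη : 0 < S.η w) : S.P w₀ ≤ S.P w :=
  P_le_of_le h1 (h.max w h1 h2 hη) h.le

theorem abs_txGain_le (S : SchedModel) (lam x : ℝ) :
    |S.txGain lam x| ≤ |x| + ∑ w ∈ Finset.Icc 1 S.W, |lam * S.P w| := by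
  have h1 : ∀ w ∈ Finset.Icc 1 S.W, S.η w ≤ 1 ∧ 0 ≤ S.η w := fun w hw => by
    constructor
    · rw [← S.η_sum]
      exact Finset.single_le_sum (fun v hv => S.η_nonneg v (Finset.mem_Icc.1 hv).1
        (Finset.mem_Icc.1 hv).2) hw
    · exact S.η_nonneg w (Finset.mem_Icc.1 hw).1 (Finset.mem_Icc.1 hw).2
  calc |S.txGain lam x| ≤ ∑ w ∈ Finset.Icc 1 S.W, |S.η w * min 0 (lam * S.P w - x)| :=
        Finset.abs_sum_le_sum_abs _ _
    _ ≤ ∑ w ∈ Finset.Icc 1 S.W, (S.η w * |x| + |lam * S.P w|) := by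
        refine Finset.sum_le_sum fun w hw => ?_
        rw [abs_mul, abs_of_nonneg (h1 w hw).2]
        have h2 : |min 0 (lam * S.P w - x)| ≤ |x| + |lam * S.P w| := by
          rcases le_total 0 (lam * S.P w - x) with h | h
          · rw [min_eq_left h, abs_zero]; positivity
          · rw [min_eq_right h, add_comm]; exact abs_sub _ _
        have := mul_le_mul_of_nonneg_left h2 (h1 w hw).2
        have := mul_le_of_le_one_left (abs_nonneg (lam * S.P w)) (h1 w hw).1
        linarith
    _ = _ := by rw [Finset.sum_add_distrib, ← Finset.sum_mul, S.η_sum, one_mul]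

theorem decisionLoss_eq (S : SchedModel) (lam : ℝ) (D : ℕ → ℝ) (f : ℕ → ℕ → ℝ) (t : ℕ) :
    S.decisionLoss lam D f t
      = lam * S.txCost f t - D t * S.txProb f t - S.txGain lam (D t) := by
  rw [decisionLoss, txCost, txProb, txGain, Finset.mul_sum, Finset.mul_sum,
    ← Finset.sum_sub_distrib, ← Finset.sum_sub_distrib]
  exact Finset.sum_congr rfl fun w _ => by ring

theorem mul_sub_min_nonneg {a f : ℝ} (h0 : 0 ≤ f) (h1 : f ≤ 1) : 0 ≤ a * f - min 0 a := by
  rcases le_total 0 a with h | h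
  · rw [min_eq_left h]; have := mul_nonneg h h0; linarith
  · rw [min_eq_right h]; nlinarith

theorem decisionLoss_nonneg (h0 : ∀ t w, 0 ≤ f t w) (h1 : ∀ t w, f t w ≤ 1) (D : ℕ → ℝ) (t : ℕ) :
    0 ≤ S.decisionLoss lam D f t :=
  Finset.sum_nonneg fun w hw => by
    rw [Finset.mem_Icc] at hw
    exact mul_nonneg (S.η_nonneg w hw.1 hw.2) (mul_sub_min_nonneg (h0 t w) (h1 t w))

theorem Admissible.hasSum_power (h : S.Admissible f π) :
    HasSum (fun t => S.updatedProb π t * S.txCost f t) (S.meanPower f π) :=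
  (summable_mul_of_bounded (S.updatedProb_nonneg h.nonneg)
    (S.hasSum_updatedProb_one h.hasSum_one).summable
    (S.abs_txCost_le h.f_nonneg h.f_le_one)).hasSum

/-- The Lagrangian cost splits into the mean of the value drift and the loss of the decisions. -/
theorem Admissible.hasSum_decisionLoss (h : S.Admissible f π) (lam : ℝ) {D : ℕ → ℝ}
    (hD : ∀ m, Summable fun k => π k * D (k + m)) {s : ℝ}
    (hs : HasSum (fun k => π k * S.valueDrift (S.txGain lam) fun i => D (k + i)) s) :
    HasSum (fun t => S.updatedProb π t * S.decisionLoss lam D f t)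
      (lam * S.meanPower f π - s) := by
  have hψ : ∀ m, Summable fun k => π k * S.txGain lam (D (k + m)) := by
    intro m
    refine Summable.of_norm_bounded ((hD m).abs.add
      (h.hasSum_one.summable.mul_right (∑ w ∈ Finset.Icc 1 S.W, |lam * S.P w|))) fun k => ?_
    rw [Real.norm_eq_abs, abs_mul, abs_mul, abs_of_nonneg (h.nonneg k), ← mul_add]
    exact mul_le_mul_of_nonneg_left (S.abs_txGain_le lam _) (h.nonneg k)
  have a1 := S.hasSum_upRate fun m => (hD m).hasSum
  have a2 := S.hasSum_mul_tail fun m => (hD m).hasSum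
  have b1 := S.hasSum_updatedProb (u := fun t => S.txGain lam (D t)) fun m => (hψ m).hasSum
  have b2 := S.hasSum_mul_arrival (u := fun t => S.txGain lam (D t)) fun m => (hψ m).hasSum
  have hs' := (b2.add a2).congr_fun (g := fun k =>
    π k * S.valueDrift (S.txGain lam) fun i => D (k + i)) fun k => by
      rw [valueDrift, mul_add]
  rw [hs.unique hs']
  have := ((h.hasSum_power.mul_left lam).sub a1).sub b1
  rw [sub_sub, add_comm] at this
  refine this.congr_fun fun t => ?_
  rw [decisionLoss_eq, ← h.balance t]
  ring

theorem ValueCert.mono {w₀ : ℕ} {c : ℝ} {D : ℕ → ℝ} (h : S.ValueCert lam w₀ c D) :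
    StrictMono D := strictMono_nat_of_lt_succ fun j => by linarith [h.step j]

theorem ValueCert.nonneg {w₀ : ℕ} {c : ℝ} {D : ℕ → ℝ} (h : S.ValueCert lam w₀ c D)
    (hw : S.IsBestChannel w₀) (hl : 0 ≤ lam) (j : ℕ) : 0 ≤ D j :=
  (h.zero ▸ mul_nonneg hl hw.P_pos.le : 0 ≤ D 0).trans (h.mono.monotone (Nat.zero_le j))

theorem ValueCert.hasSum {w₀ : ℕ} {c : ℝ} {D : ℕ → ℝ} (h : S.ValueCert lam w₀ c D)
    (hw : S.IsBestChannel w₀) (hl : 0 ≤ lam) (ha : S.Admissible f π)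
    (hq : Summable fun k => π k * (k : ℝ)) :
    HasSum (fun t => S.updatedProb π t * S.decisionLoss lam D f t)
      (meanQueue π + lam * S.meanPower f π - c) := by
  obtain ⟨C, hC⟩ := h.growth
  have hD : ∀ m, Summable fun k => π k * D (k + m) := by
    intro m
    refine Summable.of_nonneg_of_le (fun k => mul_nonneg (ha.nonneg k) (h.nonneg hw hl _))
      (fun k => mul_le_mul_of_nonneg_left (hC (k + m)) (ha.nonneg k)) ?_
    have := (ha.hasSum_one.summable.mul_right (C * (1 + m))).add (hq.mul_right C)
    refine this.congr fun k => ?_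
    push_cast; ring
  have hs : HasSum (fun k => π k * S.valueDrift (S.txGain lam) fun i => D (k + i))
      (1 * c - meanQueue π) := by
    refine ((ha.hasSum_one.mul_right c).sub hq.hasSum).congr_fun fun k => ?_
    by_cases hk : (k : ℕ∞) < S.K
    · rw [← h.eq k hk]; ring
    · rw [ha.supp k (not_lt.1 hk)]; ring
  have := ha.hasSum_decisionLoss lam hD hs
  rwa [show lam * S.meanPower f π - (1 * c - meanQueue π)
    = meanQueue π + lam * S.meanPower f π - c by ring] at this

theorem ValueCert.le {w₀ : ℕ} {c : ℝ} {D : ℕ → ℝ} (h : S.ValueCert lam w₀ c D)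
    (hw : S.IsBestChannel w₀) (hl : 0 ≤ lam) (ha : S.Admissible f π)
    (hq : Summable fun k => π k * (k : ℝ)) : c ≤ meanQueue π + lam * S.meanPower f π := by
  have := (h.hasSum hw hl ha hq).nonneg fun t =>
    mul_nonneg (S.updatedProb_nonneg ha.nonneg t) (decisionLoss_nonneg ha.f_nonneg ha.f_le_one D t)
  linarith

theorem mul_sub_min_eq_zero {a f : ℝ} (h : a * f - min 0 a = 0) :
    (a < 0 → f = 1) ∧ (0 < a → f = 0) := by
  constructor
  · intro ha
    rw [min_eq_right ha.le] at h
    have : a * (f - 1) = 0 := by linarith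
    linarith [(mul_eq_zero.1 this).resolve_left ha.ne]
  · intro ha
    rw [min_eq_left ha.le, sub_zero] at h
    exact (mul_eq_zero.1 h).resolve_left ha.ne'

theorem decisionLoss_eq_zero (h0 : ∀ t w, 0 ≤ f t w) (h1 : ∀ t w, f t w ≤ 1) {D : ℕ → ℝ} {t w : ℕ}
    (h : S.decisionLoss lam D f t = 0) (hw1 : 1 ≤ w) (hw2 : w ≤ S.W) (hη : 0 < S.η w) :
    (lam * S.P w < D t → f t w = 1) ∧ (D t < lam * S.P w → f t w = 0) := by
  have := (Finset.sum_eq_zero_iff_of_nonneg fun w hw => by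
    rw [Finset.mem_Icc] at hw
    exact mul_nonneg (S.η_nonneg w hw.1 hw.2) (mul_sub_min_nonneg (h0 t w) (h1 t w))).1 h w
    (Finset.mem_Icc.2 ⟨hw1, hw2⟩)
  have := mul_sub_min_eq_zero ((mul_eq_zero.1 this).resolve_left hη.ne')
  exact ⟨fun h => this.1 (by linarith), fun h => this.2 (by linarith)⟩

theorem Admissible.decisionLoss_eq_zero (ha : S.Admissible f π) {D : ℕ → ℝ}
    (h : HasSum (fun t => S.updatedProb π t * S.decisionLoss lam D f t) 0) {t : ℕ}
    (ht : 0 < S.updatedProb π t) : S.decisionLoss lam D f t = 0 := by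
  have h2 := (hasSum_zero_iff_of_nonneg fun t => mul_nonneg (S.updatedProb_nonneg ha.nonneg t)
    (decisionLoss_nonneg ha.f_nonneg ha.f_le_one D t)).1 h
  exact (mul_eq_zero.1 (congrFun h2 t)).resolve_left ht.ne'

/-- Complementary slackness for a policy that attains the optimal Lagrangian cost. -/
theorem ValueCert.slackness {w₀ : ℕ} {c : ℝ} {D : ℕ → ℝ} (h : S.ValueCert lam w₀ c D)
    (hw : S.IsBestChannel w₀) (hl : 0 ≤ lam) (ha : S.Admissible f π)
    (hq : Summable fun k => π k * (k : ℝ)) (hle : meanQueue π + lam * S.meanPower f π ≤ c)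
    {t w : ℕ} (ht : 0 < S.updatedProb π t) (hw1 : 1 ≤ w) (hw2 : w ≤ S.W) (hη : 0 < S.η w) :
    (lam * S.P w < D t → f t w = 1) ∧ (D t < lam * S.P w → f t w = 0) := by
  have h1 := h.hasSum hw hl ha hq
  rw [le_antisymm hle (h.le hw hl ha hq), sub_self] at h1
  exact SchedModel.decisionLoss_eq_zero ha.f_nonneg ha.f_le_one (ha.decisionLoss_eq_zero h1 ht)
    hw1 hw2 hη

/-- The policies that follow the marginal values, with free choice at ties. -/
structure FollowsValues (S : SchedModel) (lam : ℝ) (D : ℕ → ℝ) (f : ℕ → ℕ → ℝ) : Prop where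
  f_nonneg : ∀ t w, 0 ≤ f t w
  f_le_one : ∀ t w, f t w ≤ 1
  f_empty : ∀ w, f 0 w = 0
  above : ∀ t w, 1 ≤ t → 1 ≤ w → w ≤ S.W → lam * S.P w < D t → f t w = 1
  below : ∀ t w, 1 ≤ w → w ≤ S.W → D t < lam * S.P w → f t w = 0

theorem FollowsValues.cost_eq {w₀ : ℕ} {c : ℝ} {D : ℕ → ℝ} (hf : S.FollowsValues lam D f)
    (h : S.ValueCert lam w₀ c D) (hw : S.IsBestChannel w₀) (hl : 0 ≤ lam) (ha : S.Admissible f π)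
    (hq : Summable fun k => π k * (k : ℝ)) : meanQueue π + lam * S.meanPower f π = c := by
  have h1 := h.hasSum hw hl ha hq
  have h2 : (fun t => S.updatedProb π t * S.decisionLoss lam D f t) = fun _ => 0 := by
    funext t
    rw [mul_eq_zero]
    refine Or.inr (Finset.sum_eq_zero fun w hwm => ?_)
    rw [Finset.mem_Icc] at hwm
    rcases (S.η_nonneg w hwm.1 hwm.2).eq_or_lt with hη | hη
    · rw [← hη, zero_mul]
    rcases Nat.eq_zero_or_pos t with rfl | ht
    · have := mul_le_mul_of_nonneg_left (hw.P_le hwm.1 hwm.2 hη) hl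
      rw [hf.f_empty, h.zero, min_eq_left (by linarith)]; ring
    rcases lt_trichotomy (lam * S.P w) (D t) with hlt | heq | hgt
    · rw [hf.above t w ht hwm.1 hwm.2 hlt, min_eq_right (by linarith)]; ring
    · rw [heq]; simp
    · rw [hf.below t w hwm.1 hwm.2 hgt, min_eq_left (by linarith)]; ring
  rw [h2] at h1
  linarith [h1.unique hasSum_zero]

theorem FollowsValues.txProb_pos {w₀ : ℕ} {c : ℝ} {D : ℕ → ℝ} (hf : S.FollowsValues lam D f)
    (h : S.ValueCert lam w₀ c D) (hw : S.IsBestChannel w₀) {t : ℕ} (ht : 1 ≤ t) :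
    0 < S.txProb f t := by
  have h1 : f t w₀ = 1 := hf.above t w₀ ht hw.one_le hw.le (h.zero ▸ h.mono (by omega))
  refine lt_of_lt_of_le hw.pos ?_
  have := Finset.single_le_sum (f := fun w => S.η w * f t w) (fun w hwm => by
    rw [Finset.mem_Icc] at hwm
    exact mul_nonneg (S.η_nonneg w hwm.1 hwm.2) (hf.f_nonneg t w))
    (Finset.mem_Icc.2 ⟨hw.one_le, hw.le⟩)
  simpa [h1, txProb] using this

theorem txProb_eq_one (S : SchedModel) {t : ℕ} (h : ∀ w, 1 ≤ w → w ≤ S.W → f t w = 1) :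
    S.txProb f t = 1 := by
  rw [← S.η_sum, txProb]
  refine Finset.sum_congr rfl fun w hw => ?_
  rw [Finset.mem_Icc] at hw
  rw [h w hw.1 hw.2, mul_one]

theorem ValueCert.eventually {w₀ : ℕ} {c : ℝ} {D : ℕ → ℝ} (h : S.ValueCert lam w₀ c D) :
    ∃ N : ℕ, 1 ≤ N ∧ ∀ t, N ≤ t → ∀ w, 1 ≤ w → w ≤ S.W → lam * S.P w < D t := by
  have h1 : ∀ j : ℕ, D 0 + j ≤ D j := fun j => by
    induction j with
    | zero => simp
    | succ j ih => have := h.step j; push_cast; linarith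
  obtain ⟨N, hN⟩ := exists_nat_gt ((∑ w ∈ Finset.Icc 1 S.W, |lam * S.P w|) - D 0)
  refine ⟨N + 1, by omega, fun t ht w hw1 hw2 => ?_⟩
  have h2 := Finset.single_le_sum (f := fun w => |lam * S.P w|) (fun w _ => abs_nonneg _)
    (Finset.mem_Icc.2 ⟨hw1, hw2⟩)
  have h3 := le_abs_self (lam * S.P w)
  have h4 : ((N + 1 : ℕ) : ℝ) ≤ t := by exact_mod_cast ht
  push_cast at h4
  linarith [h1 t]

theorem FollowsValues.exists_admissible {w₀ : ℕ} {c : ℝ} {D : ℕ → ℝ}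
    (hf : S.FollowsValues lam D f) (h : S.ValueCert lam w₀ c D) (hw : S.IsBestChannel w₀)
    (hθ : 0 < S.θ 0) (hS : S.FiniteBufferSingleArrival) (hrate : S.arrivalRate < 1) :
    ∃ π, S.Admissible f π ∧ Summable fun k => π k * (k : ℝ) := by
  obtain ⟨N, hN1, hN⟩ := h.eventually
  exact ⟨_, SchedModel.exists_admissible hθ hS hf.f_nonneg hf.f_le_one hf.f_empty
    (fun t ht => hf.txProb_pos h hw ht) zero_le_one hrate (N := N)
    (fun t ht => (S.txProb_eq_one fun w h1 h2 =>
      hf.above t w (by omega) h1 h2 (hN t ht w h1 h2)).ge)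
    (fun t ht => S.txProb_eq_one fun w h1 h2 => hf.above t w
      (by exact_mod_cast S.K_pos.trans ht) h1 h2 (h.top t ht w h1 h2))⟩

end

noncomputable section

/-- `txGain`, modified below the smallest relevant price `lam P_{w₀}` so as to be injective. -/
def extGain (S : SchedModel) (lam : ℝ) (w₀ : ℕ) (x : ℝ) : ℝ :=
  S.txGain lam x + max 0 (lam * S.P w₀ - x)

variable {S : SchedModel} {lam : ℝ} {w₀ : ℕ}

theorem extGain_eq_sum (x : ℝ) : S.extGain lam w₀ x
    = ∑ w ∈ Finset.Icc 1 S.W,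
      S.η w * (min 0 (lam * S.P w - x) + max 0 (lam * S.P w₀ - x)) := by
  simp_rw [mul_add]
  rw [Finset.sum_add_distrib, ← Finset.sum_mul, S.η_sum, one_mul]
  rfl

theorem extGain_sub_le (hw : S.IsBestChannel w₀) (hl : 0 ≤ lam) {x y : ℝ} (hxy : x ≤ y) :
    S.extGain lam w₀ x - S.extGain lam w₀ y ≤ y - x := by
  rw [extGain_eq_sum, extGain_eq_sum, ← Finset.sum_sub_distrib]
  calc _ ≤ ∑ w ∈ Finset.Icc 1 S.W, S.η w * (y - x) := ?_
    _ = y - x := by rw [← Finset.sum_mul, S.η_sum, one_mul]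
  refine Finset.sum_le_sum fun w hwm => ?_
  rw [Finset.mem_Icc] at hwm
  rcases (S.η_nonneg w hwm.1 hwm.2).eq_or_lt with hη | hη
  · rw [← hη]; simp
  have := mul_le_mul_of_nonneg_left (hw.P_le hwm.1 hwm.2 hη) hl
  rw [← mul_sub]
  refine mul_le_mul_of_nonneg_left ?_ hη.le
  rcases min_cases 0 (lam * S.P w - x) with h1 | h1 <;>
  rcases min_cases 0 (lam * S.P w - y) with h2 | h2 <;>
  rcases max_cases 0 (lam * S.P w₀ - x) with h3 | h3 <;>
  rcases max_cases 0 (lam * S.P w₀ - y) with h4 | h4 <;> linarith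

theorem le_extGain_sub (hw : S.IsBestChannel w₀) {x y : ℝ} (hxy : x ≤ y) :
    S.η w₀ * (y - x) ≤ S.extGain lam w₀ x - S.extGain lam w₀ y := by
  rw [extGain_eq_sum, extGain_eq_sum, ← Finset.sum_sub_distrib]
  have key : ∀ w ∈ Finset.Icc 1 S.W,
      0 ≤ S.η w * (min 0 (lam * S.P w - x) + max 0 (lam * S.P w₀ - x))
        - S.η w * (min 0 (lam * S.P w - y) + max 0 (lam * S.P w₀ - y)) := by
    intro w hwm
    rw [Finset.mem_Icc] at hwm
    rw [← mul_sub]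
    refine mul_nonneg (S.η_nonneg w hwm.1 hwm.2) ?_
    have h1 : min 0 (lam * S.P w - y) ≤ min 0 (lam * S.P w - x) :=
      min_le_min_left _ (by linarith)
    have h2 : max 0 (lam * S.P w₀ - y) ≤ max 0 (lam * S.P w₀ - x) :=
      max_le_max_left _ (by linarith)
    linarith
  refine le_trans (le_of_eq ?_) (Finset.single_le_sum key
    (Finset.mem_Icc.2 ⟨hw.one_le, hw.le⟩))
  rw [min_add_max, min_add_max]; ring

theorem continuous_extGain (S : SchedModel) (lam : ℝ) (w₀ : ℕ) :
    Continuous (S.extGain lam w₀) := by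
  unfold extGain txGain
  fun_prop

theorem txGain_eq_zero (hw : S.IsBestChannel w₀) (hl : 0 ≤ lam) {x : ℝ}
    (hx : x ≤ lam * S.P w₀) : S.txGain lam x = 0 := by
  refine Finset.sum_eq_zero fun w hwm => ?_
  rw [Finset.mem_Icc] at hwm
  rcases (S.η_nonneg w hwm.1 hwm.2).eq_or_lt with hη | hη
  · rw [← hη, zero_mul]
  have := mul_le_mul_of_nonneg_left (hw.P_le hwm.1 hwm.2 hη) hl
  rw [min_eq_left (by linarith), mul_zero]

theorem extGain_eq_txGain {x : ℝ} (hx : lam * S.P w₀ ≤ x) :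
    S.extGain lam w₀ x = S.txGain lam x := by
  rw [extGain, max_eq_left (by linarith), add_zero]

theorem extGain_self (hw : S.IsBestChannel w₀) (hl : 0 ≤ lam) :
    S.extGain lam w₀ (lam * S.P w₀) = 0 := by
  rw [extGain_eq_txGain le_rfl, txGain_eq_zero hw hl le_rfl]

theorem extGain_of_large (hw : S.IsBestChannel w₀) (hl : 0 ≤ lam) {x : ℝ}
    (hx : lam * S.P 1 ≤ x) :
    S.extGain lam w₀ x = lam * ∑ w ∈ Finset.Icc 1 S.W, S.η w * S.P w - x := by
  have hp : ∀ w, 1 ≤ w → w ≤ S.W → lam * S.P w ≤ x := fun w h1 h2 =>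
    (mul_le_mul_of_nonneg_left (P_le_of_le le_rfl h1 h2) hl).trans hx
  rw [extGain_eq_txGain (hp _ hw.one_le hw.le), txGain]
  have : x = ∑ w ∈ Finset.Icc 1 S.W, S.η w * x := by rw [← Finset.sum_mul, S.η_sum, one_mul]
  conv_rhs => rw [this]
  rw [Finset.mul_sum, ← Finset.sum_sub_distrib]
  refine Finset.sum_congr rfl fun w hwm => ?_
  rw [Finset.mem_Icc] at hwm
  rw [min_eq_right (by linarith [hp w hwm.1 hwm.2])]; ring

theorem extGain_strictAnti (hw : S.IsBestChannel w₀) : StrictAnti (S.extGain lam w₀) := by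
  intro x y hxy
  have := le_extGain_sub (lam := lam) hw hxy.le
  have := mul_pos hw.pos (sub_pos.2 hxy)
  linarith

theorem exists_inverse_extGain (hw : S.IsBestChannel w₀) (lam : ℝ) :
    ∃ F : ℝ → ℝ, Continuous F ∧ ∀ y, S.extGain lam w₀ (F y) = y := by
  set e : ℝ → ℝ := fun x => -S.extGain lam w₀ x with he
  have hmono : StrictMono e := fun x y h => neg_lt_neg (extGain_strictAnti hw h)
  have hcont : Continuous e := (continuous_extGain S lam w₀).neg
  have hsurj : Function.Surjective e := by
    refine hcont.surjective ?_ ?_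
    · refine Filter.tendsto_atTop_mono' _ ?_ (Filter.tendsto_atTop_add_const_left _ (e 0)
        (Filter.tendsto_id.const_mul_atTop hw.pos))
      filter_upwards [Filter.eventually_ge_atTop 0] with x hx
      have := le_extGain_sub (lam := lam) hw hx
      simp only [he, id]; linarith
    · refine Filter.tendsto_atBot_mono' _ ?_ (Filter.tendsto_atBot_add_const_left _ (e 0)
        (Filter.tendsto_id.const_mul_atBot hw.pos))
      filter_upwards [Filter.eventually_le_atBot 0] with x hx
      have := le_extGain_sub (lam := lam) hw hx
      simp only [he, id]; linarith
  set I := hmono.orderIsoOfSurjective e hsurj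
  refine ⟨fun y => I.symm (-y), I.symm.continuous.comp continuous_neg, fun y => ?_⟩
  have : e (I.symm (-y)) = -y := I.apply_symm_apply (-y)
  simpa [he] using this

/-- The part of the value drift that does not involve the first marginal value. -/
def tailDrift (S : SchedModel) (ψ : ℝ → ℝ) (e : ℕ → ℝ) : ℝ :=
  ∑ m ∈ Finset.range S.M, (S.θ (m + 1) * ψ (e m) + S.arrivalTail (m + 1) * e m)

theorem valueDrift_eq (S : SchedModel) (ψ : ℝ → ℝ) (e : ℕ → ℝ) :
    S.valueDrift ψ e = S.θ 0 * ψ (e 0) + S.tailDrift ψ fun i => e (i + 1) := by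
  rw [valueDrift, tailDrift, Finset.sum_range_succ', sum_Icc_one_eq, Finset.sum_add_distrib]
  ring

theorem add_one_le_of_valueDrift (hw : S.IsBestChannel w₀) (hl : 0 ≤ lam) (hθ : 0 < S.θ 0)
    {e : ℕ → ℝ} (hmono : ∀ i, e (i + 1) ≤ e (i + 2))
    (hd : S.valueDrift (S.extGain lam w₀) e
      = 1 + S.valueDrift (S.extGain lam w₀) fun i => e (i + 1)) :
    e 0 + 1 ≤ e 1 := by
  rw [valueDrift_eq, valueDrift_eq] at hd
  have ht : S.tailDrift (S.extGain lam w₀) (fun i => e (i + 1))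
      ≤ S.tailDrift (S.extGain lam w₀) fun i => e (i + 1 + 1) := by
    refine Finset.sum_le_sum fun m _ => ?_
    have h1 := extGain_sub_le hw hl (hmono m)
    have h2 := mul_le_mul_of_nonneg_left h1 (S.θ_nonneg (m + 1))
    have h3 := mul_le_mul_of_nonneg_right (S.θ_le_arrivalTail (m + 1)) (sub_nonneg.2 (hmono m))
    simp only [add_assoc, Nat.reduceAdd] at h2 h3 ⊢
    linarith
  have hθ1 : S.θ 0 ≤ 1 := by
    rw [← S.arrivalTail_zero]; exact S.θ_le_arrivalTail 0
  simp only [zero_add] at hd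
  have h4 : 1 ≤ S.θ 0 * (S.extGain lam w₀ (e 0) - S.extGain lam w₀ (e 1)) := by linarith
  have h5 : e 0 ≤ e 1 := by
    by_contra! hc
    have := extGain_strictAnti (lam := lam) hw hc
    have := mul_nonpos_of_nonneg_of_nonpos hθ.le (by linarith :
      S.extGain lam w₀ (e 0) - S.extGain lam w₀ (e 1) ≤ 0)
    linarith
  have h6 := extGain_sub_le hw hl h5
  have h7 := mul_le_mul_of_nonneg_left h6 hθ.le
  have h8 := mul_le_mul_of_nonneg_right hθ1 (sub_nonneg.2 h5)
  linarith

/-- Prepend a term to a sequence. -/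
def prepend (a : ℝ) (e : ℕ → ℝ) : ℕ → ℝ
  | 0 => a
  | i + 1 => e i

/-- Marginal values from level `N - n` on, computed backwards from the values `T` above `N`. -/
def backwardValues (S : SchedModel) (F ψ : ℝ → ℝ) (c : ℝ) (N : ℕ) (T : ℕ → ℝ) : ℕ → ℕ → ℝ
  | 0 => T
  | n + 1 => prepend (F ((c - ((N : ℝ) - (n + 1 : ℕ)) -
      S.tailDrift ψ (backwardValues S F ψ c N T n)) / S.θ 0)) (backwardValues S F ψ c N T n)

section backward

variable {F ψ : ℝ → ℝ} {c : ℝ} {N : ℕ} {T : ℕ → ℝ}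

theorem backwardValues_add (n i : ℕ) : S.backwardValues F ψ c N T n (n + i) = T i := by
  induction n with
  | zero => simp [backwardValues]
  | succ n ih => rw [show n + 1 + i = (n + i) + 1 by omega]; exact ih

theorem valueDrift_backwardValues_zero (hθ : 0 < S.θ 0) (hF : ∀ y, ψ (F y) = y) (n : ℕ) :
    ((N : ℝ) - (n + 1 : ℕ)) + S.valueDrift ψ (S.backwardValues F ψ c N T (n + 1)) = c := by
  rw [valueDrift_eq]
  have h1 : S.backwardValues F ψ c N T (n + 1) 0 = F ((c - ((N : ℝ) - (n + 1 : ℕ)) -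
      S.tailDrift ψ (S.backwardValues F ψ c N T n)) / S.θ 0) := rfl
  have h2 : (fun i => S.backwardValues F ψ c N T (n + 1) (i + 1))
      = S.backwardValues F ψ c N T n := rfl
  rw [h1, h2, hF, mul_div_cancel₀ _ hθ.ne']
  ring

theorem valueDrift_backwardValues (hθ : 0 < S.θ 0) (hF : ∀ y, ψ (F y) = y)
    (hT : N + S.valueDrift ψ T = c) (n i : ℕ) (hi : i ≤ n) :
    ((N : ℝ) - n + i) + S.valueDrift ψ (fun k => S.backwardValues F ψ c N T n (i + k)) = c := by
  induction n generalizing i with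
  | zero =>
    obtain rfl : i = 0 := by omega
    simpa [backwardValues] using hT
  | succ n ih =>
    cases i with
    | zero =>
      have := valueDrift_backwardValues_zero (N := N) (T := T) (c := c) hθ hF n
      simpa using this
    | succ i =>
      have := ih i (by omega)
      have h2 : (fun k => S.backwardValues F ψ c N T (n + 1) (i + 1 + k))
          = fun k => S.backwardValues F ψ c N T n (i + k) := by
        funext k; rw [show i + 1 + k = (i + k) + 1 by omega]; rfl
      rw [h2]
      refine Eq.trans ?_ this
      push_cast; ring

theorem backwardValues_step (hw : S.IsBestChannel w₀) (hl : 0 ≤ lam) (hθ : 0 < S.θ 0)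
    (hF : ∀ y, S.extGain lam w₀ (F y) = y)
    (hT : N + S.valueDrift (S.extGain lam w₀) T = c) (hstep : ∀ i, T i + 1 ≤ T (i + 1))
    (n i : ℕ) : S.backwardValues F (S.extGain lam w₀) c N T n i + 1
      ≤ S.backwardValues F (S.extGain lam w₀) c N T n (i + 1) := by
  induction n generalizing i with
  | zero => exact hstep i
  | succ n ih =>
    cases i with
    | succ i => exact ih i
    | zero =>
      have hm : ∀ i, S.backwardValues F (S.extGain lam w₀) c N T n i
          ≤ S.backwardValues F (S.extGain lam w₀) c N T n (i + 1) := fun i => by linarith [ih i]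
      refine add_one_le_of_valueDrift hw hl hθ hm ?_
      have h1 := valueDrift_backwardValues_zero (N := N) (T := T) (c := c) hθ hF n
      have h2 := valueDrift_backwardValues hθ hF hT n 0 (Nat.zero_le _)
      simp only [zero_add] at h2
      have h3 : (fun i => S.backwardValues F (S.extGain lam w₀) c N T (n + 1) (i + 1))
        = S.backwardValues F (S.extGain lam w₀) c N T n := rfl
      rw [h3]
      push_cast at h1 h2
      linarith

theorem tailDrift_nonneg (hw : S.IsBestChannel w₀) (hl : 0 ≤ lam) {e : ℕ → ℝ}
    (he : ∀ i, lam * S.P w₀ ≤ e i) : 0 ≤ S.tailDrift (S.extGain lam w₀) e := by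
  refine Finset.sum_nonneg fun m _ => ?_
  have h1 := extGain_sub_le hw hl (he m)
  rw [extGain_self hw hl] at h1
  have h2 := mul_nonneg hl hw.P_pos.le
  have h3 := mul_le_mul_of_nonneg_right (S.θ_le_arrivalTail (m + 1)) (h2.trans (he m))
  have h4 := mul_nonneg (S.θ_nonneg (m + 1))
    (by linarith : 0 ≤ S.extGain lam w₀ (e m) + e m)
  linarith

theorem le_backwardValues (hw : S.IsBestChannel w₀) (hl : 0 ≤ lam) (hθ : 0 < S.θ 0)
    (hF : ∀ y, S.extGain lam w₀ (F y) = y) (hT : ∀ i, lam * S.P w₀ ≤ T i) (hc : c ≤ 0)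
    (n : ℕ) (hn : n ≤ N) (i : ℕ) :
    lam * S.P w₀ ≤ S.backwardValues F (S.extGain lam w₀) c N T n i := by
  induction n generalizing i with
  | zero => exact hT i
  | succ n ih =>
    cases i with
    | succ i => exact ih (by omega) i
    | zero =>
      have h1 := valueDrift_backwardValues_zero (N := N) (T := T) (c := c) hθ hF n
      have h2 := tailDrift_nonneg hw hl (ih (by omega))
      rw [valueDrift_eq] at h1
      have h3 : (fun i => S.backwardValues F (S.extGain lam w₀) c N T (n + 1) (i + 1))
        = S.backwardValues F (S.extGain lam w₀) c N T n := rfl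
      rw [h3] at h1
      have h4 : ((n + 1 : ℕ) : ℝ) ≤ N := by exact_mod_cast hn
      by_contra! hlt
      have h5 := extGain_strictAnti (lam := lam) hw hlt
      rw [extGain_self hw hl] at h5
      have := mul_pos hθ h5
      linarith

end backward

theorem continuous_backwardValues {F ψ : ℝ → ℝ} (hF : Continuous F) (hψ : Continuous ψ)
    {c : ℝ → ℝ} (hc : Continuous c) {T : ℝ → ℕ → ℝ} (hT : ∀ i, Continuous fun b => T b i)
    (N n i : ℕ) : Continuous fun b => S.backwardValues F ψ (c b) N (T b) n i := by
  induction n generalizing i with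
  | zero => exact hT i
  | succ n ih =>
    cases i with
    | succ i => exact ih i
    | zero =>
      refine hF.comp (((hc.sub continuous_const).sub ?_).div_const _)
      exact continuous_finsetSum _ fun m _ =>
        (continuous_const.mul (hψ.comp (ih m))).add (continuous_const.mul (ih m))

theorem exists_marginalValues (hw : S.IsBestChannel w₀) (hl : 0 ≤ lam) (hθ : 0 < S.θ 0) (N : ℕ)
    {T : ℝ → ℕ → ℝ} {b₁ b₂ : ℝ} (hb : b₁ ≤ b₂) (hT : ∀ i, Continuous fun b => T b i)
    (hstep : ∀ b, b₁ ≤ b → ∀ i, T b i + 1 ≤ T b (i + 1)) (h₁ : T b₁ 0 ≤ lam * S.P w₀ + N)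
    (h₂ : lam * S.P w₀ ≤ T b₂ 0) (hc : N + S.valueDrift (S.extGain lam w₀) (T b₂) ≤ 0) :
    ∃ b, b₁ ≤ b ∧ ∃ D : ℕ → ℝ, (∀ i, D (N + i) = T b i) ∧ D 0 = lam * S.P w₀ ∧
      (∀ j, D j + 1 ≤ D (j + 1)) ∧ ∀ j : ℕ, j ≤ N →
        j + S.valueDrift (S.extGain lam w₀) (fun i => D (j + i))
          = N + S.valueDrift (S.extGain lam w₀) (T b) := by
  obtain ⟨F, hFc, hF⟩ := exists_inverse_extGain hw lam
  set c : ℝ → ℝ := fun b => N + S.valueDrift (S.extGain lam w₀) (T b) with hcdef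
  have hcc : Continuous c := by
    refine continuous_const.add (Continuous.add ?_ ?_)
    · exact continuous_finsetSum _ fun m _ =>
        continuous_const.mul ((continuous_extGain S lam w₀).comp (hT m))
    · exact continuous_finsetSum _ fun m _ => continuous_const.mul (hT m)
  set E : ℝ → ℕ → ℝ := fun b => S.backwardValues F (S.extGain lam w₀) (c b) N (T b) N with hE
  have hEstep : ∀ b, b₁ ≤ b → ∀ i, E b i + 1 ≤ E b (i + 1) := fun b hb' i =>
    backwardValues_step hw hl hθ hF rfl (hstep b hb') N i
  have hcont : Continuous fun b => E b 0 :=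
    continuous_backwardValues hFc (continuous_extGain S lam w₀) hcc hT N N 0
  have hlow : E b₁ 0 ≤ lam * S.P w₀ := by
    have h : ∀ i : ℕ, E b₁ 0 + i ≤ E b₁ i := fun i => by
      induction i with
      | zero => simp
      | succ i ih => have := hEstep b₁ le_rfl i; push_cast; linarith
    have h3 := h N
    have h4 : E b₁ N = T b₁ 0 := backwardValues_add N 0
    linarith
  have hTm : ∀ i, lam * S.P w₀ ≤ T b₂ i := fun i => by
    induction i with
    | zero => exact h₂
    | succ i ih => have := hstep b₂ hb i; linarith
  have hhigh : lam * S.P w₀ ≤ E b₂ 0 := le_backwardValues hw hl hθ hF hTm hc N le_rfl 0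
  obtain ⟨b, hbm, hb0⟩ := intermediate_value_Icc hb hcont.continuousOn ⟨hlow, hhigh⟩
  refine ⟨b, hbm.1, E b, fun i => backwardValues_add N i, hb0, hEstep b hbm.1, fun j hj => ?_⟩
  have := valueDrift_backwardValues (T := T b) hθ hF (rfl : _ = c b) N j hj
  simpa using this

theorem valueDrift_congr (S : SchedModel) {ψ ψ' : ℝ → ℝ} {e : ℕ → ℝ}
    (h : ∀ i, ψ (e i) = ψ' (e i)) : S.valueDrift ψ e = S.valueDrift ψ' e := by
  simp only [valueDrift, h]

theorem valueDrift_affine (hw : S.IsBestChannel w₀) (hl : 0 ≤ lam) {a x : ℝ} (ha : 0 ≤ a)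
    (hx : lam * S.P 1 ≤ x) :
    S.valueDrift (S.extGain lam w₀) (fun i => x + a * i)
      = lam * ∑ w ∈ Finset.Icc 1 S.W, S.η w * S.P w - (1 - S.arrivalRate) * x
        + a * (∑ i ∈ Finset.Icc 1 S.M, S.arrivalTail i * (i : ℝ) - S.arrivalRate) := by
  set Q := lam * ∑ w ∈ Finset.Icc 1 S.W, S.η w * S.P w
  have h1 : ∑ m ∈ Finset.range (S.M + 1), S.θ m * S.extGain lam w₀ (x + a * m)
      = (Q - x) - a * S.arrivalRate := by
    have : ∀ m ∈ Finset.range (S.M + 1), S.θ m * S.extGain lam w₀ (x + a * m)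
        = S.θ m * (Q - x) - a * (m * S.θ m) := fun m _ => by
      rw [extGain_of_large hw hl (by have : (0 : ℝ) ≤ a * m := by positivity
                                     linarith)]
      ring
    rw [Finset.sum_congr rfl this, Finset.sum_sub_distrib, ← Finset.sum_mul, S.θ_sum, one_mul,
      ← Finset.mul_sum]
    rfl
  have h2 : ∑ i ∈ Finset.Icc 1 S.M, S.arrivalTail i * (x + a * i)
      = S.arrivalRate * x + a * ∑ i ∈ Finset.Icc 1 S.M, S.arrivalTail i * (i : ℝ) := by
    rw [← S.sum_arrivalTail, Finset.sum_mul, Finset.mul_sum, ← Finset.sum_add_distrib]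
    exact Finset.sum_congr rfl fun i _ => by ring
  rw [valueDrift, h1, h2]; ring

theorem ValueCert.of_extGain {c : ℝ} {D : ℕ → ℝ} (h0 : D 0 = lam * S.P w₀)
    (hstep : ∀ j, D j + 1 ≤ D (j + 1))
    (heq : ∀ j : ℕ, (j : ℕ∞) < S.K →
      j + S.valueDrift (S.extGain lam w₀) (fun i => D (j + i)) = c)
    (htop : ∀ n : ℕ, S.K ≤ (n : ℕ∞) → ∀ w, 1 ≤ w → w ≤ S.W → lam * S.P w < D n)
    {N : ℕ} {A B : ℝ} (hB : 0 ≤ B) (hgrow : ∀ i : ℕ, D (N + i) ≤ A + B * i) :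
    S.ValueCert lam w₀ c D := by
  have hmono : Monotone D := monotone_nat_of_le_succ fun j => by linarith [hstep j]
  refine ⟨h0, hstep, fun j hj => ?_, htop, |A| + B, fun j => ?_⟩
  · rw [← heq j hj]
    congr 1
    exact S.valueDrift_congr fun i =>
      (extGain_eq_txGain (by rw [← h0]; exact hmono (Nat.zero_le _))).symm
  · have h1 := hmono (Nat.le_add_left j N)
    have h2 := hgrow j
    have h3 := le_abs_self A
    have h4 : 0 ≤ |A| * (j : ℝ) := by positivity
    nlinarith

theorem exists_valueCert_infinite (hw : S.IsBestChannel w₀) (hl : 0 ≤ lam) (hθ : 0 < S.θ 0)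
    (hrate : S.arrivalRate < 1) (hK : S.K = ⊤) : ∃ c D, S.ValueCert lam w₀ c D := by
  have hpos : 0 < 1 - S.arrivalRate := by linarith
  have hrate0 : 0 ≤ S.arrivalRate :=
    Finset.sum_nonneg fun m _ => mul_nonneg (Nat.cast_nonneg m) (S.θ_nonneg m)
  set a := (1 - S.arrivalRate)⁻¹ with ha
  have ha1 : 1 ≤ a := (one_le_inv₀ hpos).2 (by linarith)
  have hamul : (1 - S.arrivalRate) * a = 1 := mul_inv_cancel₀ hpos.ne'
  set L := lam * S.P 1
  obtain ⟨N, hN⟩ := exists_nat_gt L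
  set T : ℝ → ℕ → ℝ := fun b i => (a * N + b) + a * i with hT
  set R := lam * ∑ w ∈ Finset.Icc 1 S.W, S.η w * S.P w
    + a * (∑ i ∈ Finset.Icc 1 S.M, S.arrivalTail i * (i : ℝ) - S.arrivalRate) with hR
  have hp0 : lam * S.P w₀ ≤ L := mul_le_mul_of_nonneg_left (P_le_of_le le_rfl hw.one_le hw.le) hl
  have hp00 : 0 ≤ lam * S.P w₀ := mul_nonneg hl hw.P_pos.le
  have hdrift : ∀ b, L - a * N ≤ b → ∀ j : ℕ, N ≤ j →
      j + S.valueDrift (S.extGain lam w₀) (fun i => (a * j + b) + a * i)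
        = R - (1 - S.arrivalRate) * b := by
    intro b hb j hj
    have hj' : (N : ℝ) ≤ j := by exact_mod_cast hj
    have := mul_le_mul_of_nonneg_left hj' (zero_le_one.trans ha1)
    rw [valueDrift_affine hw hl (zero_le_one.trans ha1) (by linarith)]
    have : (1 - S.arrivalRate) * (a * j + b) = j + (1 - S.arrivalRate) * b := by
      rw [mul_add, ← mul_assoc, hamul, one_mul]
    rw [this, hR]; ring
  obtain ⟨b, hb, D, hD, hD0, hDs, hDe⟩ := exists_marginalValues (T := T)
    (b₁ := L - a * N) (b₂ := max (L - a * N) (R * a)) hw hl hθ N (le_max_left _ _)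
    (fun i => by simp only [hT]; fun_prop)
    (fun b _ i => by simp only [hT]; push_cast; linarith)
    (by simp only [hT]; push_cast; linarith)
    (by have := le_max_left (L - a * N) (R * a); simp only [hT]; push_cast; linarith)
    (by
      rw [hdrift _ (le_max_left _ _) N le_rfl]
      have h1 := mul_le_mul_of_nonneg_left (le_max_right (L - a * N) (R * a)) hpos.le
      have h2 : (1 - S.arrivalRate) * (R * a) = R := by linear_combination R * hamul
      linarith)
  refine ⟨_, D, ValueCert.of_extGain hD0 hDs (c := R - (1 - S.arrivalRate) * b) (fun j _ => ?_)
    (fun n hn => ?_) (N := N) (A := a * N + b) (B := a) (zero_le_one.trans ha1) fun i => ?_⟩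
  · rcases le_total j N with hj | hj
    · rw [hDe j hj]; exact hdrift b hb N le_rfl
    · rw [← hdrift b hb j hj]
      congr 2
      funext i
      have := hD (j - N + i)
      rw [show N + (j - N + i) = j + i by omega] at this
      rw [this]
      simp only [hT]
      push_cast [Nat.cast_sub hj]; ring
  · rw [hK] at hn; exact absurd hn (by simp)
  · rw [hD]

theorem arrivalTail_eq_θ (hm : ∀ m, 2 ≤ m → S.θ m = 0) {i : ℕ} (hi : 1 ≤ i) :
    S.arrivalTail i = S.θ i := by
  rw [arrivalTail_eq_add, add_eq_left]
  refine Finset.sum_eq_zero fun m _ => ?_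
  split_ifs with h
  · exact hm m (by omega)
  · rfl

theorem exists_valueCert_finite (hw : S.IsBestChannel w₀) (hl : 0 ≤ lam) (hθ : 0 < S.θ 0)
    {n : ℕ} (hK : S.K = n) (hm : ∀ m, 2 ≤ m → S.θ m = 0) : ∃ c D, S.ValueCert lam w₀ c D := by
  obtain ⟨N, rfl⟩ : ∃ N, n = N + 1 := ⟨n - 1, by
    have := S.K_pos; rw [hK] at this
    have : 1 ≤ n := by exact_mod_cast this
    omega⟩
  obtain ⟨F, -, hF⟩ := exists_inverse_extGain hw lam
  set L := lam * S.P 1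
  set Q := lam * ∑ w ∈ Finset.Icc 1 S.W, S.η w * S.P w with hQ
  set T : ℝ → ℕ → ℝ := fun b i => if i = 0 then b else max b L + i with hT
  have hT0 : ∀ b, T b 0 = b := fun b => by simp [hT]
  have hTs : ∀ b i, T b (i + 1) = max b L + (i + 1 : ℕ) := fun b i => by simp [hT]
  have hp00 : 0 ≤ lam * S.P w₀ := mul_nonneg hl hw.P_pos.le
  have hdrift : ∀ b, S.valueDrift (S.extGain lam w₀) (T b)
      = S.θ 0 * S.extGain lam w₀ b + (1 - S.θ 0) * Q := by
    intro b
    rw [valueDrift_eq, hT0, tailDrift]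
    congr 1
    have : ∀ m ∈ Finset.range S.M, (S.θ (m + 1) * S.extGain lam w₀ (T b (m + 1))
        + S.arrivalTail (m + 1) * T b (m + 1)) = S.θ (m + 1) * Q := fun m _ => by
      rw [extGain_of_large hw hl, arrivalTail_eq_θ hm (by omega)]
      · ring
      · rw [hTs]
        have := le_max_right b L
        have : (0 : ℝ) ≤ (m + 1 : ℕ) := Nat.cast_nonneg _
        linarith
    rw [Finset.sum_congr rfl this, ← Finset.sum_mul]
    have := S.θ_sum
    rw [Finset.sum_range_succ'] at this
    congr 1; linarith
  have hθ1 : S.θ 0 ≤ 1 := by rw [← S.arrivalTail_zero]; exact S.θ_le_arrivalTail 0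
  have hQ0 : 0 ≤ Q := mul_nonneg hl (Finset.sum_nonneg fun w hwm => by
    rw [Finset.mem_Icc] at hwm
    exact mul_nonneg (S.η_nonneg w hwm.1 hwm.2) (S.P_pos w hwm.1 hwm.2).le)
  set b₂ := max (lam * S.P w₀) (F (-(N + Q) / S.θ 0)) with hb₂
  obtain ⟨b, hb, D, hD, hD0, hDs, hDe⟩ := exists_marginalValues (T := T)
    (b₁ := lam * S.P w₀) (b₂ := b₂) hw hl hθ N (le_max_left _ _)
    (fun i => by simp only [hT]; split_ifs <;> fun_prop)
    (fun b _ i => by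
      rw [hTs]
      rcases Nat.eq_zero_or_pos i with rfl | hi
      · rw [hT0]; push_cast; have := le_max_left b L; linarith
      · simp only [hT, if_neg hi.ne']; push_cast; linarith)
    (by rw [hT0]; have : (0 : ℝ) ≤ N := Nat.cast_nonneg _
        linarith)
    (by rw [hT0]; exact le_max_left _ _)
    (by
      rw [hdrift]
      have h1 := (extGain_strictAnti (lam := lam) hw).antitone
        (le_max_right (lam * S.P w₀) (F (-(N + Q) / S.θ 0)))
      rw [hF, ← hb₂] at h1
      have h2 := mul_le_mul_of_nonneg_left h1 hθ.le
      rw [mul_div_cancel₀ _ hθ.ne'] at h2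
      have h3 := mul_nonneg hθ.le hQ0
      linarith)
  refine ⟨_, D, ValueCert.of_extGain hD0 hDs
    (c := N + S.valueDrift (S.extGain lam w₀) (T b)) (fun j hj => ?_)
    (fun n hn w h1 h2 => ?_) (N := N) (A := max b L) (B := 1) zero_le_one fun i => ?_⟩
  · rw [hK] at hj
    have : j < N + 1 := by exact_mod_cast hj
    exact hDe j (by omega)
  · rw [hK] at hn
    have hn' : N + 1 ≤ n := by exact_mod_cast hn
    obtain ⟨i, rfl⟩ : ∃ i, n = N + (i + 1) := ⟨n - N - 1, by omega⟩
    rw [hD, hTs]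
    have h3 := mul_le_mul_of_nonneg_left (P_le_of_le le_rfl h1 h2) hl
    have h4 := le_max_right b L
    have : (0 : ℝ) < (i + 1 : ℕ) := by exact_mod_cast Nat.succ_pos i
    linarith
  · rw [hD]
    simp only [hT]
    split_ifs with hi
    · subst hi; simp
    · simp

theorem exists_valueCert (hw : S.IsBestChannel w₀) (hl : 0 ≤ lam) (hθ : 0 < S.θ 0)
    (hrate : S.arrivalRate < 1) (hS : S.FiniteBufferSingleArrival) :
    ∃ c D, S.ValueCert lam w₀ c D := by
  by_cases hK : S.K = ⊤
  · exact exists_valueCert_infinite hw hl hθ hrate hK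
  · obtain ⟨n, hn⟩ := ENat.ne_top_iff_exists.1 hK
    exact exists_valueCert_finite hw hl hθ hn.symm (hS.resolve_left hK)

end

noncomputable section

variable {S : SchedModel} {f : ℕ → ℕ → ℝ} {π : ℕ → ℝ} {lam : ℝ} {w₀ : ℕ} {c : ℝ} {D : ℕ → ℝ}

/-- Mixing the occupation measures of two admissible pairs. -/
theorem Admissible.combine {f₀ f₁ : ℕ → ℕ → ℝ} {π₀ π₁ : ℕ → ℝ} (h₀ : S.Admissible f₀ π₀)
    (h₁ : S.Admissible f₁ π₁) {s : ℝ} (hs0 : 0 ≤ s) (hs1 : s ≤ 1)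
    (hf0 : ∀ t w, 0 ≤ f t w) (hf1 : ∀ t w, f t w ≤ 1) (he : ∀ w, f 0 w = 0)
    (hf : ∀ t w, ((1 - s) * S.updatedProb π₀ t + s * S.updatedProb π₁ t) * f t w
      = (1 - s) * (S.updatedProb π₀ t * f₀ t w) + s * (S.updatedProb π₁ t * f₁ t w)) :
    S.Admissible f (fun k => (1 - s) * π₀ k + s * π₁ k) ∧
      S.meanPower f (fun k => (1 - s) * π₀ k + s * π₁ k)
        = (1 - s) * S.meanPower f₀ π₀ + s * S.meanPower f₁ π₁ := by
  have hμ : ∀ t, S.updatedProb (fun k => (1 - s) * π₀ k + s * π₁ k) t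
      = (1 - s) * S.updatedProb π₀ t + s * S.updatedProb π₁ t := fun t => by
    rw [S.updatedProb_add (fun k => (1 - s) * π₀ k) fun k => s * π₁ k, updatedProb_smul,
      updatedProb_smul]
  have key : ∀ (a : ℕ → ℝ) (t : ℕ),
      S.updatedProb (fun k => (1 - s) * π₀ k + s * π₁ k) t
        * ∑ w ∈ Finset.Icc 1 S.W, a w * f t w
      = (1 - s) * (S.updatedProb π₀ t * ∑ w ∈ Finset.Icc 1 S.W, a w * f₀ t w)
        + s * (S.updatedProb π₁ t * ∑ w ∈ Finset.Icc 1 S.W, a w * f₁ t w) := by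
    intro a t
    rw [hμ]
    simp_rw [Finset.mul_sum]
    rw [← Finset.sum_add_distrib]
    refine Finset.sum_congr rfl fun w _ => ?_
    linear_combination a w * hf t w
  refine ⟨⟨hf0, hf1, he, fun k => ?_, fun k hk => ?_, ?_, fun t => ?_⟩, ?_⟩
  · exact add_nonneg (mul_nonneg (by linarith) (h₀.nonneg k)) (mul_nonneg hs0 (h₁.nonneg k))
  · rw [h₀.supp k hk, h₁.supp k hk]; ring
  · simpa using (h₀.hasSum_one.mul_left (1 - s)).add (h₁.hasSum_one.mul_left s)
  · rw [S.upRate_add (fun k => (1 - s) * π₀ k) fun k => s * π₁ k, upRate_smul, upRate_smul,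
      ← h₀.balance t, ← h₁.balance t]
    exact key S.η t
  · refine HasSum.tsum_eq ?_
    exact ((h₀.hasSum_power.mul_left (1 - s)).add (h₁.hasSum_power.mul_left s)).congr_fun
      fun t => key (fun w => S.η w * S.P w) t

theorem summable_combine {π₀ π₁ : ℕ → ℝ} (h₀ : Summable fun k => π₀ k * (k : ℝ))
    (h₁ : Summable fun k => π₁ k * (k : ℝ)) (s : ℝ) :
    (Summable fun k => ((1 - s) * π₀ k + s * π₁ k) * (k : ℝ)) ∧
      meanQueue (fun k => (1 - s) * π₀ k + s * π₁ k)
        = (1 - s) * meanQueue π₀ + s * meanQueue π₁ := by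
  have := ((h₀.hasSum.mul_left (1 - s)).add (h₁.hasSum.mul_left s)).congr_fun
    (g := fun k => ((1 - s) * π₀ k + s * π₁ k) * (k : ℝ)) fun k => by ring
  exact ⟨this.summable, this.tsum_eq⟩

/-- The policy `f` has a stationary regime of finite mean queue length and average power `p`. -/
def AttainsPower (S : SchedModel) (f : ℕ → ℕ → ℝ) (p : ℝ) : Prop :=
  ∃ π, S.Admissible f π ∧ (Summable fun k => π k * (k : ℝ)) ∧ S.meanPower f π = p

/-- The policy `f` with its value in one state replaced. -/
def setAt (f : ℕ → ℕ → ℝ) (i : ℕ × ℕ) (a : ℝ) (t w : ℕ) : ℝ := if (t, w) = i then a else f t w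

theorem setAt_self (f : ℕ → ℕ → ℝ) (i : ℕ × ℕ) : setAt f i (f i.1 i.2) = f := by
  funext t w
  unfold setAt
  split_ifs with h
  · rw [← h]
  · rfl

theorem setAt_comm (f : ℕ → ℕ → ℝ) {i j : ℕ × ℕ} (hij : i ≠ j) (a b : ℝ) :
    setAt (setAt f i a) j b = setAt (setAt f j b) i a := by
  funext t w
  unfold setAt
  split_ifs with h1 h2 <;> first | rfl | (exact absurd (h2.symm.trans h1) hij)

theorem exists_setAt_attains {i : ℕ × ℕ} (hi : 1 ≤ i.1) {p₀ p₁ p : ℝ}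
    (h₀ : S.AttainsPower (setAt f i 0) p₀) (h₁ : S.AttainsPower (setAt f i 1) p₁)
    (hp : p ∈ Set.uIcc p₀ p₁) : ∃ a, 0 ≤ a ∧ a ≤ 1 ∧ S.AttainsPower (setAt f i a) p := by
  obtain ⟨π₀, ha₀, hq₀, hp₀⟩ := h₀
  obtain ⟨π₁, ha₁, hq₁, hp₁⟩ := h₁
  obtain ⟨s, ⟨hs0, hs1⟩, hs⟩ : ∃ s ∈ Set.Icc (0 : ℝ) 1, (1 - s) * p₀ + s * p₁ = p := by
    rw [← segment_eq_uIcc, segment_eq_image] at hp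
    simpa using hp
  have hm₀ := mul_nonneg (sub_nonneg.2 hs1) (S.updatedProb_nonneg ha₀.nonneg i.1)
  have hm₁ := mul_nonneg hs0 (S.updatedProb_nonneg ha₁.nonneg i.1)
  set m₀ := S.updatedProb π₀ i.1
  set m₁ := S.updatedProb π₁ i.1
  have ha0 : 0 ≤ s * m₁ / ((1 - s) * m₀ + s * m₁) := div_nonneg hm₁ (add_nonneg hm₀ hm₁)
  have ha1 : s * m₁ / ((1 - s) * m₀ + s * m₁) ≤ 1 :=
    div_le_one_of_le₀ (by linarith) (add_nonneg hm₀ hm₁)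
  refine ⟨_, ha0, ha1, ?_⟩
  have := ha₀.combine (f := setAt f i (s * m₁ / ((1 - s) * m₀ + s * m₁))) ha₁ hs0 hs1
    (fun t w => ?_) (fun t w => ?_) (fun w => ?_) fun t w => ?_
  · exact ⟨_, this.1, (summable_combine hq₀ hq₁ s).1, by rw [this.2, hp₀, hp₁, hs]⟩
  · have := ha₀.f_nonneg t w
    unfold setAt at this ⊢
    split_ifs with h
    · exact ha0
    · rwa [if_neg h] at this
  · have := ha₀.f_le_one t w
    unfold setAt at this ⊢
    split_ifs with h
    · exact ha1
    · rwa [if_neg h] at this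
  · have := ha₀.f_empty w
    have h : (0, w) ≠ i := fun h => by rw [← h] at hi; simp at hi
    unfold setAt at this ⊢
    rwa [if_neg h] at this ⊢
  · unfold setAt
    split_ifs with h
    · subst h
      rcases (add_nonneg hm₀ hm₁).eq_or_lt with hz | hz
      · have h0 : s * m₁ = 0 := by linarith
        rw [← hz, h0]; simp; exact mul_eq_zero.1 h0
      · rw [mul_div_cancel₀ _ hz.ne']; ring
    · ring

theorem setAt_attains_mem {i : ℕ × ℕ} {p₀ p₁ p a : ℝ}
    (hθ : 0 < S.θ 0) (hg : ∀ t, 1 ≤ t → 0 < S.txProb (setAt f i a) t)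
    (h₀ : S.AttainsPower (setAt f i 0) p₀) (h₁ : S.AttainsPower (setAt f i 1) p₁)
    (ha0 : 0 ≤ a) (ha1 : a ≤ 1) (h : S.AttainsPower (setAt f i a) p) : p ∈ Set.uIcc p₀ p₁ := by
  obtain ⟨π₀, ha₀, hq₀, hp₀⟩ := h₀
  obtain ⟨π₁, ha₁, hq₁, hp₁⟩ := h₁
  obtain ⟨π, ha, hq, hp⟩ := h
  have hm₀ := mul_nonneg ha0 (S.updatedProb_nonneg ha₀.nonneg i.1)
  have hm₁ := mul_nonneg (sub_nonneg.2 ha1) (S.updatedProb_nonneg ha₁.nonneg i.1)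
  set m₀ := S.updatedProb π₀ i.1
  set m₁ := S.updatedProb π₁ i.1
  set s := a * m₀ / (a * m₀ + (1 - a) * m₁) with hs
  have hs0 : 0 ≤ s := div_nonneg hm₀ (add_nonneg hm₀ hm₁)
  have hs1 : s ≤ 1 := div_le_one_of_le₀ (by linarith) (add_nonneg hm₀ hm₁)
  have hc := ha₀.combine ha₁ hs0 hs1 ha.f_nonneg ha.f_le_one ha.f_empty fun t w => by
    unfold setAt
    split_ifs with h
    · subst h
      rcases (add_nonneg hm₀ hm₁).eq_or_lt with hz | hz
      · have h0 : a * m₀ = 0 := by linarith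
        have h1 : (1 - a) * m₁ = 0 := by linarith
        linear_combination (1 - s) * h0 - s * h1
      · have : s * (a * m₀ + (1 - a) * m₁) = a * m₀ := div_mul_cancel₀ _ hz.ne'
        linear_combination -this
    · ring
  rw [← hc.1.unique hθ hg ha] at hp
  rw [← hp, hc.2, hp₀, hp₁, ← segment_eq_uIcc]
  exact ⟨1 - s, s, by linarith, hs0, by ring, by simp⟩

/-- The states in which the policy randomizes. -/
def fractionalStates (S : SchedModel) (f : ℕ → ℕ → ℝ) : Set (ℕ × ℕ) :=
  {p | 1 ≤ p.2 ∧ p.2 ≤ S.W ∧ 0 < f p.1 p.2 ∧ f p.1 p.2 < 1}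

theorem FollowsValues.finite_fractionalStates (hf : S.FollowsValues lam D f)
    (h : S.ValueCert lam w₀ c D) : (S.fractionalStates f).Finite := by
  obtain ⟨N, hN1, hN⟩ := h.eventually
  refine ((Set.finite_Iio N).prod (Set.finite_Icc 1 S.W)).subset fun p hp => ?_
  refine ⟨?_, hp.1, hp.2.1⟩
  by_contra hc
  have hc' : N ≤ p.1 := not_lt.1 hc
  exact hp.2.2.2.ne (hf.above p.1 p.2 (by omega) hp.1 hp.2.1 (hN p.1 hc' p.2 hp.1 hp.2.1))

theorem FollowsValues.tie (hf : S.FollowsValues lam D f) {p : ℕ × ℕ}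
    (hp : p ∈ S.fractionalStates f) : 1 ≤ p.1 ∧ lam * S.P p.2 = D p.1 := by
  have h1 : 1 ≤ p.1 := by
    by_contra hc
    have h0 : p.1 = 0 := by omega
    have := hp.2.2.1
    rw [h0, hf.f_empty] at this
    exact this.false
  refine ⟨h1, ?_⟩
  rcases lt_trichotomy (lam * S.P p.2) (D p.1) with hlt | heq | hgt
  · exact absurd (hf.above p.1 p.2 h1 hp.1 hp.2.1 hlt) hp.2.2.2.ne
  · exact heq
  · exact absurd (hf.below p.1 p.2 hp.1 hp.2.1 hgt) hp.2.2.1.ne'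

theorem FollowsValues.set_tie (hf : S.FollowsValues lam D f) {i : ℕ × ℕ} (hi : 1 ≤ i.1)
    (htie : lam * S.P i.2 = D i.1) {a : ℝ} (ha0 : 0 ≤ a) (ha1 : a ≤ 1) :
    S.FollowsValues lam D (setAt f i a) := by
  refine ⟨fun t w => ?_, fun t w => ?_, fun w => ?_, fun t w ht hw1 hw2 hlt => ?_,
    fun t w hw1 hw2 hlt => ?_⟩
  · unfold setAt; split_ifs; exacts [ha0, hf.f_nonneg t w]
  · unfold setAt; split_ifs; exacts [ha1, hf.f_le_one t w]
  · have h : (0, w) ≠ i := fun h => by rw [← h] at hi; simp at hi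
    unfold setAt; rw [if_neg h]; exact hf.f_empty w
  · have h : (t, w) ≠ i := fun h => by subst h; exact hlt.ne htie
    unfold setAt; rw [if_neg h]; exact hf.above t w ht hw1 hw2 hlt
  · have h : (t, w) ≠ i := fun h => by subst h; exact hlt.ne' htie
    unfold setAt; rw [if_neg h]; exact hf.below t w hw1 hw2 hlt

theorem fractionalStates_setAt_subset {i : ℕ × ℕ} (hi : i ∈ S.fractionalStates f) (a : ℝ) :
    S.fractionalStates (setAt f i a) ⊆ S.fractionalStates f := by
  intro p hp
  by_cases h : p = i
  · rwa [h]
  · have : setAt f i a p.1 p.2 = f p.1 p.2 := if_neg h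
    refine ⟨hp.1, hp.2.1, ?_⟩
    rw [← this]; exact hp.2.2

theorem notMem_fractionalStates_setAt {i : ℕ × ℕ} {a : ℝ} (ha : a = 0 ∨ a = 1) :
    i ∉ S.fractionalStates (setAt f i a) := by
  intro h
  have h1 : setAt f i a i.1 i.2 = a := if_pos rfl
  have h2 := h.2.2
  rw [h1] at h2
  rcases ha with rfl | rfl
  · exact h2.1.false
  · exact h2.2.false

theorem lt_or_lt_of_notMem_uIcc {x y p : ℝ} (h : p ∉ Set.uIcc x y) :
    (x < p ∧ y < p) ∨ (p < x ∧ p < y) := by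
  rw [Set.mem_uIcc] at h
  push Not at h
  rcases lt_trichotomy x p with h1 | h1 | h1
  · exact Or.inl ⟨h1, h.1 h1.le⟩
  · subst h1
    rcases le_total x y with h2 | h2
    · exact absurd (h.1 le_rfl) (not_lt.2 h2)
    · exact absurd (h.2 h2) (lt_irrefl _)
  · refine Or.inr ⟨h1, ?_⟩
    by_contra! hc
    exact absurd (h.2 hc) (not_lt.2 h1.le)

/-- Of two randomized ties, one can be resolved at unchanged power. -/
theorem FollowsValues.resolve_tie (hf : S.FollowsValues lam D f) (h : S.ValueCert lam w₀ c D)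
    (hw : S.IsBestChannel w₀) (hθ : 0 < S.θ 0) (hS : S.FiniteBufferSingleArrival)
    (hrate : S.arrivalRate < 1) {p : ℝ} (hp : S.AttainsPower f p) {i j : ℕ × ℕ} (hij : i ≠ j)
    (hi : i ∈ S.fractionalStates f) (hj : j ∈ S.fractionalStates f) :
    ∃ f', S.FollowsValues lam D f' ∧ S.AttainsPower f' p ∧
      S.fractionalStates f' ⊂ S.fractionalStates f := by
  obtain ⟨hi1, hit⟩ := hf.tie hi
  obtain ⟨hj1, hjt⟩ := hf.tie hj
  have hex : ∀ {f'}, S.FollowsValues lam D f' → ∃ p, S.AttainsPower f' p := fun hf' => by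
    obtain ⟨π, h1, h2⟩ := hf'.exists_admissible h hw hθ hS hrate
    exact ⟨_, π, h1, h2, rfl⟩
  have z0 : (0 : ℝ) ≤ 0 := le_rfl
  have z1 : (0 : ℝ) ≤ 1 := zero_le_one
  have z2 : (1 : ℝ) ≤ 1 := le_rfl
  have fi := fun (a : ℝ) (ha0 : 0 ≤ a) (ha1 : a ≤ 1) => hf.set_tie hi1 hit ha0 ha1
  have fij := fun (a b : ℝ) (ha0 : 0 ≤ a) (ha1 : a ≤ 1) (hb0 : 0 ≤ b) (hb1 : b ≤ 1) =>
    (fi a ha0 ha1).set_tie hj1 hjt hb0 hb1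
  obtain ⟨q0, hq0⟩ := hex (fi 0 z0 z1)
  obtain ⟨q1, hq1⟩ := hex (fi 1 z1 z2)
  obtain ⟨p00, h00⟩ := hex (fij 0 0 z0 z1 z0 z1)
  obtain ⟨p01, h01⟩ := hex (fij 0 1 z0 z1 z1 z2)
  obtain ⟨p10, h10⟩ := hex (fij 1 0 z1 z2 z0 z1)
  obtain ⟨p11, h11⟩ := hex (fij 1 1 z1 z2 z1 z2)
  have hpq : p ∈ Set.uIcc q0 q1 := by
    refine setAt_attains_mem (i := i) (a := f i.1 i.2) hθ ?_ hq0 hq1 hi.2.2.1.le hi.2.2.2.le ?_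
    · rw [setAt_self]; exact fun t ht => hf.txProb_pos h hw ht
    · rwa [setAt_self]
  have hval : ∀ a, setAt f i a j.1 j.2 = f j.1 j.2 := fun a => if_neg (Ne.symm hij)
  have hq : ∀ a q r0 r1, 0 ≤ a → a ≤ 1 → S.AttainsPower (setAt f i a) q →
      S.AttainsPower (setAt (setAt f i a) j 0) r0 →
      S.AttainsPower (setAt (setAt f i a) j 1) r1 →
      q ∈ Set.uIcc r0 r1 := by
    intro a q r0 r1 ha0 ha1 hqa h0 h1
    have hself := setAt_self (setAt f i a) j
    refine setAt_attains_mem (i := j) (a := setAt f i a j.1 j.2) hθ ?_ h0 h1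
      (by rw [hval]; exact hj.2.2.1.le) (by rw [hval]; exact hj.2.2.2.le) ?_
    · rw [hself]; exact fun t ht => (fi a ha0 ha1).txProb_pos h hw ht
    · rwa [hself]
  have hq0m := hq 0 q0 p00 p01 z0 z1 hq0 h00 h01
  have hq1m := hq 1 q1 p10 p11 z1 z2 hq1 h10 h11
  have hmemj : ∀ a, j ∈ S.fractionalStates (setAt f i a) := fun a =>
    ⟨hj.1, hj.2.1, by rw [hval]; exact hj.2.2⟩
  have hmemi : ∀ b, i ∈ S.fractionalStates (setAt f j b) := fun b =>
    ⟨hi.1, hi.2.1, by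
      have : setAt f j b i.1 i.2 = f i.1 i.2 := if_neg hij
      rw [this]; exact hi.2.2⟩
  -- an edge `{a} × [0, 1]` of the square
  have edge1 : ∀ a, (a = 0 ∨ a = 1) → 0 ≤ a → a ≤ 1 → ∀ r0 r1,
      S.AttainsPower (setAt (setAt f i a) j 0) r0 →
      S.AttainsPower (setAt (setAt f i a) j 1) r1 →
      p ∈ Set.uIcc r0 r1 → ∃ f', S.FollowsValues lam D f' ∧ S.AttainsPower f' p ∧
      S.fractionalStates f' ⊂ S.fractionalStates f := by
    intro a ha ha0 ha1 r0 r1 h0 h1 hm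
    obtain ⟨b, hb0, hb1, hb⟩ := exists_setAt_attains hj1 h0 h1 hm
    refine ⟨_, fij a b ha0 ha1 hb0 hb1, hb, ?_⟩
    have hsub := fractionalStates_setAt_subset (hmemj a) b
    rw [Set.ssubset_iff_of_subset (hsub.trans (fractionalStates_setAt_subset hi a))]
    exact ⟨i, hi, fun hc => notMem_fractionalStates_setAt ha (hsub hc)⟩
  -- an edge `[0, 1] × {b}` of the square
  have edge2 : ∀ b, (b = 0 ∨ b = 1) → 0 ≤ b → b ≤ 1 → ∀ r0 r1,
      S.AttainsPower (setAt (setAt f i 0) j b) r0 →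
      S.AttainsPower (setAt (setAt f i 1) j b) r1 →
      p ∈ Set.uIcc r0 r1 → ∃ f', S.FollowsValues lam D f' ∧ S.AttainsPower f' p ∧
      S.fractionalStates f' ⊂ S.fractionalStates f := by
    intro b hb hb0 hb1 r0 r1 h0 h1 hm
    rw [setAt_comm f hij] at h0 h1
    obtain ⟨a, ha0, ha1, ha⟩ := exists_setAt_attains hi1 h0 h1 hm
    refine ⟨_, (hf.set_tie hj1 hjt hb0 hb1).set_tie hi1 hit ha0 ha1, ha, ?_⟩
    have hsub := fractionalStates_setAt_subset (hmemi b) a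
    rw [Set.ssubset_iff_of_subset (hsub.trans (fractionalStates_setAt_subset hj b))]
    exact ⟨j, hj, fun hc => notMem_fractionalStates_setAt hb (hsub hc)⟩
  by_contra hno
  have e1 := lt_or_lt_of_notMem_uIcc fun hm => hno (edge1 0 (Or.inl rfl) z0 z1 _ _ h00 h01 hm)
  have e2 := lt_or_lt_of_notMem_uIcc fun hm => hno (edge1 1 (Or.inr rfl) z1 z2 _ _ h10 h11 hm)
  have e3 := lt_or_lt_of_notMem_uIcc fun hm => hno (edge2 0 (Or.inl rfl) z0 z1 _ _ h00 h10 hm)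
  rw [Set.mem_uIcc] at hpq hq0m hq1m
  rcases e1 with e1 | e1 <;> rcases e2 with e2 | e2 <;> rcases e3 with e3 | e3 <;>
  rcases hpq with hpq | hpq <;> rcases hq0m with hq0m | hq0m <;> rcases hq1m with hq1m | hq1m <;>
  linarith [e1.1, e1.2, e2.1, e2.2, e3.1, e3.2, hpq.1, hpq.2, hq0m.1, hq0m.2, hq1m.1, hq1m.2]

theorem FollowsValues.exists_subsingleton (hf : S.FollowsValues lam D f)
    (h : S.ValueCert lam w₀ c D) (hw : S.IsBestChannel w₀) (hθ : 0 < S.θ 0)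
    (hS : S.FiniteBufferSingleArrival) (hrate : S.arrivalRate < 1) {p : ℝ}
    (hp : S.AttainsPower f p) :
    ∃ f', S.FollowsValues lam D f' ∧ S.AttainsPower f' p ∧
      (S.fractionalStates f').Subsingleton := by
  induction hn : (S.fractionalStates f).ncard using Nat.strong_induction_on generalizing f with
  | _ n ih =>
    by_cases hsub : (S.fractionalStates f).Subsingleton
    · exact ⟨f, hf, hp, hsub⟩
    · obtain ⟨i, hi, j, hj, hij⟩ := Set.not_subsingleton_iff.1 hsub
      obtain ⟨f', hf', hp', hss⟩ := hf.resolve_tie h hw hθ hS hrate hp hij hi hj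
      exact ih _ (hn ▸ Set.ncard_lt_ncard hss (hf.finite_fractionalStates h)) hf' hp' rfl

/-- Policies that follow the marginal values have the dual-threshold structure. -/
theorem FollowsValues.isDualThreshold (hf : S.FollowsValues lam D f) (h : S.ValueCert lam w₀ c D)
    (hl : 0 ≤ lam) (hsub : (S.fractionalStates f).Subsingleton) :
    ∃ T I, S.IsDualThreshold (S.cutoff f) T I ∧
      {p : ℕ × ℕ | (p.1 : ℕ∞) ≤ S.K ∧ 1 ≤ p.2 ∧ p.2 = T p.1
        ∧ S.cutoff f p.1 p.2 ≠ 0}.Subsingleton ∧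
      {p : ℕ × ℕ | (p.1 : ℕ∞) ≤ S.K ∧ 1 ≤ p.2 ∧ p.2 ≤ S.W ∧
        0 < S.cutoff f p.1 p.2 ∧ S.cutoff f p.1 p.2 < 1}.Subsingleton := by
  classical
  have hpos : ∀ k w, 1 ≤ w → w ≤ S.W → f k w ≠ 0 → 1 ≤ k ∧ lam * S.P w ≤ D k := by
    intro k w h1 h2 h3
    constructor
    · by_contra hc
      obtain rfl : k = 0 := by omega
      exact h3 (hf.f_empty w)
    · by_contra! hc
      exact h3 (hf.below k w h1 h2 hc)
  have hlt : ∀ k w, 1 ≤ k → 1 ≤ w → w ≤ S.W → f k w ≠ 1 → D k ≤ lam * S.P w := by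
    intro k w h0 h1 h2 h3
    by_contra! hc
    exact h3 (hf.above k w h0 h1 h2 hc)
  set T : ℕ → ℕ := fun k => Nat.findGreatest (fun w => 1 ≤ w ∧ f k w ≠ 1) S.W with hT
  have hTle : ∀ k, T k ≤ S.W := fun k => Nat.findGreatest_le _
  have hTspec : ∀ k, 1 ≤ T k → f k (T k) ≠ 1 := fun k hk =>
    (Nat.findGreatest_of_ne_zero (P := fun w => 1 ≤ w ∧ f k w ≠ 1) (m := T k) rfl
      (Nat.one_le_iff_ne_zero.1 hk)).2
  have hTabove : ∀ k w, 1 ≤ w → w ≤ S.W → T k < w → f k w = 1 := by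
    intro k w h1 h2 h3
    have := Nat.findGreatest_is_greatest h3 h2
    simp only [not_and, not_not] at this
    exact this h1
  -- two prices at one queue length cannot both be ties, up to `lam = 0`
  have hTbelow : ∀ k w, 1 ≤ w → w < T k → f k w = 0 := by
    intro k w h1 h2
    by_contra hc
    have h3 := hTle k
    obtain ⟨h4, h5⟩ := hpos k w h1 (by omega) hc
    have h6 := hlt k (T k) h4 (by omega) h3 (hTspec k (by omega))
    have h7 := S.P_anti w (T k) h1 h2 h3
    have h8 : lam = 0 := by
      by_contra hne
      have := mul_lt_mul_of_pos_left h7 (hl.lt_of_ne' hne)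
      linarith
    rw [h8, zero_mul] at h6
    have h9 := h.mono (show 0 < k by omega)
    rw [h.zero, h8, zero_mul] at h9
    linarith
  set I : ℕ → ℕ∞ := fun w => if hex : ∃ k : ℕ, (k : ℕ∞) ≤ S.K ∧ f k w ≠ 0
    then ((Nat.find hex : ℕ) : ℕ∞) else S.K with hI
  refine ⟨T, I, ⟨hTle, fun k w hk h1 h2 h3 => ?_, fun k w hk h1 h2 h3 => ?_,
    fun k l hk hkl hl => ?_, fun w => ?_, fun k w hk h1 h2 h3 => ?_, fun k w hk h1 h2 h3 => ?_⟩,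
    fun p hp q hq => hsub ?_ ?_, fun p hp q hq => hsub ?_ ?_⟩
  · rw [cutoff_of_le hk]; exact hTbelow k w h1 h3
  · rw [cutoff_of_le hk]; exact hTabove k w h1 h2 h3
  · by_contra! hc
    have h1 := hTspec l (by omega)
    have h2 := hlt l (T l) (by omega) (by omega) (hTle l) h1
    have hne : k ≠ l := fun hkl => by subst hkl; exact lt_irrefl _ hc
    have h3 := h.mono (show k < l by omega)
    have h4 := hTabove k (T l) (by omega) (hTle l) hc
    have h5 := (hpos k (T l) (by omega) (hTle l) (by rw [h4]; exact one_ne_zero)).2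
    linarith
  · simp only [hI]
    split_ifs with hex
    · exact (Nat.find_spec hex).1
    · exact le_rfl
  · rw [cutoff_of_le hk]
    by_contra hc
    have hex : ∃ k : ℕ, (k : ℕ∞) ≤ S.K ∧ f k w ≠ 0 := ⟨k, hk, hc⟩
    simp only [hI, dif_pos hex] at h3
    have : k < Nat.find hex := by exact_mod_cast h3
    exact Nat.find_min hex this ⟨hk, hc⟩
  · rw [cutoff_of_le hk]
    by_cases hex : ∃ k : ℕ, (k : ℕ∞) ≤ S.K ∧ f k w ≠ 0
    · simp only [hI, dif_pos hex] at h3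
      have h4 : Nat.find hex < k := by exact_mod_cast h3
      have h5 := (hpos _ w h1 h2 (Nat.find_spec hex).2).2
      exact hf.above k w (by omega) h1 h2 (h5.trans_lt (h.mono h4))
    · simp only [hI, dif_neg hex] at h3
      exact absurd hk (not_le.2 h3)
  · obtain ⟨h1, h2, h3, h4⟩ := hp
    rw [cutoff_of_le h1] at h4
    refine ⟨h2, h3 ▸ hTle _, (hf.f_nonneg _ _).lt_of_ne' h4, (hf.f_le_one _ _).lt_of_ne ?_⟩
    rw [h3]; exact hTspec _ (h3 ▸ h2)
  · obtain ⟨h1, h2, h3, h4⟩ := hq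
    rw [cutoff_of_le h1] at h4
    refine ⟨h2, h3 ▸ hTle _, (hf.f_nonneg _ _).lt_of_ne' h4, (hf.f_le_one _ _).lt_of_ne ?_⟩
    rw [h3]; exact hTspec _ (h3 ▸ h2)
  · have := hp.2
    rwa [cutoff_of_le hp.1] at this
  · have := hq.2
    rwa [cutoff_of_le hq.1] at this

end

noncomputable section

variable {S : SchedModel} {f : ℕ → ℕ → ℝ} {π : ℕ → ℝ} {w₀ : ℕ}

/-- Transmission probabilities that fill the channel states from the best one down, with the last
state `v` filled to the level `r`. -/
def waterLevel (v : ℕ) (r : ℝ) (w : ℕ) : ℝ := if v < w then 1 else if w = v then r else 0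

theorem exists_waterLevel (S : SchedModel) {x : ℝ} (hx0 : 0 < x) (hx1 : x ≤ 1) :
    ∃ v r, 1 ≤ v ∧ v ≤ S.W ∧ 0 < S.η v ∧ 0 ≤ r ∧ r ≤ 1 ∧
      ∑ w ∈ Finset.Icc 1 S.W, S.η w * waterLevel v r w = x := by
  classical
  set A : ℕ → ℝ := fun w => ∑ u ∈ Finset.Icc w S.W, S.η u with hA
  set v := Nat.findGreatest (fun w => x ≤ A w) S.W with hv
  have h1 : x ≤ A 1 := by simp only [hA]; rw [S.η_sum]; exact hx1
  have hv1 : 1 ≤ v := Nat.le_findGreatest S.W_pos h1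
  have hvW : v ≤ S.W := Nat.findGreatest_le _
  have hxv : x ≤ A v := Nat.findGreatest_spec (P := fun w => x ≤ A w) S.W_pos h1
  have hxs : A (v + 1) < x := by
    by_cases hlt : v + 1 ≤ S.W
    · exact not_le.1 (Nat.findGreatest_is_greatest (P := fun w => x ≤ A w) (Nat.lt_succ_self v) hlt)
    · simp only [hA]
      rw [Finset.Icc_eq_empty (by omega), Finset.sum_empty]; exact hx0
  have hsplit : A v = S.η v + A (v + 1) := by
    simp only [hA]
    rw [← Finset.insert_Icc_succ_left_eq_Icc hvW, Finset.sum_insert (by simp)]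
    rfl
  have hη : 0 < S.η v := by linarith
  refine ⟨v, (x - A (v + 1)) / S.η v, hv1, hvW, hη, div_nonneg (by linarith) hη.le,
    (div_le_one hη).2 (by linarith), ?_⟩
  have : ∀ w ∈ Finset.Icc 1 S.W, S.η w * waterLevel v ((x - A (v + 1)) / S.η v) w
      = (if w = v then x - A (v + 1) else 0) + if v < w then S.η w else 0 := fun w _ => by
    unfold waterLevel
    split_ifs with h2 h3 h3
    · omega
    · ring
    · rw [h3, mul_div_cancel₀ _ hη.ne', add_zero]
    · ring
  rw [Finset.sum_congr rfl this, Finset.sum_add_distrib, Finset.sum_ite_eq',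
    if_pos (Finset.mem_Icc.2 ⟨hv1, hvW⟩), ← Finset.sum_filter]
  have : (Finset.Icc 1 S.W).filter (fun w => v < w) = Finset.Icc (v + 1) S.W := by
    ext w; simp; omega
  rw [this]; simp only [hA]; ring

theorem waterLevel_nonneg {v : ℕ} {r : ℝ} (h : 0 ≤ r) (w : ℕ) : 0 ≤ waterLevel v r w := by
  unfold waterLevel; split_ifs; exacts [zero_le_one, h, le_rfl]

theorem waterLevel_le_one {v : ℕ} {r : ℝ} (h : r ≤ 1) (w : ℕ) : waterLevel v r w ≤ 1 := by
  unfold waterLevel; split_ifs; exacts [le_rfl, h, zero_le_one]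

theorem valueDrift_const (S : SchedModel) (ψ : ℝ → ℝ) (b : ℝ) :
    S.valueDrift ψ (fun _ => b) = ψ b + S.arrivalRate * b := by
  rw [valueDrift, ← Finset.sum_mul, ← Finset.sum_mul, S.θ_sum, S.sum_arrivalTail, one_mul]

theorem waterLevel_cost {v : ℕ} {r x : ℝ} (hv1 : 1 ≤ v) (hvW : v ≤ S.W)
    (hx : ∑ w ∈ Finset.Icc 1 S.W, S.η w * waterLevel v r w = x) :
    ∑ w ∈ Finset.Icc 1 S.W, S.η w * S.P w * waterLevel v r w
      = S.txGain 1 (S.P v) + x * S.P v := by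
  rw [← hx, txGain, Finset.sum_mul, ← Finset.sum_add_distrib]
  refine Finset.sum_congr rfl fun w hwm => ?_
  rw [Finset.mem_Icc] at hwm
  rw [one_mul]
  unfold waterLevel
  split_ifs with h1 h2
  · have := S.P_anti v w hv1 h1 hwm.2
    rw [min_eq_right (by linarith)]; ring
  · rw [h2]; simp; ring
  · have := S.P_anti w v hwm.1 (by omega) hvW
    rw [min_eq_left (by linarith)]; ring

/-- The loss of a policy against the constant price `P v`. -/
theorem Admissible.hasSum_loss_const (h : S.Admissible f π) (b : ℝ) :
    HasSum (fun t => S.updatedProb π t * S.decisionLoss 1 (fun _ => b) f t)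
      (S.meanPower f π - (S.txGain 1 b + S.arrivalRate * b)) := by
  have := h.hasSum_decisionLoss 1 (D := fun _ => b) (s := S.txGain 1 b + S.arrivalRate * b)
    (fun m => h.hasSum_one.summable.mul_right b) (by
      simp only [valueDrift_const]
      simpa using h.hasSum_one.mul_right (S.txGain 1 b + S.arrivalRate * b))
  rwa [one_mul] at this

theorem Admissible.price_le_power (h : S.Admissible f π) (b : ℝ) :
    S.txGain 1 b + S.arrivalRate * b ≤ S.meanPower f π := by
  have := (h.hasSum_loss_const b).nonneg fun t =>
    mul_nonneg (S.updatedProb_nonneg h.nonneg t) (decisionLoss_nonneg h.f_nonneg h.f_le_one _ t)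
  linarith

/-- A pair of the least conceivable power transmits in the best channel state only. -/
theorem Admissible.only_best (hθ : 0 < S.θ 0) (hw : S.IsBestChannel w₀) (h : S.Admissible f π)
    {v : ℕ} (hv1 : 1 ≤ v) (hvW : v ≤ S.W) (hη : 0 < S.η v)
    (hle : S.meanPower f π ≤ S.txGain 1 (S.P v) + S.arrivalRate * S.P v) :
    v = w₀ ∧ ∀ t w, 0 < S.updatedProb π t → 1 ≤ w → w ≤ S.W → 0 < S.η w → w ≠ w₀ →
      f t w = 0 := by
  have h0 := h.hasSum_loss_const (S.P v)
  rw [le_antisymm hle (h.price_le_power _), sub_self] at h0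
  have key : ∀ t w, 0 < S.updatedProb π t → 1 ≤ w → w ≤ S.W → 0 < S.η w →
      (S.P w < S.P v → f t w = 1) ∧ (S.P v < S.P w → f t w = 0) := by
    intro t w ht h1 h2 h3
    have := SchedModel.decisionLoss_eq_zero h.f_nonneg h.f_le_one (h.decisionLoss_eq_zero h0 ht)
      h1 h2 h3
    simpa using this
  have hv : v = w₀ := by
    by_contra hne
    have hlt : S.P w₀ < S.P v :=
      S.P_anti v w₀ hv1 (lt_of_le_of_ne (hw.max v hv1 hvW hη) hne) hw.le
    have hone : ∀ t, 0 < S.updatedProb π t → f t w₀ = 1 := fun t ht =>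
      (key t w₀ ht hw.one_le hw.le hw.pos).1 hlt
    have hπ0 := h.pos_zero hθ fun t _ ht => by
      have h1 := hone t ht
      refine lt_of_lt_of_le hw.pos ?_
      have := Finset.single_le_sum (f := fun w => S.η w * f t w) (fun w hwm => by
        rw [Finset.mem_Icc] at hwm
        exact mul_nonneg (S.η_nonneg w hwm.1 hwm.2) (h.f_nonneg t w))
        (Finset.mem_Icc.2 ⟨hw.one_le, hw.le⟩)
      simpa [h1, txProb] using this
    have := hone 0 (lt_of_lt_of_le (mul_pos hθ hπ0) (by simpa using S.le_updatedProb h.nonneg 0 0))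
    rw [h.f_empty] at this
    exact zero_ne_one this
  refine ⟨hv, fun t w ht h1 h2 h3 h4 => (key t w ht h1 h2 h3).2 ?_⟩
  rw [hv]
  exact S.P_anti w w₀ h1 (lt_of_le_of_ne (hw.max w h1 h2 h3) h4) hw.le

theorem hasSum_first_moments {q : ℝ} (h1 : HasSum π 1)
    (hq : HasSum (fun k => π k * (k : ℝ)) q) :
    HasSum (fun t => S.updatedProb π t * (t : ℝ)) (q + S.arrivalRate) ∧
      HasSum (fun t => S.upRate π t * (t : ℝ))
        (S.arrivalRate * q + ∑ i ∈ Finset.Icc 1 S.M, S.arrivalTail i * (i : ℝ)) := by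
  have h : ∀ m : ℕ, HasSum (fun k => π k * ((k + m : ℕ) : ℝ)) (q + m) := fun m => by
    have := hq.add (h1.mul_right (m : ℝ))
    rw [one_mul] at this
    exact this.congr_fun fun k => by push_cast; ring
  constructor
  · have := S.hasSum_updatedProb (u := fun k => (k : ℝ)) h
    convert this using 1
    rw [arrivalRate]
    simp_rw [mul_add]
    rw [Finset.sum_add_distrib, ← Finset.sum_mul, S.θ_sum, one_mul]
    congr 1
    exact Finset.sum_congr rfl fun m _ => mul_comm _ _
  · have := S.hasSum_upRate (u := fun k => (k : ℝ)) h
    convert this using 1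
    simp_rw [mul_add]
    rw [Finset.sum_add_distrib, ← Finset.sum_mul, S.sum_arrivalTail]

/-- The weights of a critically loaded chain have infinite mass. -/
theorem not_summable_weights (hθ : 0 < S.θ 0) {g : ℕ → ℝ} (hg0 : g 0 = 0)
    (hrate : 0 < S.arrivalRate) (hrate1 : S.arrivalRate ≤ 1)
    (hg : ∀ t, 1 ≤ t → g t = S.arrivalRate) : ¬ Summable (S.weights g) := by
  intro hs
  have hgpos : ∀ t, 1 ≤ t → 0 < g t := fun t ht => by rw [hg t ht]; exact hrate
  have h1 := (S.hasSum_updatedProb_one hs.hasSum).mul_left S.arrivalRate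
  have h2 := S.hasSum_upRate_one hs.hasSum
  have hw0 := weights_nonneg (S := S) hgpos fun t => by
    rcases Nat.eq_zero_or_pos t with rfl | ht
    · rw [hg0]; exact zero_le_one
    · rw [hg t ht]; exact hrate1
  refine lt_irrefl _ (hasSum_lt (i := 0) (fun t => ?_) ?_ h2 h1)
  · rcases Nat.eq_zero_or_pos t with rfl | ht
    · rw [upRate_zero]
      exact mul_nonneg hrate.le (S.updatedProb_nonneg hw0 0)
    · rw [← weights_balance hθ hg0 hgpos t, hg t ht, mul_comm]
  · rw [upRate_zero]
    have := S.le_updatedProb hw0 0 0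
    rw [weights_zero, mul_one] at this
    exact mul_pos hrate (hθ.trans_le this)

/-- With an infinite buffer, stable policies come arbitrarily close to the least conceivable
power. -/
theorem exists_power_lt (hθ : 0 < S.θ 0) (hK : S.K = ⊤) (hrate : 0 < S.arrivalRate)
    (hrate1 : S.arrivalRate < 1) {v : ℕ} {r : ℝ} (hr0 : 0 ≤ r) (hr1 : r ≤ 1)
    (hx : ∑ w ∈ Finset.Icc 1 S.W, S.η w * waterLevel v r w = S.arrivalRate) {p : ℝ}
    (hp : ∑ w ∈ Finset.Icc 1 S.W, S.η w * S.P w * waterLevel v r w < p) :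
    ∃ f π, S.Admissible f π ∧ (Summable fun k => π k * (k : ℝ)) ∧ S.meanPower f π < p := by
  set φ := ∑ w ∈ Finset.Icc 1 S.W, S.η w * S.P w * waterLevel v r w with hφ
  set C := ∑ w ∈ Finset.Icc 1 S.W, S.η w * S.P w with hC
  have hηP : ∀ w ∈ Finset.Icc 1 S.W, 0 ≤ S.η w * S.P w := fun w hwm => by
    rw [Finset.mem_Icc] at hwm
    exact mul_nonneg (S.η_nonneg w hwm.1 hwm.2) (S.P_pos w hwm.1 hwm.2).le
  have hC0 : 0 ≤ C := Finset.sum_nonneg hηP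
  have hφ0 : 0 ≤ φ := Finset.sum_nonneg fun w hwm =>
    mul_nonneg (hηP w hwm) (waterLevel_nonneg hr0 w)
  have hpos : 0 < 1 - S.arrivalRate := by linarith
  set κ := C / (1 - S.arrivalRate) with hκ
  have hκ0 : 0 ≤ κ := div_nonneg hC0 hpos.le
  have hκm : κ * (1 - S.arrivalRate) = C := div_mul_cancel₀ _ hpos.ne'
  set gc : ℕ → ℝ := fun t => if t = 0 then 0 else S.arrivalRate with hgc
  have hgcpos : ∀ t, 1 ≤ t → gc t = S.arrivalRate := fun t ht => if_neg (by omega)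
  have hgc0 : gc 0 = 0 := if_pos rfl
  have hgc1 : ∀ t, gc t ≤ 1 := fun t => by
    simp only [hgc]; split_ifs; exacts [zero_le_one, hrate1.le]
  have hgcp : ∀ t, 1 ≤ t → 0 < gc t := fun t ht => by rw [hgcpos t ht]; exact hrate
  have hwc := weights_nonneg (S := S) hgcp hgc1
  have htend := (not_summable_iff_tendsto_nat_atTop_of_nonneg hwc).1
    (not_summable_weights hθ hgc0 hrate hrate1.le hgcpos)
  set δ := p - φ with hδ
  have hδ0 : 0 < δ := by linarith
  obtain ⟨N, hN⟩ := (htend.eventually_gt_atTop (κ * S.arrivalRate * S.θ 0 / δ)).exists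
  set f : ℕ → ℕ → ℝ := fun t w =>
    if t = 0 then 0 else if t ≤ N then waterLevel v r w else 1 with hf
  have hf0 : ∀ t w, 0 ≤ f t w := fun t w => by
    simp only [hf]; split_ifs; exacts [le_rfl, waterLevel_nonneg hr0 w, zero_le_one]
  have hf1 : ∀ t w, f t w ≤ 1 := fun t w => by
    simp only [hf]; split_ifs; exacts [zero_le_one, waterLevel_le_one hr1 w, le_rfl]
  have he : ∀ w, f 0 w = 0 := fun w => if_pos rfl
  have hgle : ∀ t, 1 ≤ t → t ≤ N → S.txProb f t = S.arrivalRate := fun t h1 h2 => by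
    rw [← hx, txProb]
    exact Finset.sum_congr rfl fun w _ => by simp only [hf]; rw [if_neg (by omega), if_pos h2]
  have hggt : ∀ t, N < t → S.txProb f t = 1 := fun t h1 =>
    S.txProb_eq_one fun w _ _ => by simp only [hf]; rw [if_neg (by omega), if_neg (by omega)]
  have hgpos : ∀ t, 1 ≤ t → 0 < S.txProb f t := fun t ht => by
    rcases le_or_gt t N with h | h
    · rw [hgle t ht h]; exact hrate
    · rw [hggt t h]; exact one_pos
  obtain ⟨ha, hq⟩ := exists_admissible hθ (Or.inl hK) hf0 hf1 he hgpos zero_le_one hrate1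
    (N := N + 1) (fun t ht => (hggt t (by omega)).ge)
    (fun t ht => by rw [hK] at ht; exact absurd ht (by simp))
  obtain ⟨hs, -⟩ := weights_summable hθ (S.txProb_empty he) hgpos (S.txProb_le_one hf1)
    zero_le_one hrate1 (N := N + 1) (fun t ht => (hggt t (by omega)).ge)
  set Z := ∑' j, S.weights (S.txProb f) j
  have hwn := weights_nonneg (S := S) hgpos (S.txProb_le_one hf1)
  have hZ : κ * S.arrivalRate * S.θ 0 / δ < Z := by
    refine hN.trans_le ?_
    refine le_trans (le_of_eq ?_) (hs.sum_le_tsum (Finset.range N) fun k _ => hwn k)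
    refine Finset.sum_congr rfl fun k hk => ?_
    rw [Finset.mem_range] at hk
    refine eq_of_balance hθ (n := N) (g := gc) (g' := S.txProb f) (fun t ht => ?_) hgcp
      (by rw [weights_zero, weights_zero]) (weights_balance hθ hgc0 hgcp)
      (weights_balance hθ (S.txProb_empty he) hgpos) k hk.le
    rcases Nat.eq_zero_or_pos t with rfl | h0
    · rw [hgc0, S.txProb_empty he]
    · rw [hgcpos t h0, hgle t h0 ht]
  have hZ0 : 0 < Z := lt_of_le_of_lt (by positivity) hZ
  refine ⟨f, _, ha, hq, ?_⟩
  set π : ℕ → ℝ := fun k => Z⁻¹ * S.weights (S.txProb f) k with hπ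
  -- comparison of the cost with an affine function of the transmission probability
  have hcost : ∀ t, S.txCost f t
      ≤ φ + κ * (S.txProb f t - S.arrivalRate) + if t = 0 then κ * S.arrivalRate else 0 := by
    intro t
    rcases Nat.eq_zero_or_pos t with rfl | h0
    · rw [S.txProb_empty he, if_pos rfl, txCost]
      simp only [he, mul_zero, Finset.sum_const_zero]
      linarith
    rw [if_neg (by omega), add_zero]
    rcases le_or_gt t N with h | h
    · rw [hgle t h0 h, sub_self, mul_zero, add_zero]
      refine (Finset.sum_congr rfl fun w _ => ?_).le
      simp only [hf]; rw [if_neg (by omega), if_pos h]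
    · rw [hggt t h, hκm]
      have := (le_abs_self _).trans (S.abs_txCost_le hf0 hf1 t)
      linarith
  have hμ := S.hasSum_updatedProb_one ha.hasSum_one
  have hμg : HasSum (fun t => S.updatedProb π t * S.txProb f t) S.arrivalRate := by
    have := S.hasSum_upRate_one ha.hasSum_one
    rw [mul_one] at this
    exact this.congr_fun ha.balance
  have hμ0 : HasSum (fun t => S.updatedProb π t * if t = 0 then κ * S.arrivalRate else 0)
      (S.updatedProb π 0 * (κ * S.arrivalRate)) := by
    have := hasSum_ite_eq (0 : ℕ) (S.updatedProb π 0 * (κ * S.arrivalRate))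
    refine this.congr_fun fun t => ?_
    split_ifs with h
    · rw [h]
    · rw [mul_zero]
  have hsum := ((hμ.mul_left φ).add ((hμg.sub (hμ.mul_left S.arrivalRate)).mul_left κ)).add hμ0
  have hbound := hasSum_le (fun t => ?_) ha.hasSum_power hsum
  · have h0 : S.updatedProb π 0 = S.θ 0 * Z⁻¹ := by
      rw [updatedProb_eq_range]; simp [hπ, weights_zero]
    rw [h0] at hbound
    have h1 : S.θ 0 * Z⁻¹ * (κ * S.arrivalRate) < δ := by
      rw [div_lt_iff₀ hδ0] at hZ
      rw [show S.θ 0 * Z⁻¹ * (κ * S.arrivalRate) = κ * S.arrivalRate * S.θ 0 / Z by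
        rw [div_eq_mul_inv]; ring, div_lt_iff₀ hZ0]
      linarith
    linarith
  · have := mul_le_mul_of_nonneg_left (hcost t) (S.updatedProb_nonneg ha.nonneg t)
    refine this.trans (le_of_eq ?_)
    ring

end

noncomputable section

open Filter Topology

variable {S : SchedModel} {f : ℕ → ℕ → ℝ} {π : ℕ → ℝ} {w₀ : ℕ}

theorem tendsto_delayed {πs : ℕ → ℕ → ℝ} (h : ∀ k, Tendsto (fun n => πs n k) atTop (𝓝 (π k)))
    (i t : ℕ) : Tendsto (fun n => delayed (πs n) i t) atTop (𝓝 (delayed π i t)) := by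
  unfold delayed; split_ifs
  · exact h _
  · exact tendsto_const_nhds

theorem tendsto_updatedProb {πs : ℕ → ℕ → ℝ}
    (h : ∀ k, Tendsto (fun n => πs n k) atTop (𝓝 (π k))) (t : ℕ) :
    Tendsto (fun n => S.updatedProb (πs n) t) atTop (𝓝 (S.updatedProb π t)) := by
  simp only [updatedProb_eq]
  exact tendsto_finsetSum _ fun m _ => (tendsto_delayed h m t).const_mul _

theorem tendsto_upRate {πs : ℕ → ℕ → ℝ}
    (h : ∀ k, Tendsto (fun n => πs n k) atTop (𝓝 (π k))) (t : ℕ) :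
    Tendsto (fun n => S.upRate (πs n) t) atTop (𝓝 (S.upRate π t)) :=
  tendsto_finsetSum _ fun m _ => (tendsto_delayed h m t).const_mul _

/-- Markov's inequality for the queue length. -/
theorem one_sub_le_sum_range (h0 : ∀ k, 0 ≤ π k) (h1 : HasSum π 1)
    (hq : Summable fun k => π k * (k : ℝ)) {N : ℕ} (hN : 0 < N) :
    1 - meanQueue π / N ≤ ∑ k ∈ Finset.range N, π k := by
  have hN' : (0 : ℝ) < N := by exact_mod_cast hN
  have e1 := h1.sub (hq.hasSum.div_const (N : ℝ))
  have e2 : HasSum (fun k => if k < N then π k else 0) (∑ k ∈ Finset.range N, π k) := by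
    have : HasSum (fun k => if k < N then π k else 0)
        (∑ k ∈ Finset.range N, if k < N then π k else 0) :=
      hasSum_sum_of_ne_finset_zero fun k hk => if_neg fun h => hk (Finset.mem_range.2 h)
    rwa [Finset.sum_congr rfl fun k hk => if_pos (Finset.mem_range.1 hk)] at this
  refine hasSum_le (fun k => ?_) e1 e2
  split_ifs with hk
  · have := h0 k
    have : 0 ≤ π k * (k : ℝ) / N := by positivity
    linarith
  · have hk' : (N : ℝ) ≤ k := by exact_mod_cast not_lt.1 hk
    have := mul_le_mul_of_nonneg_left hk' (h0 k)
    rw [sub_nonpos, le_div_iff₀ hN']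
    exact this

theorem txCost_nonneg (S : SchedModel) (h0 : ∀ t w, 0 ≤ f t w) (t : ℕ) : 0 ≤ S.txCost f t :=
  Finset.sum_nonneg fun w hwm => by
    rw [Finset.mem_Icc] at hwm
    exact mul_nonneg (mul_nonneg (S.η_nonneg w hwm.1 hwm.2) (S.P_pos w hwm.1 hwm.2).le) (h0 t w)

/-- A pointwise limit of admissible pairs with bounded mean queue length is admissible, and mean
queue length and power are lower semicontinuous. -/
theorem Admissible.of_tendsto {fs : ℕ → ℕ → ℕ → ℝ} {πs : ℕ → ℕ → ℝ}
    (hf : ∀ t w, Tendsto (fun n => fs n t w) atTop (𝓝 (f t w)))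
    (hπ : ∀ k, Tendsto (fun n => πs n k) atTop (𝓝 (π k)))
    (ha : ∀ n, S.Admissible (fs n) (πs n)) (hq : ∀ n, Summable fun k => πs n k * (k : ℝ))
    {p q : ℝ} {qs : ℕ → ℝ} (hqs : Tendsto qs atTop (𝓝 q)) (hqle : ∀ n, meanQueue (πs n) ≤ qs n)
    (hp : ∀ n, S.meanPower (fs n) (πs n) ≤ p) :
    S.Admissible f π ∧ (Summable fun k => π k * (k : ℝ)) ∧ meanQueue π ≤ q ∧
      S.meanPower f π ≤ p := by
  have h0 : ∀ k, 0 ≤ π k := fun k => ge_of_tendsto' (hπ k) fun n => (ha n).nonneg k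
  have hf0 : ∀ t w, 0 ≤ f t w := fun t w => ge_of_tendsto' (hf t w) fun n => (ha n).f_nonneg t w
  have hQ0 : ∀ k, 0 ≤ π k * (k : ℝ) := fun k => mul_nonneg (h0 k) (Nat.cast_nonneg k)
  have hQ : ∀ N, ∑ k ∈ Finset.range N, π k * (k : ℝ) ≤ q := fun N =>
    le_of_tendsto_of_tendsto' (tendsto_finsetSum _ fun k _ => (hπ k).mul_const (k : ℝ)) hqs
      fun n => ((hq n).sum_le_tsum _ fun k _ =>
        mul_nonneg ((ha n).nonneg k) (Nat.cast_nonneg k)).trans (hqle n)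
  have hPN : ∀ N, ∑ t ∈ Finset.range N, S.updatedProb π t * S.txCost f t ≤ p := fun N =>
    le_of_tendsto' (tendsto_finsetSum _ fun t _ => (tendsto_updatedProb hπ t).mul
      (tendsto_finsetSum _ fun w _ => (hf t w).const_mul _)) fun n =>
      ((ha n).hasSum_power.summable.sum_le_tsum _ fun t _ =>
        mul_nonneg (S.updatedProb_nonneg (ha n).nonneg t)
          (S.txCost_nonneg (ha n).f_nonneg t)).trans
        (by rw [(ha n).hasSum_power.tsum_eq]; exact hp n)
  have hle1 : ∀ N, ∑ k ∈ Finset.range N, π k ≤ 1 := fun N =>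
    le_of_tendsto' (tendsto_finsetSum _ fun k _ => hπ k) fun n =>
      sum_le_hasSum _ (fun k _ => (ha n).nonneg k) (ha n).hasSum_one
  have hge1 : ∀ N : ℕ, 0 < N → 1 - q / N ≤ ∑ k ∈ Finset.range N, π k := fun N hN =>
    le_of_tendsto_of_tendsto' (tendsto_const_nhds.sub (hqs.div_const (N : ℝ)))
      (tendsto_finsetSum _ fun k _ => hπ k) fun n =>
      le_trans (by have := hqle n; gcongr) (one_sub_le_sum_range (ha n).nonneg (ha n).hasSum_one
        (hq n) hN)
  have hs := summable_of_sum_range_le h0 hle1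
  have hsum : HasSum π 1 := by
    rw [hs.hasSum_iff_tendsto_nat]
    have h1 : Tendsto (fun N : ℕ => 1 - q / N) atTop (𝓝 1) := by
      simpa using tendsto_const_nhds.sub (tendsto_const_div_atTop_nhds_zero_nat q)
    refine tendsto_of_tendsto_of_tendsto_of_le_of_le' h1 tendsto_const_nhds ?_
      (Eventually.of_forall hle1)
    filter_upwards [eventually_gt_atTop 0] with N hN using hge1 N hN
  refine ⟨⟨hf0, fun t w => le_of_tendsto' (hf t w) fun n => (ha n).f_le_one t w, fun w => ?_, h0,
    fun k hk => ?_, hsum, fun t => ?_⟩, summable_of_sum_range_le hQ0 hQ,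
    Real.tsum_le_of_sum_range_le hQ0 hQ, Real.tsum_le_of_sum_range_le (fun t =>
      mul_nonneg (S.updatedProb_nonneg h0 t) (S.txCost_nonneg hf0 t)) hPN⟩
  · exact tendsto_nhds_unique (hf 0 w) (by simp [(ha _).f_empty])
  · exact tendsto_nhds_unique (hπ k) (by simp [(ha _).supp k hk])
  · refine tendsto_nhds_unique ((tendsto_updatedProb hπ t).mul
      (tendsto_finsetSum _ fun w _ => (hf t w).const_mul _)) ?_
    exact (tendsto_upRate hπ t).congr fun n => ((ha n).balance t).symm

theorem Admissible.le_one (h : S.Admissible f π) (k : ℕ) : π k ≤ 1 :=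
  le_hasSum h.hasSum_one k fun j _ => h.nonneg j

theorem Admissible.meanQueue_nonneg (h : S.Admissible f π) : 0 ≤ meanQueue π :=
  tsum_nonneg fun k => mul_nonneg (h.nonneg k) (Nat.cast_nonneg k)

/-- `(f, π)` has the least mean queue length under the power budget `Paver`. -/
structure IsMinQueue (S : SchedModel) (Paver : ℝ) (f : ℕ → ℕ → ℝ) (π : ℕ → ℝ) : Prop where
  admissible : S.Admissible f π
  summable : Summable fun k => π k * (k : ℝ)
  power_le : S.meanPower f π ≤ Paver
  min : ∀ f' π', S.Admissible f' π' → (Summable fun k => π' k * (k : ℝ)) →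
    S.meanPower f' π' ≤ Paver → meanQueue π ≤ meanQueue π'

theorem exists_isMinQueue {Paver : ℝ} (hex : ∃ f π, S.Admissible f π ∧
    (Summable fun k => π k * (k : ℝ)) ∧ S.meanPower f π ≤ Paver) :
    ∃ f π, S.IsMinQueue Paver f π := by
  set A : Set ℝ := {q | ∃ f π, S.Admissible f π ∧ (Summable fun k => π k * (k : ℝ)) ∧
    S.meanPower f π ≤ Paver ∧ meanQueue π = q} with hA
  have hne : A.Nonempty := by
    obtain ⟨f, π, h1, h2, h3⟩ := hex
    exact ⟨_, f, π, h1, h2, h3, rfl⟩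
  have hbdd : BddBelow A := ⟨0, by
    rintro _ ⟨f, π, h1, _, _, rfl⟩
    exact h1.meanQueue_nonneg⟩
  have hseq : ∀ n : ℕ, ∃ x : (ℕ → ℕ → ℝ) × (ℕ → ℝ), S.Admissible x.1 x.2 ∧
      (Summable fun k => x.2 k * (k : ℝ)) ∧ S.meanPower x.1 x.2 ≤ Paver ∧
      meanQueue x.2 ≤ sInf A + 1 / ((n : ℝ) + 1) := by
    intro n
    obtain ⟨q, ⟨f, π, h1, h2, h3, rfl⟩, hlt⟩ := exists_lt_of_csInf_lt hne
      (lt_add_of_pos_right (sInf A) (Nat.one_div_pos_of_nat (n := n) (α := ℝ)))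
    exact ⟨(f, π), h1, h2, h3, hlt.le⟩
  choose x hx1 hx2 hx3 hx4 using hseq
  have hcomp : IsCompact ((Set.univ.pi fun _ : ℕ => Set.univ.pi fun _ : ℕ => Set.Icc (0 : ℝ) 1) ×ˢ
      (Set.univ.pi fun _ : ℕ => Set.Icc (0 : ℝ) 1)) :=
    (isCompact_univ_pi fun _ => isCompact_univ_pi fun _ => isCompact_Icc).prod
      (isCompact_univ_pi fun _ => isCompact_Icc)
  obtain ⟨y, -, s, hs, hy⟩ := hcomp.tendsto_subseq (x := x) fun n =>
    ⟨fun t _ w _ => ⟨(hx1 n).f_nonneg t w, (hx1 n).f_le_one t w⟩,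
      fun k _ => ⟨(hx1 n).nonneg k, (hx1 n).le_one k⟩⟩
  have hy1 : Tendsto (fun n => (x (s n)).1) atTop (𝓝 y.1) := (continuous_fst.tendsto y).comp hy
  have hy2 : Tendsto (fun n => (x (s n)).2) atTop (𝓝 y.2) := (continuous_snd.tendsto y).comp hy
  rw [tendsto_pi_nhds] at hy1 hy2
  have hlim : Tendsto (fun n => sInf A + 1 / ((s n : ℝ) + 1)) atTop (𝓝 (sInf A)) := by
    have := (tendsto_one_div_add_atTop_nhds_zero_nat (𝕜 := ℝ)).comp hs.tendsto_atTop
    simpa using this.const_add (sInf A)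
  obtain ⟨h1, h2, h3, h4⟩ := Admissible.of_tendsto (S := S) (fs := fun n => (x (s n)).1)
    (πs := fun n => (x (s n)).2) (fun t w => tendsto_pi_nhds.1 (hy1 t) w) hy2
    (fun n => hx1 (s n)) (fun n => hx2 (s n)) hlim (fun n => hx4 (s n)) (fun n => hx3 (s n))
  exact ⟨y.1, y.2, h1, h2, h4, fun f' π' h1' h2' h3' =>
    h3.trans (csInf_le hbdd ⟨f', π', h1', h2', h3', rfl⟩)⟩

/-- The attainable pairs of average power and mean queue length. -/
def attainable (S : SchedModel) : Set (ℝ × ℝ) :=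
  {x | ∃ f π, S.Admissible f π ∧ (Summable fun k => π k * (k : ℝ)) ∧
    S.meanPower f π = x.1 ∧ meanQueue π = x.2}

theorem convex_attainable (S : SchedModel) : Convex ℝ S.attainable := by
  rintro x ⟨f₀, π₀, h₀, hq₀, hp₀, hm₀⟩ y ⟨f₁, π₁, h₁, hq₁, hp₁, hm₁⟩ a s ha hs hsum
  obtain rfl : a = 1 - s := by linarith
  have hs1 : s ≤ 1 := by linarith
  set m : ℕ → ℝ := fun t => (1 - s) * S.updatedProb π₀ t + s * S.updatedProb π₁ t with hm
  have e0 : ∀ t, 0 ≤ (1 - s) * S.updatedProb π₀ t := fun t =>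
    mul_nonneg ha (S.updatedProb_nonneg h₀.nonneg t)
  have e1 : ∀ t, 0 ≤ s * S.updatedProb π₁ t := fun t =>
    mul_nonneg hs (S.updatedProb_nonneg h₁.nonneg t)
  set f : ℕ → ℕ → ℝ := fun t w => ((1 - s) * (S.updatedProb π₀ t * f₀ t w)
    + s * (S.updatedProb π₁ t * f₁ t w)) / m t with hf
  have hn : ∀ t w, 0 ≤ (1 - s) * (S.updatedProb π₀ t * f₀ t w)
      + s * (S.updatedProb π₁ t * f₁ t w) := fun t w => by
    have := mul_nonneg (e0 t) (h₀.f_nonneg t w)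
    have := mul_nonneg (e1 t) (h₁.f_nonneg t w)
    linarith
  have hle : ∀ t w, (1 - s) * (S.updatedProb π₀ t * f₀ t w)
      + s * (S.updatedProb π₁ t * f₁ t w) ≤ m t := fun t w => by
    have := mul_le_of_le_one_right (e0 t) (h₀.f_le_one t w)
    have := mul_le_of_le_one_right (e1 t) (h₁.f_le_one t w)
    simp only [hm]; linarith
  have hm0 : ∀ t, 0 ≤ m t := fun t => add_nonneg (e0 t) (e1 t)
  obtain ⟨hc1, hc2⟩ := h₀.combine h₁ hs hs1 (f := f) (fun t w => div_nonneg (hn t w) (hm0 t))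
    (fun t w => div_le_one_of_le₀ (hle t w) (hm0 t))
    (fun w => by simp only [hf]; rw [h₀.f_empty, h₁.f_empty]; simp) fun t w => by
      rcases (hm0 t).eq_or_lt with hz | hz
      · have := hn t w
        have := hle t w
        change m t * f t w = _
        rw [← hz, zero_mul]
        linarith
      · exact mul_div_cancel₀ _ hz.ne'
  obtain ⟨hc3, hc4⟩ := summable_combine hq₀ hq₁ s
  refine ⟨f, _, hc1, hc3, ?_, ?_⟩
  · rw [hc2, hp₀, hp₁]; simp
  · rw [hc4, hm₀, hm₁]; simp

/-- A supporting line of the attainable region at the optimum. -/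
theorem IsMinQueue.exists_support {Paver : ℝ} (h : S.IsMinQueue Paver f π) :
    ∃ l₁ l₀ : ℝ, 0 ≤ l₁ ∧ 0 ≤ l₀ ∧ (l₀ = 0 → 0 < l₁) ∧ ∀ x ∈ S.attainable,
      l₁ * Paver + l₀ * meanQueue π ≤ l₁ * x.1 + l₀ * x.2 := by
  have hdisj : Disjoint (Set.Iio Paver ×ˢ Set.Iio (meanQueue π)) S.attainable := by
    rw [Set.disjoint_left]
    rintro x ⟨hx1, hx2⟩ ⟨f', π', h1, h2, h3, h4⟩
    have := h.min f' π' h1 h2 (by rw [h3]; exact le_of_lt hx1)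
    rw [h4] at this
    exact absurd hx2 (not_lt.2 this)
  obtain ⟨L, u, hL1, hL2⟩ := geometric_hahn_banach_open ((convex_Iio Paver).prod
    (convex_Iio (meanQueue π))) (isOpen_Iio.prod isOpen_Iio) S.convex_attainable hdisj
  set l₁ := L (1, 0) with hl₁
  set l₀ := L (0, 1) with hl₀
  have hL : ∀ x : ℝ × ℝ, L x = l₁ * x.1 + l₀ * x.2 := fun x => by
    have : x = x.1 • ((1 : ℝ), (0 : ℝ)) + x.2 • ((0 : ℝ), (1 : ℝ)) := by
      ext <;> simp
    conv_lhs => rw [this]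
    rw [map_add, map_smul, map_smul, smul_eq_mul, smul_eq_mul]
    ring
  have hlt : ∀ a b : ℝ, 0 < a → 0 < b →
      l₁ * (Paver - a) + l₀ * (meanQueue π - b) < u := fun a b ha hb => by
    have := hL1 (Paver - a, meanQueue π - b) ⟨sub_lt_self _ ha, sub_lt_self _ hb⟩
    rwa [hL] at this
  have hn1 : 0 ≤ l₁ := by
    by_contra! hc
    set X := u - l₁ * Paver - l₀ * (meanQueue π - 1)
    have h1 := hlt ((|X| + 1) / (-l₁)) 1 (div_pos (by positivity) (by linarith)) one_pos
    have h2 : l₁ * ((|X| + 1) / (-l₁)) = -(|X| + 1) := by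
      have := hc.ne
      field_simp
    have := le_abs_self X
    rw [mul_sub, h2] at h1
    simp only [X] at *
    linarith
  have hn0 : 0 ≤ l₀ := by
    by_contra! hc
    set X := u - l₁ * (Paver - 1) - l₀ * meanQueue π
    have h1 := hlt 1 ((|X| + 1) / (-l₀)) one_pos (div_pos (by positivity) (by linarith))
    have h2 : l₀ * ((|X| + 1) / (-l₀)) = -(|X| + 1) := by
      have := hc.ne
      field_simp
    have := le_abs_self X
    rw [mul_sub l₀, h2] at h1
    simp only [X] at *
    linarith
  have hu : l₁ * Paver + l₀ * meanQueue π ≤ u := by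
    refine le_of_forall_pos_lt_add fun ε hε => ?_
    have hd : 0 < l₁ + l₀ + 1 := by linarith
    have h1 := hlt (ε / (l₁ + l₀ + 1)) (ε / (l₁ + l₀ + 1)) (div_pos hε hd) (div_pos hε hd)
    have h2 : (l₁ + l₀ + 1) * (ε / (l₁ + l₀ + 1)) = ε := mul_div_cancel₀ _ hd.ne'
    have h3 := div_pos hε hd
    linarith
  refine ⟨l₁, l₀, hn1, hn0, fun h0 => hn1.lt_of_ne' fun h1 => ?_, fun x hx => ?_⟩
  · have e1 := hlt 1 1 one_pos one_pos
    have e2 := hL2 (S.meanPower f π, meanQueue π) ⟨f, π, h.admissible, h.summable, rfl, rfl⟩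
    rw [hL, h0, h1] at e2
    rw [h0, h1] at e1
    linarith
  · have := hL2 x hx
    rw [hL] at this
    linarith

/-- With a finite buffer, a multiplier exists even at the least power. -/
theorem IsMinQueue.exists_multiplier_finite {Paver : ℝ} (h : S.IsMinQueue Paver f π)
    (hw : S.IsBestChannel w₀) (hθ : 0 < S.θ 0) (hS : S.FiniteBufferSingleArrival)
    (hrate : S.arrivalRate < 1) {n : ℕ} (hK : S.K = n)
    (hmin : ∀ f' π', S.Admissible f' π' → (Summable fun k => π' k * (k : ℝ)) →
      Paver ≤ S.meanPower f' π') :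
    ∃ lam, 0 ≤ lam ∧ ∀ f' π', S.Admissible f' π' → (Summable fun k => π' k * (k : ℝ)) →
      meanQueue π + lam * Paver ≤ meanQueue π' + lam * S.meanPower f' π' := by
  classical
  choose c D hD using fun N : ℕ => exists_valueCert hw (Nat.cast_nonneg N) hθ hrate hS
  set A : ℕ → Fin (n + 1) → Fin (S.W + 1) → Prop := fun N t w => (N : ℝ) * S.P w < D N t with hA
  set F : (Fin (n + 1) → Fin (S.W + 1) → Prop) → ℕ → ℕ → ℝ := fun B t w =>
    if 1 ≤ t ∧ 1 ≤ w ∧ ∀ (h1 : t < n + 1) (h2 : w < S.W + 1), B ⟨t, h1⟩ ⟨w, h2⟩ then 1 else 0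
    with hF
  have hFV : ∀ N : ℕ, S.FollowsValues N (D N) (F (A N)) := by
    intro N
    refine ⟨fun t w => ?_, fun t w => ?_, fun w => ?_, fun t w ht h1 _ hlt => ?_,
      fun t w h1 h2 hlt => ?_⟩
    · simp only [hF]; split_ifs <;> norm_num
    · simp only [hF]; split_ifs <;> norm_num
    · simp only [hF]; rw [if_neg (by simp)]
    · simp only [hF]; rw [if_pos ⟨ht, h1, fun _ _ => hlt⟩]
    · simp only [hF]
      rw [if_neg]
      rintro ⟨-, -, h3⟩
      by_cases ht : t < n + 1
      · exact lt_asymm hlt (h3 ht (by omega))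
      · exact lt_asymm hlt ((hD N).top t (by rw [hK]; exact_mod_cast (by omega : n ≤ t)) w h1 h2)
  obtain ⟨B, hB⟩ := Finite.exists_infinite_fiber A
  have hinf : (A ⁻¹' {B}).Infinite := Set.infinite_coe_iff.1 hB
  have hFN : ∀ N ∈ A ⁻¹' {B}, F (A N) = F B := fun N hN => by
    rw [Set.mem_preimage, Set.mem_singleton_iff] at hN; rw [hN]
  obtain ⟨N₀, hN₀⟩ := hinf.nonempty
  have hB0 := hFV N₀
  rw [hFN N₀ hN₀] at hB0
  obtain ⟨π₀, ha₀, hq₀⟩ := hB0.exists_admissible (hD N₀) hw hθ hS hrate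
  have hopt : ∀ N ∈ A ⁻¹' {B}, ∀ f' π', S.Admissible f' π' →
      (Summable fun k => π' k * (k : ℝ)) →
      meanQueue π₀ + N * S.meanPower (F B) π₀ ≤ meanQueue π' + N * S.meanPower f' π' := by
    intro N hN f' π' h1 h2
    have hfv := hFV N
    rw [hFN N hN] at hfv
    rw [hfv.cost_eq (hD N) hw (Nat.cast_nonneg N) ha₀ hq₀]
    exact (hD N).le hw (Nat.cast_nonneg N) h1 h2
  have hpow : S.meanPower (F B) π₀ ≤ Paver := by
    by_contra! hc
    obtain ⟨N', hN'⟩ := exists_nat_gt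
      ((meanQueue π - meanQueue π₀) / (S.meanPower (F B) π₀ - Paver))
    obtain ⟨N, hN, hNN⟩ := hinf.exists_gt N'
    have h1 := hopt N hN f π h.admissible h.summable
    have h2 := mul_le_mul_of_nonneg_left h.power_le (Nat.cast_nonneg (α := ℝ) N)
    have h3 : (N' : ℝ) < N := by exact_mod_cast hNN
    have h4 := hN'.trans h3
    rw [div_lt_iff₀ (by linarith)] at h4
    linarith
  refine ⟨N₀, Nat.cast_nonneg N₀, fun f' π' h1 h2 => ?_⟩
  have h3 := hopt N₀ hN₀ f' π' h1 h2
  have h4 := h.min _ _ ha₀ hq₀ hpow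
  have h5 := mul_le_mul_of_nonneg_left (hmin _ _ ha₀ hq₀) (Nat.cast_nonneg (α := ℝ) N₀)
  linarith

theorem IsMinQueue.exists_multiplier {Paver : ℝ} (h : S.IsMinQueue Paver f π)
    (hw : S.IsBestChannel w₀) (hθ : 0 < S.θ 0) (hS : S.FiniteBufferSingleArrival)
    (hrate : S.arrivalRate < 1)
    (hslater : S.K = ⊤ → ∃ f' π', S.Admissible f' π' ∧ (Summable fun k => π' k * (k : ℝ)) ∧
      S.meanPower f' π' < Paver) :
    ∃ lam, 0 ≤ lam ∧ ∀ f' π', S.Admissible f' π' → (Summable fun k => π' k * (k : ℝ)) →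
      meanQueue π + lam * Paver ≤ meanQueue π' + lam * S.meanPower f' π' := by
  obtain ⟨l₁, l₀, h1, h0, hne, hsup⟩ := h.exists_support
  rcases h0.eq_or_lt with hz | hpos
  · have hl1 := hne hz.symm
    have hmin : ∀ f' π', S.Admissible f' π' → (Summable fun k => π' k * (k : ℝ)) →
        Paver ≤ S.meanPower f' π' := fun f' π' ha hq => by
      have := hsup (S.meanPower f' π', meanQueue π') ⟨f', π', ha, hq, rfl, rfl⟩
      rw [← hz, zero_mul, zero_mul, add_zero, add_zero] at this
      exact le_of_mul_le_mul_left this hl1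
    by_cases hK : S.K = ⊤
    · obtain ⟨f', π', ha, hq, hlt⟩ := hslater hK
      exact absurd (hmin f' π' ha hq) (not_le.2 hlt)
    · obtain ⟨n, hn⟩ := ENat.ne_top_iff_exists.1 hK
      exact h.exists_multiplier_finite hw hθ hS hrate hn.symm hmin
  · refine ⟨l₁ / l₀, div_nonneg h1 h0, fun f' π' ha hq => ?_⟩
    have := hsup (S.meanPower f' π', meanQueue π') ⟨f', π', ha, hq, rfl, rfl⟩
    simp only at this
    have e : ∀ p : ℝ, l₁ / l₀ * p = (l₁ * p) / l₀ := fun p => by ring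
    rw [e, e, ← sub_nonneg]
    have h2 : 0 ≤ (l₁ * S.meanPower f' π' + l₀ * meanQueue π'
        - (l₁ * Paver + l₀ * meanQueue π)) / l₀ := div_nonneg (by linarith) hpos.le
    convert h2 using 1
    field_simp
    ring

end

noncomputable section

variable {S : SchedModel} {f : ℕ → ℕ → ℝ} {π : ℕ → ℝ} {w₀ : ℕ} {Paver : ℝ}

theorem avgDelay_eq (hrate : 0 < S.arrivalRate) (h0 : ∀ k, 0 ≤ π k)
    (hq : Summable fun k => π k * (k : ℝ)) :
    S.avgDelay π = ENNReal.ofReal (meanQueue π / S.arrivalRate) := by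
  rw [ENNReal.ofReal_div_of_pos hrate, meanQueue, ENNReal.ofReal_tsum_of_nonneg
    (fun k => mul_nonneg (h0 k) (Nat.cast_nonneg k)) hq, avgDelay]
  congr 2
  funext k
  rw [mul_comm (π k), ENNReal.ofReal_mul (Nat.cast_nonneg k), ENNReal.ofReal_natCast]

theorem avgDelay_eq_top (h0 : ∀ k, 0 ≤ π k) (hq : ¬ Summable fun k => π k * (k : ℝ)) :
    S.avgDelay π = ⊤ := by
  have : ∑' k : ℕ, (k : ENNReal) * ENNReal.ofReal (π k) = ⊤ := by
    by_contra hc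
    refine hq ((ENNReal.summable_toReal hc).congr fun k => ?_)
    rw [ENNReal.toReal_mul, ENNReal.toReal_natCast, ENNReal.toReal_ofReal (h0 k), mul_comm]
  rw [avgDelay, this, ENNReal.top_div_of_ne_top ENNReal.ofReal_ne_top]

theorem IsMinQueue.isOptimal (hrate : 0 < S.arrivalRate) (hS : S.FiniteBufferSingleArrival)
    (h : S.IsMinQueue Paver f π) : S.IsOptimal Paver (S.cutoff f) π := by
  refine ⟨h.admissible.isFeasible hS h.power_le, fun f' π' h' => ?_⟩
  have ha := h'.admissible hrate
  by_cases hq : Summable fun k => π' k * (k : ℝ)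
  · rw [avgDelay_eq hrate h.admissible.nonneg h.summable, avgDelay_eq hrate ha.nonneg hq]
    exact ENNReal.ofReal_le_ofReal (div_le_div_of_nonneg_right
      (h.min f' π' ha hq (ha.avgPower_eq ▸ h'.power)) hrate.le)
  · rw [avgDelay_eq_top ha.nonneg hq]; exact le_top

theorem IsOptimal.isMinQueue (hrate : 0 < S.arrivalRate) (h : S.IsOptimal Paver f π)
    (hS : S.FiniteBufferSingleArrival) {f' : ℕ → ℕ → ℝ} {π' : ℕ → ℝ}
    (h' : S.IsMinQueue Paver f' π') : S.Admissible f π ∧ (Summable fun k => π k * (k : ℝ)) ∧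
      S.meanPower f π ≤ Paver ∧ meanQueue π ≤ meanQueue π' := by
  have ha := h.1.admissible hrate
  have hle := h.2 _ _ (h'.isOptimal hrate hS).1
  rw [avgDelay_eq hrate h'.admissible.nonneg h'.summable] at hle
  have hq : Summable fun k => π k * (k : ℝ) := by
    by_contra hc
    rw [avgDelay_eq_top ha.nonneg hc] at hle
    exact ENNReal.ofReal_ne_top (top_le_iff.1 hle)
  refine ⟨ha, hq, ha.avgPower_eq ▸ h.1.power, ?_⟩
  rw [avgDelay_eq hrate ha.nonneg hq, ENNReal.ofReal_le_ofReal_iff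
    (div_nonneg h'.admissible.meanQueue_nonneg hrate.le)] at hle
  exact (div_le_div_iff_of_pos_right hrate).1 hle

/-- Some optimal policy has the dual-threshold structure with at most one randomized state, and
every optimal policy has non-increasing channel thresholds on the states that occur. -/
def HasThresholdStructure (S : SchedModel) (Paver : ℝ) : Prop :=
  (∃ (f : ℕ → ℕ → ℝ) (π : ℕ → ℝ) (T : ℕ → ℕ) (I : ℕ → ℕ∞),
    S.IsOptimal Paver f π ∧
    S.IsDualThreshold f T I ∧
    {p : ℕ × ℕ | (p.1 : ℕ∞) ≤ S.K ∧ 1 ≤ p.2 ∧ p.2 = T p.1 ∧ f p.1 p.2 ≠ 0}.Subsingleton ∧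
    {p : ℕ × ℕ | (p.1 : ℕ∞) ≤ S.K ∧ 1 ≤ p.2 ∧ p.2 ≤ S.W ∧
      0 < f p.1 p.2 ∧ f p.1 p.2 < 1}.Subsingleton) ∧
  (∀ (f : ℕ → ℕ → ℝ) (π : ℕ → ℝ), S.IsOptimal Paver f π →
    ∃ T : ℕ → ℕ, (∀ k, T k ≤ S.W) ∧
      (∀ k w, 0 < S.updatedProb π k → 1 ≤ k → 1 ≤ w → w ≤ S.W → 0 < S.η w →
        (w < T k → f k w = 0) ∧ (T k < w → f k w = 1)) ∧
      (∀ k l, 0 < S.updatedProb π k → 0 < S.updatedProb π l → 1 ≤ k → k ≤ l →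
        T l ≤ T k))

theorem IsMinQueue.hasThresholdStructure (hrate : 0 < S.arrivalRate) (hrate1 : S.arrivalRate < 1)
    (hS : S.FiniteBufferSingleArrival) (hw : S.IsBestChannel w₀) (hθ : 0 < S.θ 0)
    (h : S.IsMinQueue Paver f π) {lam : ℝ} (hl : 0 ≤ lam)
    (hmul : ∀ f' π', S.Admissible f' π' → (Summable fun k => π' k * (k : ℝ)) →
      meanQueue π + lam * Paver ≤ meanQueue π' + lam * S.meanPower f' π') :
    S.HasThresholdStructure Paver := by
  classical
  obtain ⟨c, D, hD⟩ := exists_valueCert hw hl hθ hrate1 hS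
  have hDpos : ∀ k, 1 ≤ k → 0 < D k := fun k hk =>
    (hD.nonneg hw hl 0).trans_lt (hD.mono (by omega))
  -- the policy `f`, made to follow the marginal values in the states that do not occur
  set g : ℕ → ℕ → ℝ := fun t w => if t = 0 then 0 else
    if lam * S.P w < D t then 1 else if D t < lam * S.P w then 0 else f t w with hg
  have hgF : S.FollowsValues lam D g := by
    refine ⟨fun t w => ?_, fun t w => ?_, fun w => if_pos rfl, fun t w ht _ _ hlt => ?_,
      fun t w _ _ hlt => ?_⟩
    · simp only [hg]; split_ifs
      exacts [le_rfl, zero_le_one, le_rfl, h.admissible.f_nonneg t w]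
    · simp only [hg]; split_ifs
      exacts [zero_le_one, le_rfl, zero_le_one, h.admissible.f_le_one t w]
    · simp only [hg]; rw [if_neg (by omega), if_pos hlt]
    · simp only [hg]; split_ifs with h1 h2
      · rfl
      · exact absurd hlt (not_lt.2 h2.le)
      · rfl
  have hc : meanQueue π + lam * Paver ≤ c := by
    obtain ⟨π', ha', hq'⟩ := hgF.exists_admissible hD hw hθ hS hrate1
    rw [← hgF.cost_eq hD hw hl ha' hq']
    exact hmul _ _ ha' hq'
  refine ⟨?_, fun f' π' h' => ?_⟩
  · have hle : meanQueue π + lam * S.meanPower f π ≤ c :=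
      le_trans (by have := mul_le_mul_of_nonneg_left h.power_le hl; linarith) hc
    obtain ⟨hga, hgp⟩ := h.admissible.congr_policy hgF.f_nonneg hgF.f_le_one hgF.f_empty
      fun t w ht h1 h2 h3 => by
        have hsl := hD.slackness hw hl h.admissible h.summable hle ht h1 h2 h3
        simp only [hg]
        split_ifs with e1 e2 e3
        · rw [e1, h.admissible.f_empty]
        · exact (hsl.1 e2).symm
        · exact (hsl.2 e3).symm
        · rfl
    obtain ⟨f₁, hf₁, ⟨π₁, ha₁, hq₁, hp₁⟩, hsub⟩ := hgF.exists_subsingleton hD hw hθ hS hrate1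
      (p := S.meanPower g π) ⟨π, hga, h.summable, rfl⟩
    have e1 := hf₁.cost_eq hD hw hl ha₁ hq₁
    have e2 := hgF.cost_eq hD hw hl hga h.summable
    have hmin : S.IsMinQueue Paver f₁ π₁ := by
      refine ⟨ha₁, hq₁, by rw [hp₁, hgp]; exact h.power_le, fun f' π' h1 h2 h3 => ?_⟩
      refine le_trans (le_of_eq ?_) (h.min f' π' h1 h2 h3)
      rw [hp₁] at e1; linarith
    obtain ⟨T, I, h1, h2, h3⟩ := hf₁.isDualThreshold hD hl hsub
    exact ⟨_, π₁, T, I, hmin.isOptimal hrate hS, h1, h2, h3⟩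
  · obtain ⟨ha, hq, hp, hqle⟩ := h'.isMinQueue hrate hS h
    have hle : meanQueue π' + lam * S.meanPower f' π' ≤ c :=
      le_trans (by have := mul_le_mul_of_nonneg_left hp hl; linarith) hc
    set T : ℕ → ℕ := fun k => Nat.findGreatest (fun w => 1 ≤ w ∧ D k ≤ lam * S.P w) S.W with hT
    have hTle : ∀ k, T k ≤ S.W := fun k => Nat.findGreatest_le _
    have hTspec : ∀ k, T k ≠ 0 → 1 ≤ T k ∧ D k ≤ lam * S.P (T k) := fun k hk =>
      Nat.findGreatest_of_ne_zero (P := fun w => 1 ≤ w ∧ D k ≤ lam * S.P w) (m := T k) rfl hk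
    refine ⟨T, hTle, fun k w hk hk1 h1 h2 h3 => ⟨fun hlt => ?_, fun hlt => ?_⟩,
      fun k l _ _ hk1 hkl => ?_⟩
    · have hsp := hTspec k (by omega)
      refine (hD.slackness hw hl ha hq hle hk h1 h2 h3).2 (hsp.2.trans_lt ?_)
      refine mul_lt_mul_of_pos_left (S.P_anti w (T k) h1 hlt (hTle k)) (hl.lt_of_ne' fun hz => ?_)
      have h4 := hsp.2
      rw [hz, zero_mul] at h4
      exact absurd (hDpos k hk1) (not_lt.2 h4)
    · refine (hD.slackness hw hl ha hq hle hk h1 h2 h3).1 ?_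
      have := Nat.findGreatest_is_greatest hlt h2
      simp only [not_and, not_le] at this
      exact this h1
    · by_cases hz : T l = 0
      · rw [hz]; exact Nat.zero_le _
      · have hsp := hTspec l hz
        exact Nat.le_findGreatest (hTle l) ⟨hsp.1, (hD.mono.monotone hkl).trans hsp.2⟩

/-- Transmit from every nonempty queue in the channel states from `v` on. -/
def stepPolicy (v t w : ℕ) : ℝ := if 1 ≤ t ∧ v ≤ w then 1 else 0

theorem stepPolicy_nonneg (v t w : ℕ) : 0 ≤ stepPolicy v t w := by
  unfold stepPolicy; split_ifs; exacts [zero_le_one, le_rfl]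

theorem stepPolicy_le_one (v t w : ℕ) : stepPolicy v t w ≤ 1 := by
  unfold stepPolicy; split_ifs; exacts [le_rfl, zero_le_one]

theorem stepPolicy_empty (v w : ℕ) : stepPolicy v 0 w = 0 := by simp [stepPolicy]

theorem stepPolicy_dualThreshold (S : SchedModel) {v : ℕ} (hv1 : 1 ≤ v) (hvW : v ≤ S.W) :
    ∃ T I, S.IsDualThreshold (S.cutoff (stepPolicy v)) T I ∧
      {p : ℕ × ℕ | (p.1 : ℕ∞) ≤ S.K ∧ 1 ≤ p.2 ∧ p.2 = T p.1
        ∧ S.cutoff (stepPolicy v) p.1 p.2 ≠ 0}.Subsingleton ∧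
      {p : ℕ × ℕ | (p.1 : ℕ∞) ≤ S.K ∧ 1 ≤ p.2 ∧ p.2 ≤ S.W ∧
        0 < S.cutoff (stepPolicy v) p.1 p.2 ∧ S.cutoff (stepPolicy v) p.1 p.2 < 1}.Subsingleton := by
  refine ⟨fun k => if k = 0 then S.W else v - 1, fun w => if v ≤ w then 0 else S.K,
    ⟨fun k => ?_, fun k w hk h1 h2 h3 => ?_, fun k w hk h1 h2 h3 => ?_, fun k l h1 h2 h3 => ?_,
      fun w => ?_, fun k w hk h1 h2 h3 => ?_, fun k w hk h1 h2 h3 => ?_⟩,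
    fun p hp => ?_, fun p hp => ?_⟩
  · split_ifs <;> omega
  · rw [cutoff_of_le hk, stepPolicy, if_neg]
    rintro ⟨h4, h5⟩
    rw [if_neg (by omega)] at h3
    omega
  · rw [cutoff_of_le hk, stepPolicy, if_pos]
    by_cases h0 : k = 0
    · rw [if_pos h0] at h3; omega
    · rw [if_neg h0] at h3; omega
  · rw [if_neg (by omega), if_neg (by omega)]
  · split_ifs
    · exact zero_le
    · exact le_rfl
  · rw [cutoff_of_le hk, stepPolicy, if_neg]
    rintro ⟨h4, h5⟩
    rw [if_pos h5] at h3
    exact absurd h3 (by simp)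
  · rw [cutoff_of_le hk, stepPolicy, if_pos]
    by_cases h4 : v ≤ w
    · rw [if_pos h4] at h3
      exact ⟨by exact_mod_cast h3, h4⟩
    · rw [if_neg h4] at h3
      exact absurd hk (not_le.2 h3)
  · obtain ⟨h1, h2, h3, h4⟩ := hp
    rw [cutoff_of_le h1, stepPolicy] at h4
    have h5 : 1 ≤ p.1 ∧ v ≤ p.2 := by by_contra hc; exact h4 (if_neg hc)
    simp only [if_neg (show ¬ p.1 = 0 by omega)] at h3
    omega
  · obtain ⟨h1, h2, h3, h4, h5⟩ := hp
    rw [cutoff_of_le h1, stepPolicy] at h4 h5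
    split_ifs at h4 h5
    · exact absurd h5 (lt_irrefl _)
    · exact absurd h4 (lt_irrefl _)

theorem txProb_stepPolicy (hw : S.IsBestChannel w₀) {t : ℕ} (ht : 1 ≤ t) :
    S.txProb (stepPolicy w₀) t = S.η w₀ := by
  rw [txProb, Finset.sum_eq_single w₀]
  · rw [stepPolicy, if_pos ⟨ht, le_rfl⟩, mul_one]
  · intro w hwm hne
    rw [Finset.mem_Icc] at hwm
    rcases (S.η_nonneg w hwm.1 hwm.2).eq_or_lt with hη | hη
    · rw [← hη, zero_mul]
    · have := hw.max w hwm.1 hwm.2 hη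
      rw [stepPolicy, if_neg (by omega), mul_zero]
  · intro hc; exact absurd (Finset.mem_Icc.2 ⟨hw.one_le, hw.le⟩) hc

theorem txCost_stepPolicy (hw : S.IsBestChannel w₀) (t : ℕ) :
    S.txCost (stepPolicy w₀) t = S.txProb (stepPolicy w₀) t * S.P w₀ := by
  rw [txCost, txProb, Finset.sum_mul]
  refine Finset.sum_congr rfl fun w hwm => ?_
  rw [Finset.mem_Icc] at hwm
  rcases (S.η_nonneg w hwm.1 hwm.2).eq_or_lt with hη | hη
  · rw [← hη]; ring
  by_cases h : w = w₀
  · rw [h]; ring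
  · have := hw.max w hwm.1 hwm.2 hη
    rw [stepPolicy, if_neg (by omega)]; ring

/-- The case of an infinite buffer and a budget that only the best channel state can meet. -/
theorem hasThresholdStructure_of_tight (hrate : 0 < S.arrivalRate)
    (hK : S.K = ⊤) (hw : S.IsBestChannel w₀) (hθ : 0 < S.θ 0)
    (hfeas : ∃ f π, S.IsFeasible Paver f π) {v : ℕ} (hv1 : 1 ≤ v) (hvW : v ≤ S.W) (hη : 0 < S.η v)
    (htight : Paver ≤ S.txGain 1 (S.P v) + S.arrivalRate * S.P v) :
    S.HasThresholdStructure Paver := by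
  have hS : S.FiniteBufferSingleArrival := Or.inl hK
  have key : ∀ {f π}, S.Admissible f π → S.meanPower f π ≤ Paver → v = w₀ ∧
      ∀ t w, 0 < S.updatedProb π t → 1 ≤ w → w ≤ S.W → 0 < S.η w → w ≠ w₀ → f t w = 0 :=
    fun h hp => h.only_best hθ hw hv1 hvW hη (hp.trans htight)
  have hloss : ∀ {f π}, S.Admissible f π → S.meanPower f π ≤ Paver → ∀ t,
      S.upRate π t ≤ S.updatedProb π t * S.η w₀ := by
    intro f π h hp t
    rw [← h.balance t]
    rcases (S.updatedProb_nonneg h.nonneg t).eq_or_lt with hμ | hμ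
    · rw [← hμ]; simp
    refine mul_le_mul_of_nonneg_left ?_ hμ.le
    rw [txProb, Finset.sum_eq_single w₀]
    · exact mul_le_of_le_one_right hw.pos.le (h.f_le_one t w₀)
    · intro w hwm hne
      rw [Finset.mem_Icc] at hwm
      rcases (S.η_nonneg w hwm.1 hwm.2).eq_or_lt with hη | hη
      · rw [← hη, zero_mul]
      · rw [(key h hp).2 t w hμ hwm.1 hwm.2 hη hne, mul_zero]
    · intro hc; exact absurd (Finset.mem_Icc.2 ⟨hw.one_le, hw.le⟩) hc
  obtain ⟨f, π, hf⟩ := hfeas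
  have ha := hf.admissible hrate
  have hp : S.meanPower f π ≤ Paver := ha.avgPower_eq ▸ hf.power
  obtain ⟨rfl, -⟩ := key ha hp
  have hlt : S.arrivalRate < S.η v := ha.rate_lt hθ hη fun t => by
    rw [ha.balance t]; exact hloss ha hp t
  obtain ⟨ha₀, hq₀⟩ := exists_admissible hθ hS (stepPolicy_nonneg v) (stepPolicy_le_one v)
    (stepPolicy_empty v) (fun t ht => by rw [txProb_stepPolicy hw ht]; exact hη) hη.le hlt (N := 1)
    (fun t ht => (txProb_stepPolicy hw ht).ge)
    (fun t ht => by rw [hK] at ht; exact absurd ht (by simp))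
  set π₀ : ℕ → ℝ := fun k => (∑' j, S.weights (S.txProb (stepPolicy v)) j)⁻¹
    * S.weights (S.txProb (stepPolicy v)) k
  have hp₀ : S.meanPower (stepPolicy v) π₀ ≤ Paver := by
    have h1 : S.meanPower (stepPolicy v) π₀ = S.arrivalRate * S.P v := by
      have := (S.hasSum_upRate_one ha₀.hasSum_one).mul_right (S.P v)
      rw [mul_one] at this
      refine HasSum.tsum_eq (this.congr_fun fun t => ?_)
      rw [txCost_stepPolicy hw, ← ha₀.balance t, mul_assoc]
    have h2 := ha.price_le_power (S.P v)
    have h3 := txGain_eq_zero (lam := 1) hw zero_le_one (x := S.P v) (by rw [one_mul])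
    linarith
  have hmin : S.IsMinQueue Paver (stepPolicy v) π₀ := by
    refine ⟨ha₀, hq₀, hp₀, fun f' π' h1 h2 h3 => ?_⟩
    obtain ⟨a1, a2⟩ := hasSum_first_moments (S := S) h1.hasSum_one h2.hasSum
    obtain ⟨b1, b2⟩ := hasSum_first_moments (S := S) ha₀.hasSum_one hq₀.hasSum
    have e1 := hasSum_le (fun t => ?_) a2 (a1.mul_right (S.η v))
    · have e2 : HasSum (fun t => S.upRate π₀ t * (t : ℝ))
          ((∑' k, π₀ k * (k : ℝ) + S.arrivalRate) * S.η v) := by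
        refine (b1.mul_right (S.η v)).congr_fun fun t => ?_
        rcases Nat.eq_zero_or_pos t with rfl | ht
        · simp
        · rw [← ha₀.balance t, txProb_stepPolicy hw ht]; ring
      have e3 := b2.unique e2
      have e4 : (S.η v - S.arrivalRate) * meanQueue π₀
          ≤ (S.η v - S.arrivalRate) * meanQueue π' := by
        unfold meanQueue; linarith
      exact le_of_mul_le_mul_left e4 (by linarith)
    · have := mul_le_mul_of_nonneg_right (hloss h1 h3 t) (Nat.cast_nonneg (α := ℝ) t)
      linarith
  refine ⟨?_, fun f' π' h' => ?_⟩
  · obtain ⟨T, I, h1, h2, h3⟩ := S.stepPolicy_dualThreshold hv1 hvW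
    exact ⟨_, π₀, T, I, hmin.isOptimal hrate hS, h1, h2, h3⟩
  · obtain ⟨h1, -, h3, -⟩ := h'.isMinQueue hrate hS hmin
    refine ⟨fun _ => v, fun _ => hvW, fun k w hk _ hw1 hw2 hηw => ⟨fun hlt' => ?_, fun hlt' => ?_⟩,
      fun _ _ _ _ _ _ => le_rfl⟩
    · exact (key h1 h3).2 k w hk hw1 hw2 hηw hlt'.ne
    · exact absurd (hw.max w hw1 hw2 hηw) (not_le.2 hlt')

theorem hasThresholdStructure_of_pos (hrate : 0 < S.arrivalRate) (hθ : 0 < S.θ 0)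
    (hfeas : ∃ f π, S.IsFeasible Paver f π) : S.HasThresholdStructure Paver := by
  obtain ⟨f, π, hf⟩ := hfeas
  obtain ⟨w₀, hw⟩ := S.exists_bestChannel
  have hS := hf.finiteBufferSingleArrival hrate
  have ha := hf.admissible hrate
  have hrate1 := ha.rate_lt_one hθ
  obtain ⟨v, r, hv1, hvW, hη, hr0, hr1, hx⟩ := S.exists_waterLevel hrate hrate1.le
  have hcost := waterLevel_cost hv1 hvW hx
  by_cases htight : S.K = ⊤ ∧ Paver ≤ S.txGain 1 (S.P v) + S.arrivalRate * S.P v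
  · exact hasThresholdStructure_of_tight hrate htight.1 hw hθ ⟨f, π, hf⟩ hv1 hvW hη htight.2
  have hslater : S.K = ⊤ → ∃ f' π', S.Admissible f' π' ∧
      (Summable fun k => π' k * (k : ℝ)) ∧ S.meanPower f' π' < Paver := fun hK =>
    exists_power_lt hθ hK hrate hrate1 hr0 hr1 hx
      (by rw [hcost]; exact not_le.1 fun h => htight ⟨hK, h⟩)
  have hex : ∃ f π, S.Admissible f π ∧ (Summable fun k => π k * (k : ℝ)) ∧
      S.meanPower f π ≤ Paver := by
    by_cases hK : S.K = ⊤
    · obtain ⟨f', π', h1, h2, h3⟩ := hslater hK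
      exact ⟨f', π', h1, h2, h3.le⟩
    · obtain ⟨n, hn⟩ := ENat.ne_top_iff_exists.1 hK
      refine ⟨f, π, ha, ?_, ha.avgPower_eq ▸ hf.power⟩
      refine summable_of_ne_finset_zero (s := Finset.range n) fun k hk => ?_
      rw [Finset.mem_range, not_lt] at hk
      rw [ha.supp k (by rw [← hn]; exact_mod_cast hk), zero_mul]
  obtain ⟨f₁, π₁, hmin⟩ := exists_isMinQueue hex
  obtain ⟨lam, hl, hmul⟩ := hmin.exists_multiplier hw hθ hS hrate1 hslater
  exact hmin.hasThresholdStructure hrate hrate1 hS hw hθ hl hmul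

/-- If packets arrive in every slot, one packet arrives and leaves in every slot. -/
theorem hasThresholdStructure_of_zero (hrate : 0 < S.arrivalRate) (hθ : S.θ 0 = 0)
    (hfeas : ∃ f π, S.IsFeasible Paver f π) : S.HasThresholdStructure Paver := by
  obtain ⟨f, π, hf⟩ := hfeas
  have hS := hf.finiteBufferSingleArrival hrate
  have hge : ∀ m, S.θ m ≤ m * S.θ m := fun m => by
    rcases Nat.eq_zero_or_pos m with rfl | hm
    · rw [hθ, mul_zero]
    · exact le_mul_of_one_le_left (S.θ_nonneg m) (by exact_mod_cast hm)
  have hrate1 : 1 ≤ S.arrivalRate := by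
    rw [← S.θ_sum]; exact Finset.sum_le_sum fun m _ => hge m
  have hμ0 : ∀ π, S.updatedProb π 0 = 0 := fun π => by
    rw [updatedProb_eq_range, hθ]; simp
  have hall : ∀ {f π}, S.Admissible f π → ∀ t, S.updatedProb π t * (1 - S.txProb f t) = 0 := by
    intro f π h t
    have h1 := S.hasSum_updatedProb_one h.hasSum_one
    have h2 := S.hasSum_upRate_one h.hasSum_one
    have h3 : ∀ t, 0 ≤ S.updatedProb π t - S.upRate π t := fun t => by
      rw [← h.balance t]
      exact sub_nonneg.2 (updatedProb_mul_txProb_le h.nonneg h.f_le_one t)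
    have h4 := h1.sub h2
    have h5 := h4.nonneg h3
    rw [show (1 : ℝ) - S.arrivalRate * 1 = 0 by linarith] at h4
    have h6 := congrFun ((hasSum_zero_iff_of_nonneg h3).1 h4) t
    rw [mul_sub, h.balance t, mul_one]; exact h6
  have hone : ∀ {f π}, S.Admissible f π → ∀ t w, 0 < S.updatedProb π t → 1 ≤ w → w ≤ S.W →
      0 < S.η w → f t w = 1 := by
    intro f π h t w ht h1 h2 h3
    have h4 := (mul_eq_zero.1 (hall h t)).resolve_left ht.ne'
    have h5 : ∑ w ∈ Finset.Icc 1 S.W, S.η w * (1 - f t w) = 0 := by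
      simp_rw [mul_sub, mul_one]
      rw [Finset.sum_sub_distrib, S.η_sum]
      exact h4
    have h6 := (Finset.sum_eq_zero_iff_of_nonneg fun w hwm => by
      rw [Finset.mem_Icc] at hwm
      exact mul_nonneg (S.η_nonneg w hwm.1 hwm.2) (sub_nonneg.2 (h.f_le_one t w))).1 h5 w
      (Finset.mem_Icc.2 ⟨h1, h2⟩)
    linarith [(mul_eq_zero.1 h6).resolve_left h3.ne']
  have ha := hf.admissible hrate
  have hrate_eq : S.arrivalRate = 1 := by
    refine le_antisymm ?_ hrate1
    have := hasSum_le (fun t => ?_) (S.hasSum_upRate_one ha.hasSum_one)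
      (S.hasSum_updatedProb_one ha.hasSum_one)
    · rwa [mul_one] at this
    · rw [← ha.balance t]; exact updatedProb_mul_txProb_le ha.nonneg ha.f_le_one t
  have hm2 : ∀ m, 2 ≤ m → S.θ m = 0 := by
    intro m hm
    by_cases hmM : m ≤ S.M
    · have h1 : ∑ m ∈ Finset.range (S.M + 1), ((m : ℝ) * S.θ m - S.θ m) = 0 := by
        rw [Finset.sum_sub_distrib, S.θ_sum, sub_eq_zero]; exact hrate_eq
      have h2 := (Finset.sum_eq_zero_iff_of_nonneg fun m _ => sub_nonneg.2 (hge m)).1 h1 m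
        (Finset.mem_range.2 (by omega))
      have h3 : ((m : ℝ) - 1) * S.θ m = 0 := by linarith
      refine (mul_eq_zero.1 h3).resolve_left ?_
      have : (2 : ℝ) ≤ m := by exact_mod_cast hm
      linarith
    · exact S.θ_zero m (by omega)
  have hstep : ∀ t, 1 ≤ t → ∀ w, 1 ≤ w → stepPolicy 1 t w = 1 := fun t ht w h1 =>
    if_pos ⟨ht, h1⟩
  have hpow : ∀ {π}, S.Admissible (stepPolicy 1) π →
      S.meanPower (stepPolicy 1) π = ∑ w ∈ Finset.Icc 1 S.W, S.η w * S.P w := by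
    intro π h
    have := (S.hasSum_updatedProb_one h.hasSum_one).mul_right
      (∑ w ∈ Finset.Icc 1 S.W, S.η w * S.P w)
    rw [one_mul] at this
    refine HasSum.tsum_eq (this.congr_fun fun t => ?_)
    rcases Nat.eq_zero_or_pos t with rfl | ht
    · rw [hμ0]; ring
    · congr 1
      refine Finset.sum_congr rfl fun w hwm => ?_
      rw [Finset.mem_Icc] at hwm
      rw [hstep t ht w hwm.1, mul_one]
  obtain ⟨ha₁, hp₁⟩ := ha.congr_policy (stepPolicy_nonneg 1) (stepPolicy_le_one 1)
    (stepPolicy_empty 1) fun t w ht h1 h2 h3 => by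
      rcases Nat.eq_zero_or_pos t with rfl | h0
      · rw [hμ0] at ht; exact absurd ht (lt_irrefl _)
      · rw [hstep t h0 w h1, hone ha t w ht h1 h2 h3]
  -- the queue that is empty at the end of every slot
  set δ : ℕ → ℝ := fun k => if k = 0 then 1 else 0 with hδ
  have haδ : S.Admissible (stepPolicy 1) δ := by
    refine ⟨stepPolicy_nonneg 1, stepPolicy_le_one 1, stepPolicy_empty 1, fun k => ?_,
      fun k hk => ?_, hasSum_ite_eq 0 1, fun t => ?_⟩
    · simp only [hδ]; split_ifs; exacts [zero_le_one, le_rfl]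
    · have : 1 ≤ k := by exact_mod_cast S.K_pos.trans hk
      exact if_neg (by omega)
    · rcases Nat.eq_zero_or_pos t with rfl | ht
      · rw [S.txProb_empty (stepPolicy_empty 1), mul_zero, upRate_zero]
      · rw [S.txProb_eq_one fun w h1 _ => hstep t ht w h1, mul_one, updatedProb_eq_range,
          upRate_eq_range, hθ, zero_mul, add_zero]
        refine Finset.sum_congr rfl fun j hj => ?_
        rw [Finset.mem_range] at hj
        rw [arrivalTail_eq_θ hm2 (by omega)]
  have hδz : (fun k => δ k * (k : ℝ)) = fun _ => 0 := by
    funext k; simp only [hδ]; split_ifs with h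
    · rw [h]; simp
    · rw [zero_mul]
  have hmin : S.IsMinQueue Paver (stepPolicy 1) δ := by
    refine ⟨haδ, by rw [hδz]; exact summable_zero, ?_, fun f' π' h1 _ _ => ?_⟩
    · rw [hpow haδ, ← hpow ha₁, hp₁]; exact ha.avgPower_eq ▸ hf.power
    · rw [meanQueue, hδz, tsum_zero]; exact h1.meanQueue_nonneg
  refine ⟨?_, fun f' π' h' => ?_⟩
  · obtain ⟨T, I, h1, h2, h3⟩ := S.stepPolicy_dualThreshold le_rfl S.W_pos
    exact ⟨_, δ, T, I, hmin.isOptimal hrate hS, h1, h2, h3⟩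
  · exact ⟨fun _ => 0, fun _ => Nat.zero_le _, fun k w hk _ h1 h2 h3 =>
      ⟨fun hlt => absurd hlt (Nat.not_lt_zero _), fun _ =>
        hone (h'.1.admissible hrate) k w hk h1 h2 h3⟩, fun _ _ _ _ _ _ => le_rfl⟩

end

end SchedModel

theorem theorem5 (S : SchedModel) (hrate : 0 < S.arrivalRate) (Paver : ℝ)
    (hfeas : ∃ f π, S.IsFeasible Paver f π) :
    -- some optimal policy has the complete structure, with at most one threshold state
    -- of nonzero probability and at most one state of probability strictly between 0 and 1
    (∃ (f : ℕ → ℕ → ℝ) (π : ℕ → ℝ) (T : ℕ → ℕ) (I : ℕ → ℕ∞),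
      S.IsOptimal Paver f π ∧
      S.IsDualThreshold f T I ∧
      {p : ℕ × ℕ | (p.1 : ℕ∞) ≤ S.K ∧ 1 ≤ p.2 ∧ p.2 = T p.1 ∧ f p.1 p.2 ≠ 0}.Subsingleton ∧
      {p : ℕ × ℕ | (p.1 : ℕ∞) ≤ S.K ∧ 1 ≤ p.2 ∧ p.2 ≤ S.W ∧
        0 < f p.1 p.2 ∧ f p.1 p.2 < 1}.Subsingleton) ∧
    -- every optimal policy has non-increasing channel thresholds, on the states that occur
    (∀ (f : ℕ → ℕ → ℝ) (π : ℕ → ℝ), S.IsOptimal Paver f π →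
      ∃ T : ℕ → ℕ, (∀ k, T k ≤ S.W) ∧
        (∀ k w, 0 < S.updatedProb π k → 1 ≤ k → 1 ≤ w → w ≤ S.W → 0 < S.η w →
          (w < T k → f k w = 0) ∧ (T k < w → f k w = 1)) ∧
        (∀ k l, 0 < S.updatedProb π k → 0 < S.updatedProb π l → 1 ≤ k → k ≤ l →
          T l ≤ T k)) := by
  rcases (S.θ_nonneg 0).eq_or_lt with hθ | hθ
  · exact SchedModel.hasThresholdStructure_of_zero hrate hθ.symm hfeas
  · exact SchedModel.hasThresholdStructure_of_pos hrate hθ hfeas
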